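/- Let $k$ be a field, $S$ a (graded) commutative differential graded $k$-algebra, and $R$ an augmented (graded) commutative dg $S$-algebra, i.e. $R$ comes with a morphism of dg algebras $R\to S$ which is a retraction of the structure morphism $S\to R$. Let $\mathfrak n=\ker(R\to S)$, so $R=S\oplus\mathfrak n$, and assume $\mathfrak n^2=0$. Let $A$ be a (not necessarily commutative) dg $S$-algebra which is free as a graded $S$-module, and let $M$ be a right dg $A$-module which is free as a graded $S$-module ("free" means: having a basis of homogeneous elements). For a commutative dg algebra $B$ and a dg $B$-algebra $E$, let $\mathcal D_B E$ be the $B$-relative derived category: the category of right dg $E$-modules localized at the morphisms whose restriction to $B$ is a homotopy equivalence of dg $B$-modules. A deformation of $M$ is a pair $(L,u)$ where $L$ is a right dg $A\otimes_S R$-module, free as a graded $R$-module, and $u:L\otimes_R S\to M$ is an isomorphism of $\mathcal D_S A$. Let $\mathrm{Defo}'(M,R\to S)$ be the set of weak deformations of $M$, i.e. of right dg $A\otimes_S R$-modules $L$ that are free as graded $R$-modules and such that $L\otimes_R S$ is isomorphic to $M$ in $\mathcal D_S A$, modulo isomorphism in $\mathcal D_R(A\otimes_S R)$. For a deformation $(L,u)$,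 the sequence of dg $A$-modules $0\to L\otimes_R\mathfrak n\to L\to L\otimes_R S\to 0$ is exact and splits as a sequence of graded $S$-modules. It therefore yields a connecting morphism $\varepsilon':L\otimes_R S\to (L\otimes_R\mathfrak n)[1]$ in $\mathcal D_S A$, namely the composition of the inverse of the $S$-relative quasi-isomorphism $\mathrm{cone}(L\otimes_R\mathfrak n\to L)\to L\otimes_R S$ with $\mathrm{cone}(L\otimes_R\mathfrak n\to L)\to (L\otimes_R\mathfrak n)[1]$, $(x,l)\mapsto -x$. Let $$\varepsilon(L,u)\in\mathrm{Hom}_{\mathcal D_S A}(M,\,M\otimes_S\mathfrak n[1])$$ be the composition of $u^{-1}$, $\varepsilon'$, the canonical isomorphism $(L\otimes_R\mathfrak n)[1]\cong (L\otimes_R S)\otimes_S\mathfrak n[1]$ (which exists since $\mathfrak n^2=0$) and $u\otimes_S\mathfrak n[1]$. The group $\mathrm{Aut}_{\mathcal D_S A}(M)$ acts on the right on $\mathrm{Hom}_{\mathcal D_S A}(M,M\otimes_S\mathfrak n[1])$ by $c\cdot f=(f^{-1}\otimes_S\mathfrak n[1])\circ c\circ f$. Then the map $(L,u)\mapsto\varepsilon(L,u)$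 induces a (well-defined) bijection $$\mathrm{Defo}'(M,R\to S)\;\xrightarrow{\ \sim\ }\;\mathrm{Hom}_{\mathcal D_S A}(M,M\otimes_S\mathfrak n[1])\,/\,\mathrm{Aut}_{\mathcal D_S A}(M),$$ sending, for every deformation $(L,u)$, the class of $L$ to the orbit of $\varepsilon(L,u)$. -/

import Mathlib

open CategoryTheory TensorProduct

universe u

namespace DGDefo

/-- A `ℤ`-grading together with a differential of degree `+1` on a `k`-module. -/
structure DGStr (k : Type u) [Field k] (X : Type u) [AddCommGroup X] [Module k X] where
  deg : ℤ → Submodule k X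
  isInternal : DirectSum.IsInternal deg
  d : X →ₗ[k] X
  d_mem : ∀ {i : ℤ} {x : X}, x ∈ deg i → d x ∈ deg (i + 1)
  d_d : ∀ x : X, d (d x) = 0

section Graded

variable {k : Type u} [Field k]

theorem sgn_congr {e e' : ℤ} (m : ℤ) (h : e = e' + 2 * m) : (-1 : k) ^ e = (-1 : k) ^ e' := by
  subst h
  rw [zpow_add₀ (by simp), zpow_mul]
  simp

theorem sgn_add (e e' : ℤ) : (-1 : k) ^ (e + e') = (-1 : k) ^ e * (-1 : k) ^ e' :=
  zpow_add₀ (by simp) _ _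

variable {X Y Z : Type u} [AddCommGroup X] [Module k X] [AddCommGroup Y] [Module k Y]
  [AddCommGroup Z] [Module k Z]

theorem DGStr.induction (G : DGStr k X) {P : X → Prop} (zero : P 0)
    (add : ∀ x y, P x → P y → P (x + y)) (hom : ∀ i, ∀ x ∈ G.deg i, P x) (x : X) : P x := by
  have hx : x ∈ ⨆ i, G.deg i := by
    rw [G.isInternal.submodule_iSup_eq_top]; trivial
  induction hx using Submodule.iSup_induction' with
  | mem i x hx => exact hom i x hx
  | zero => exact zero
  | add x y _ _ hx hy => exact add x y hx hy

theorem DGStr.hom_ext (G : DGStr k X) {f g : X →ₗ[k] Y}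
    (h : ∀ i, ∀ x ∈ G.deg i, f x = g x) : f = g :=
  LinearMap.ext fun x => G.induction (by simp) (fun x y hx hy => by simp [hx, hy]) h x

/-- The linear map that agrees with `f i` on the homogeneous elements of degree `i`. -/
noncomputable def DGStr.lift (G : DGStr k X) (f : ℤ → X →ₗ[k] Y) : X →ₗ[k] Y :=
  (DirectSum.toModule k ℤ Y fun i => (f i).comp (G.deg i).subtype).comp
    (LinearEquiv.ofBijective (DirectSum.coeLinearMap G.deg) G.isInternal).symm.toLinearMap

theorem DGStr.lift_apply (G : DGStr k X) (f : ℤ → X →ₗ[k] Y) {i : ℤ} {x : X}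
    (hx : x ∈ G.deg i) : G.lift f x = f i x := by
  have : (LinearEquiv.ofBijective (DirectSum.coeLinearMap G.deg) G.isInternal).symm x
      = DirectSum.lof k ℤ (fun i => G.deg i) i ⟨x, hx⟩ := by
    rw [LinearEquiv.symm_apply_eq]
    exact (DirectSum.coeLinearMap_lof G.deg i ⟨x, hx⟩).symm
  simp [DGStr.lift, this]

/-- Projection onto the component of degree `j`. -/
noncomputable def DGStr.proj (G : DGStr k X) (j : ℤ) : X →ₗ[k] X :=
  G.lift fun i => if i = j then LinearMap.id else 0

theorem DGStr.proj_same (G : DGStr k X) {i : ℤ} {x : X} (hx : x ∈ G.deg i) :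
    G.proj i x = x := by
  simp [DGStr.proj, G.lift_apply _ hx]

theorem DGStr.proj_ne (G : DGStr k X) {i j : ℤ} (h : i ≠ j) {x : X} (hx : x ∈ G.deg i) :
    G.proj j x = 0 := by
  simp [DGStr.proj, G.lift_apply _ hx, h]

theorem DGStr.proj_mem (G : DGStr k X) (j : ℤ) (x : X) : G.proj j x ∈ G.deg j := by
  refine G.induction (P := fun x => G.proj j x ∈ G.deg j) (by simp)
    (fun x y hx hy => by simpa using add_mem hx hy) (fun i x hx => ?_) x
  by_cases h : i = j
  · subst h; rwa [G.proj_same hx]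
  · simp [G.proj_ne h hx]

/-- The linear map `x ↦ (-1) ^ (e * |x|) x`. -/
noncomputable def DGStr.sgn (G : DGStr k X) (e : ℤ) : X →ₗ[k] X :=
  G.lift fun i => (-1 : k) ^ (e * i) • LinearMap.id

theorem DGStr.sgn_apply (G : DGStr k X) (e : ℤ) {i : ℤ} {x : X} (hx : x ∈ G.deg i) :
    G.sgn e x = (-1 : k) ^ (e * i) • x := by
  simp [DGStr.sgn, G.lift_apply _ hx]

theorem isInternal_of_proj (D : ℤ → Submodule k X) (p : ℤ → X →ₗ[k] X)
    (hp : ∀ i, ∀ x ∈ D i, p i x = x) (hp' : ∀ i j, i ≠ j → ∀ x ∈ D i, p j x = 0)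
    (htop : ∀ x, x ∈ ⨆ i, D i) : DirectSum.IsInternal D := by
  rw [DirectSum.isInternal_submodule_iff_iSupIndep_and_iSup_eq_top]
  refine ⟨fun i => ?_, eq_top_iff.2 fun x _ => htop x⟩
  rw [Submodule.disjoint_def]
  intro x hx hx'
  have : (⨆ j, ⨆ (_ : j ≠ i), D j) ≤ LinearMap.ker (p i) :=
    iSup₂_le fun j hj x hx => hp' j i hj x hx
  rw [← hp i x hx]
  exact this hx'

end Graded

/-- A (not necessarily commutative) differential graded `k`-algebra. -/
structure DGAlg (k : Type u) [Field k] where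
  carrier : Type u
  [ring : Ring carrier]
  [algebra : Algebra k carrier]
  str : DGStr k carrier
  one_mem : (1 : carrier) ∈ str.deg 0
  mul_mem : ∀ {i j : ℤ} {a b : carrier}, a ∈ str.deg i → b ∈ str.deg j → a * b ∈ str.deg (i + j)
  d_mul : ∀ {i : ℤ} {a : carrier} (b : carrier), a ∈ str.deg i →
    str.d (a * b) = str.d a * b + (-1 : k) ^ i • (a * str.d b)

attribute [instance] DGAlg.ring DGAlg.algebra

instance (k : Type u) [Field k] : CoeSort (DGAlg k) (Type u) := ⟨DGAlg.carrier⟩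

variable {k : Type u} [Field k]

/-- Graded commutativity. -/
def DGAlg.IsComm (A : DGAlg k) : Prop :=
  ∀ (i j : ℤ) (a b : A), a ∈ A.str.deg i → b ∈ A.str.deg j →
    a * b = (-1 : k) ^ (i * j) • (b * a)

theorem DGAlg.d_one (A : DGAlg k) : A.str.d 1 = 0 := by
  have h := A.d_mul (1 : A) A.one_mem
  simpa using h

/-- Morphisms of differential graded algebras. -/
structure DGAlg.Hom (A B : DGAlg k) where
  toAlgHom : A →ₐ[k] B
  map_deg : ∀ {i : ℤ} {a : A}, a ∈ A.str.deg i → toAlgHom a ∈ B.str.deg i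
  map_d : ∀ a : A, toAlgHom (A.str.d a) = B.str.d (toAlgHom a)

instance (A B : DGAlg k) : CoeFun (DGAlg.Hom A B) (fun _ => A → B) := ⟨fun f => f.toAlgHom⟩

/-- A dg algebra over the dg algebra `B`: a dg algebra together with a morphism from `B`
whose image is central in the graded sense. -/
structure DGAlgOver (B : DGAlg k) extends DGAlg k where
  algMap : DGAlg.Hom B toDGAlg
  central : ∀ {i j : ℤ} {b : B} {a : carrier}, b ∈ B.str.deg i → a ∈ str.deg j →
    algMap b * a = (-1 : k) ^ (i * j) • (a * algMap b)

/-- A right dg module over the dg algebra `A`; `act x a` is `x · a`. -/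
structure DGMod (A : DGAlg k) where
  carrier : Type u
  [addCommGroup : AddCommGroup carrier]
  [module : Module k carrier]
  str : DGStr k carrier
  act : carrier →ₗ[k] A →ₗ[k] carrier
  act_one : ∀ x, act x 1 = x
  act_mul : ∀ x a b, act x (a * b) = act (act x a) b
  act_mem : ∀ {i j : ℤ} {x : carrier} {a : A}, x ∈ str.deg i → a ∈ A.str.deg j →
    act x a ∈ str.deg (i + j)
  d_act : ∀ {i : ℤ} {x : carrier} (a : A), x ∈ str.deg i →
    str.d (act x a) = act (str.d x) a + (-1 : k) ^ i • act x (A.str.d a)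

attribute [instance] DGMod.addCommGroup DGMod.module

instance (A : DGAlg k) : CoeSort (DGMod A) (Type u) := ⟨DGMod.carrier⟩

/-- A left dg module over the dg algebra `A`; `act a x` is `a · x`. -/
structure DGLMod (A : DGAlg k) where
  carrier : Type u
  [addCommGroup : AddCommGroup carrier]
  [module : Module k carrier]
  str : DGStr k carrier
  act : A →ₗ[k] carrier →ₗ[k] carrier
  one_act : ∀ x, act 1 x = x
  mul_act : ∀ a b x, act (a * b) x = act a (act b x)
  act_mem : ∀ {i j : ℤ} {a : A} {x : carrier}, a ∈ A.str.deg i → x ∈ str.deg j →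
    act a x ∈ str.deg (i + j)
  d_act : ∀ {i : ℤ} {a : A} (x : carrier), a ∈ A.str.deg i →
    str.d (act a x) = act (A.str.d a) x + (-1 : k) ^ i • act a (str.d x)

attribute [instance] DGLMod.addCommGroup DGLMod.module

instance (A : DGAlg k) : CoeSort (DGLMod A) (Type u) := ⟨DGLMod.carrier⟩

/-- Morphisms of right dg modules: closed homogeneous linear maps of degree zero. -/
@[ext]
structure DGMod.Hom {A : DGAlg k} (X Y : DGMod A) where
  lin : X →ₗ[k] Y
  map_deg : ∀ {i : ℤ} {x : X}, x ∈ X.str.deg i → lin x ∈ Y.str.deg i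
  map_d : ∀ x : X, lin (X.str.d x) = Y.str.d (lin x)
  map_act : ∀ (x : X) (a : A), lin (X.act x a) = Y.act (lin x) a

instance DGMod.category (A : DGAlg k) : Category (DGMod A) where
  Hom := DGMod.Hom
  id X := ⟨LinearMap.id, fun h => h, fun _ => rfl, fun _ _ => rfl⟩
  comp f g := ⟨g.lin.comp f.lin, fun h => g.map_deg (f.map_deg h),
    fun x => by simp [f.map_d, g.map_d], fun x a => by simp [f.map_act, g.map_act]⟩

theorem DGMod.hom_ext {A : DGAlg k} {X Y : DGMod A} {f g : X ⟶ Y}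
    (h : ∀ x : X, f.lin x = g.lin x) : f = g :=
  DGMod.Hom.ext (LinearMap.ext h)

@[simp] theorem DGMod.id_lin {A : DGAlg k} (X : DGMod A) (x : X) :
    DGMod.Hom.lin (𝟙 X) x = x := rfl

@[simp] theorem DGMod.comp_lin {A : DGAlg k} {X Y Z : DGMod A} (f : X ⟶ Y) (g : Y ⟶ Z) (x : X) :
    DGMod.Hom.lin (f ≫ g) x = g.lin (f.lin x) := rfl

/-- Restriction of a right dg module along a morphism of dg algebras. -/
@[reducible] def DGMod.restrict {A B : DGAlg k} (φ : DGAlg.Hom B A) (X : DGMod A) : DGMod B where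
  carrier := X.carrier
  str := X.str
  act := X.act.compl₂ φ.toAlgHom.toLinearMap
  act_one x := by simp [X.act_one]
  act_mul x a b := by simp [X.act_mul]
  act_mem hx ha := X.act_mem hx (φ.map_deg ha)
  d_act a hx := by simp [X.d_act _ hx, φ.map_d]

/-- Restriction as a functor. -/
@[reducible] def DGMod.res {A B : DGAlg k} (φ : DGAlg.Hom B A) : DGMod A ⥤ DGMod B where
  obj X := X.restrict φ
  map f := ⟨f.lin, f.map_deg, f.map_d, fun x a => f.map_act x (φ a)⟩

/-- Restriction of a left dg module along a morphism of dg algebras. -/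
@[reducible] def DGLMod.restrict {A B : DGAlg k} (φ : DGAlg.Hom B A) (X : DGLMod A) :
    DGLMod B where
  carrier := X.carrier
  str := X.str
  act := X.act.comp φ.toAlgHom.toLinearMap
  one_act x := by simp [X.one_act]
  mul_act a b x := by simp [X.mul_act]
  act_mem ha hx := X.act_mem (φ.map_deg ha) hx
  d_act x ha := by simp [X.d_act _ (φ.map_deg ha), φ.map_d]

/-- The dg algebra `A` as a right dg module over itself. -/
@[reducible] def DGMod.self (A : DGAlg k) : DGMod A where
  carrier := A.carrier
  str := A.str
  act := LinearMap.mul k A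
  act_one x := by simp
  act_mul x a b := by simp [mul_assoc]
  act_mem hx ha := A.mul_mem hx ha
  d_act a hx := by simp [A.d_mul _ hx]

/-- The dg algebra `A` as a left dg module over itself. -/
@[reducible] def DGLMod.self (A : DGAlg k) : DGLMod A where
  carrier := A.carrier
  str := A.str
  act := LinearMap.mul k A
  one_act x := by simp
  mul_act x a b := by simp [mul_assoc]
  act_mem hx ha := A.mul_mem hx ha
  d_act a hx := by simp [A.d_mul _ hx]

/-- `X` is free as a graded right `A`-module: it has a basis of homogeneous elements. -/
def DGMod.IsGradedFree {A : DGAlg k} (X : DGMod A) : Prop :=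
  ∃ (I : Type u) (n : I → ℤ) (b : I → X), (∀ i, b i ∈ X.str.deg (n i)) ∧
    Function.Bijective (fun c : I →₀ A => c.sum fun i a => X.act (b i) a)

/-- The kernel of a morphism of dg algebras `A ⟶ B`, as a left dg `A`-module. -/
@[reducible] def DGLMod.ker {A B : DGAlg k} (φ : DGAlg.Hom A B) : DGLMod A where
  carrier := LinearMap.ker φ.toAlgHom.toLinearMap
  str :=
    { deg := fun i => (A.str.deg i).comap (LinearMap.ker φ.toAlgHom.toLinearMap).subtype
      isInternal := by
        have hk : ∀ (j : ℤ) (x : A), φ (A.str.proj j x) = B.str.proj j (φ x) := by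
          intro j x
          refine A.str.induction (P := fun x => φ (A.str.proj j x) = B.str.proj j (φ x))
            (by simp) (fun x y hx hy => by simp [hx, hy]) (fun i x hx => ?_) x
          by_cases h : i = j
          · subst h
            rw [A.str.proj_same hx, B.str.proj_same (φ.map_deg hx)]
          · rw [A.str.proj_ne h hx, B.str.proj_ne h (φ.map_deg hx), map_zero]
        have hk' : ∀ (j : ℤ), ∀ x ∈ LinearMap.ker φ.toAlgHom.toLinearMap,
            A.str.proj j x ∈ LinearMap.ker φ.toAlgHom.toLinearMap := by
          intro j x hx
          have hx' : φ x = 0 := hx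
          have := hk j x
          rw [hx', map_zero] at this
          exact this
        refine isInternal_of_proj _ (fun j => (A.str.proj j).restrict (hk' j)) ?_ ?_ ?_
        · intro i x hx
          exact Subtype.ext (A.str.proj_same hx)
        · intro i j h x hx
          exact Subtype.ext (A.str.proj_ne h hx)
        · intro x
          obtain ⟨s, hs⟩ : ∃ s : Finset ℤ, ∑ j ∈ s, A.str.proj j x = (x : A) := by
            have : ∀ x : A, ∃ s : Finset ℤ, ∀ t, s ⊆ t → ∑ j ∈ t, A.str.proj j x = x := by
              intro x
              refine A.str.induction (P := fun x : A => ∃ s : Finset ℤ, ∀ t, s ⊆ t →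
                ∑ j ∈ t, A.str.proj j x = x) ⟨∅, by simp⟩ ?_ ?_ x
              · rintro x y ⟨s, hs⟩ ⟨t, ht⟩
                refine ⟨s ∪ t, fun r hr => ?_⟩
                simp only [map_add, Finset.sum_add_distrib]
                rw [hs r (Finset.union_subset_left hr), ht r (Finset.union_subset_right hr)]
              · intro i x hx
                refine ⟨{i}, fun t ht => ?_⟩
                rw [Finset.sum_eq_single i, A.str.proj_same hx]
                · intro j _ hj
                  exact A.str.proj_ne hj.symm hx
                · intro h
                  exact absurd (ht (by simp)) h
            obtain ⟨s, hs⟩ := this x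
            exact ⟨s, hs s subset_rfl⟩
          have : x = ∑ j ∈ s, (A.str.proj j).restrict (hk' j) x := by
            apply Subtype.ext
            rw [← hs]
            simp [LinearMap.restrict_apply]
          rw [this]
          refine sum_mem fun j _ => ?_
          exact Submodule.mem_iSup_of_mem j (A.str.proj_mem j x)
      d := A.str.d.restrict fun x hx => by
        have hx' : φ x = 0 := hx
        change φ (A.str.d x) = 0
        rw [φ.map_d, hx', map_zero]
      d_mem := fun hx => A.str.d_mem hx
      d_d := fun x => Subtype.ext (A.str.d_d x) }
  act := LinearMap.mk₂ k (fun a x => ⟨a * x, by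
      have hx : φ x = 0 := x.2
      change φ (a * x) = 0
      rw [map_mul, hx, mul_zero]⟩)
    (fun a b x => Subtype.ext (add_mul _ _ _)) (fun c a x => Subtype.ext (smul_mul_assoc _ _ _))
    (fun a x y => Subtype.ext (mul_add _ _ _)) (fun c a x => Subtype.ext (mul_smul_comm _ _ _))
  one_act x := Subtype.ext (one_mul _)
  mul_act a b x := Subtype.ext (mul_assoc _ _ _)
  act_mem ha hx := A.mul_mem ha hx
  d_act x ha := Subtype.ext (A.d_mul _ ha)

section Tensor

variable {B : DGAlg k} (X : DGMod B) (N : DGLMod B)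

/-- The relations `x b ⊗ n = x ⊗ b n`. -/
def tensRel : Submodule k (X ⊗[k] N) :=
  Submodule.span k {t | ∃ (x : X) (b : B) (n : N), t = X.act x b ⊗ₜ[k] n - x ⊗ₜ[k] N.act b n}

/-- The underlying `k`-module of the tensor product `X ⊗_B N`. -/
@[reducible] def Tens : Type u := (X ⊗[k] N) ⧸ tensRel X N

/-- The pure tensor `x ⊗ n` as a bilinear map. -/
def tmk : X →ₗ[k] N →ₗ[k] Tens X N := (TensorProduct.mk k X N).compr₂ (tensRel X N).mkQ

variable {X N}

theorem tmk_balanced (x : X) (b : B) (n : N) :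
    tmk X N (X.act x b) n = tmk X N x (N.act b n) := by
  rw [← sub_eq_zero]
  change (tensRel X N).mkQ _ - (tensRel X N).mkQ _ = 0
  rw [← map_sub, ← LinearMap.mem_ker, Submodule.ker_mkQ]
  exact Submodule.subset_span ⟨x, b, n, rfl⟩

variable {Y : Type u} [AddCommGroup Y] [Module k Y]

/-- The linear map on `X ⊗_B N` given by a balanced bilinear map. -/
def Tens.lift (f : X →ₗ[k] N →ₗ[k] Y)
    (hf : ∀ (i j l : ℤ), ∀ x ∈ X.str.deg i, ∀ b ∈ B.str.deg j, ∀ n ∈ N.str.deg l,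
      f (X.act x b) n = f x (N.act b n)) : Tens X N →ₗ[k] Y :=
  (tensRel X N).liftQ (TensorProduct.lift f) <| by
    have key : ∀ (x : X) (b : B) (n : N), f (X.act x b) n = f x (N.act b n) := by
      intro x b n
      refine X.str.induction (P := fun x => f (X.act x b) n = f x (N.act b n)) (by simp)
        (fun _ _ h h' => by simp [h, h']) (fun i x hx => ?_) x
      refine B.str.induction (P := fun b => f (X.act x b) n = f x (N.act b n)) (by simp)
        (fun _ _ h h' => by simp [h, h']) (fun j b hb => ?_) b
      exact N.str.induction (P := fun n => f (X.act x b) n = f x (N.act b n)) (by simp)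
        (fun _ _ h h' => by simp [h, h']) (fun l n hn => hf i j l x hx b hb n hn) n
    have h : tensRel X N ≤ LinearMap.ker (TensorProduct.lift f) := by
      unfold tensRel
      refine Submodule.span_le.2 ?_
      rintro _ ⟨x, b, n, rfl⟩
      simp [key]
    exact h

@[simp] theorem Tens.lift_tmk (f : X →ₗ[k] N →ₗ[k] Y) (hf) (x : X) (n : N) :
    Tens.lift f hf (tmk X N x n) = f x n := by
  change (tensRel X N).liftQ _ _ ((tensRel X N).mkQ (x ⊗ₜ n)) = _
  rw [Submodule.mkQ_apply, Submodule.liftQ_apply, TensorProduct.lift.tmul]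

theorem Tens.induction {P : Tens X N → Prop} (zero : P 0)
    (add : ∀ s t, P s → P t → P (s + t))
    (hom : ∀ (i j : ℤ), ∀ x ∈ X.str.deg i, ∀ n ∈ N.str.deg j, P (tmk X N x n))
    (t : Tens X N) : P t := by
  obtain ⟨t, rfl⟩ := Submodule.mkQ_surjective _ t
  induction t using TensorProduct.induction_on with
  | zero => rw [map_zero]; exact zero
  | add s t hs ht => rw [map_add]; exact add _ _ hs ht
  | tmul x n =>
    change P (tmk X N x n)
    refine X.str.induction (P := fun x => P (tmk X N x n)) (by simpa using zero)
        (fun _ _ h h' => by simpa using add _ _ h h') (fun i x hx => ?_) x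
    exact N.str.induction (P := fun n => P (tmk X N x n)) (by simpa using zero)
        (fun _ _ h h' => by simpa using add _ _ h h') (fun j n hn => hom i j x hx n hn) n

theorem Tens.hom_ext {f g : Tens X N →ₗ[k] Y}
    (h : ∀ (i j : ℤ), ∀ x ∈ X.str.deg i, ∀ n ∈ N.str.deg j,
      f (tmk X N x n) = g (tmk X N x n)) : f = g :=
  LinearMap.ext fun t =>
    Tens.induction (P := fun t => f t = g t) (by rw [map_zero, map_zero])
      (fun _ _ hs ht => by rw [map_add, map_add, hs, ht]) h t

/-- Functoriality of `X ⊗_B N` in `X`. -/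
def Tens.map {X X' : DGMod B} (N : DGLMod B) (f : X →ₗ[k] X')
    (hf : ∀ x b, f (X.act x b) = X'.act (f x) b) : Tens X N →ₗ[k] Tens X' N :=
  Tens.lift ((tmk X' N).comp f) fun _ _ _ x _ b _ n _ => by
    simp [hf, tmk_balanced]

@[simp] theorem Tens.map_tmk {X X' : DGMod B} (N : DGLMod B) (f : X →ₗ[k] X') (hf) (x : X)
    (n : N) : Tens.map N f hf (tmk X N x n) = tmk X' N (f x) n := by
  simp [Tens.map]

variable (X N)

/-- The degree `m` part of `X ⊗_B N`, spanned by the `x ⊗ n` with `|x| + |n| = m`. -/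
def Tens.deg (m : ℤ) : Submodule k (Tens X N) :=
  Submodule.span k {t | ∃ (i j : ℤ) (x : X) (n : N),
    x ∈ X.str.deg i ∧ n ∈ N.str.deg j ∧ i + j = m ∧ t = tmk X N x n}

variable {X N}

theorem tmk_mem {i j : ℤ} {x : X} {n : N} (hx : x ∈ X.str.deg i) (hn : n ∈ N.str.deg j) :
    tmk X N x n ∈ Tens.deg X N (i + j) :=
  Submodule.subset_span ⟨i, j, x, n, hx, hn, rfl, rfl⟩

theorem Tens.deg_induction {m : ℤ} {P : Tens X N → Prop} (zero : P 0)
    (add : ∀ s t, P s → P t → P (s + t))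
    (hom : ∀ (i j : ℤ), ∀ x ∈ X.str.deg i, ∀ n ∈ N.str.deg j, i + j = m → P (tmk X N x n))
    {t : Tens X N} (ht : t ∈ Tens.deg X N m) : P t := by
  suffices h : ∀ c : k, P (c • t) by simpa using h 1
  induction ht using Submodule.span_induction with
  | mem t ht =>
    obtain ⟨i, j, x, n, hx, hn, h, rfl⟩ := ht
    intro c
    have := hom i j (c • x) (Submodule.smul_mem _ c hx) n hn h
    simpa using this
  | zero => intro c; simpa using zero
  | add s t _ _ hs ht => intro c; rw [smul_add]; exact add _ _ (hs c) (ht c)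
  | smul a t _ h => intro c; rw [smul_smul]; exact h _

variable (X N)

/-- Projection of `X ⊗_B N` onto its degree `m` part. -/
noncomputable def Tens.proj (m : ℤ) : Tens X N →ₗ[k] Tens X N :=
  Tens.lift (X.str.lift fun i => (tmk X N).compl₂ (N.str.proj (m - i))) <| by
    intro i j l x hx b hb n hn
    rw [X.str.lift_apply _ (X.act_mem hx hb), X.str.lift_apply _ hx]
    simp only [LinearMap.compl₂_apply]
    by_cases h : l = m - (i + j)
    · have hm : j + l = m - i := by omega
      rw [← h, N.str.proj_same hn, ← hm, N.str.proj_same (N.act_mem hb hn), tmk_balanced]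
    · have hm : j + l ≠ m - i := by omega
      rw [N.str.proj_ne h hn, N.str.proj_ne hm (N.act_mem hb hn)]
      simp

theorem Tens.isInternal : DirectSum.IsInternal (Tens.deg X N) := by
  have key : ∀ (m i j : ℤ), ∀ x ∈ X.str.deg i, ∀ n : N,
      Tens.proj X N m (tmk X N x n) = tmk X N x (N.str.proj (m - i) n) := by
    intro m i j x hx n
    simp [Tens.proj, X.str.lift_apply _ hx]
  refine isInternal_of_proj _ (Tens.proj X N) ?_ ?_ ?_
  · intro m t ht
    refine Tens.deg_induction (P := fun t => Tens.proj X N m t = t) (by simp)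
      (fun _ _ h h' => by simp [h, h']) ?_ ht
    intro i j x hx n hn h
    rw [key m i j x hx, show m - i = j by omega, N.str.proj_same hn]
  · intro m m' hm t ht
    refine Tens.deg_induction (P := fun t => Tens.proj X N m' t = 0) (by simp)
      (fun _ _ h h' => by simp [h, h']) ?_ ht
    intro i j x hx n hn h
    rw [key m' i j x hx, N.str.proj_ne (by omega) hn, map_zero]
  · intro t
    refine Tens.induction (P := fun t => t ∈ ⨆ m, Tens.deg X N m) (zero_mem _)
      (fun _ _ h h' => add_mem h h') (fun i j x hx n hn => ?_) t
    exact Submodule.mem_iSup_of_mem (i + j) (tmk_mem hx hn)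

/-- The differential of `X ⊗_B N`: `d (x ⊗ n) = d x ⊗ n + (-1) ^ |x| x ⊗ d n`. -/
noncomputable def Tens.d : Tens X N →ₗ[k] Tens X N :=
  Tens.lift ((tmk X N).comp X.str.d + ((tmk X N).comp (X.str.sgn 1)).compl₂ N.str.d) <| by
    intro i j l x hx b hb n hn
    simp only [LinearMap.add_apply, LinearMap.comp_apply, LinearMap.compl₂_apply]
    rw [X.str.sgn_apply _ (X.act_mem hx hb), X.str.sgn_apply _ hx, X.d_act _ hx, N.d_act _ hb]
    simp only [map_add, map_smul, LinearMap.add_apply, LinearMap.smul_apply, tmk_balanced,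
      one_mul, sgn_add, smul_smul, add_assoc]
    rw [mul_comm ((-1 : k) ^ i)]

theorem Tens.d_tmk {i : ℤ} {x : X} (hx : x ∈ X.str.deg i) (n : N) :
    Tens.d X N (tmk X N x n) =
      tmk X N (X.str.d x) n + (-1 : k) ^ i • tmk X N x (N.str.d n) := by
  simp [Tens.d, X.str.sgn_apply _ hx]

/-- The complex `X ⊗_B N`. -/
noncomputable def Tens.str : DGStr k (Tens X N) where
  deg := Tens.deg X N
  isInternal := Tens.isInternal X N
  d := Tens.d X N
  d_mem {m t} ht := by
    refine Tens.deg_induction (P := fun t => Tens.d X N t ∈ Tens.deg X N (m + 1)) (by simp)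
      (fun _ _ h h' => by rw [map_add]; exact add_mem h h') ?_ ht
    rintro i j x hx n hn rfl
    rw [Tens.d_tmk X N hx]
    refine add_mem ?_ (Submodule.smul_mem _ _ ?_)
    · rw [show i + j + 1 = i + 1 + j by ring]
      exact tmk_mem (X.str.d_mem hx) hn
    · rw [add_assoc]
      exact tmk_mem hx (N.str.d_mem hn)
  d_d t := by
    refine Tens.induction (P := fun t => Tens.d X N (Tens.d X N t) = 0) (by simp)
      (fun _ _ h h' => by simp [h, h']) (fun i j x hx n hn => ?_) t
    rw [Tens.d_tmk X N hx, map_add, map_smul, Tens.d_tmk X N hx,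
      Tens.d_tmk X N (X.str.d_mem hx), X.str.d_d, N.str.d_d, sgn_add]
    simp

variable {X N}

theorem Tens.map_mem {X X' : DGMod B} (N : DGLMod B) (f : X →ₗ[k] X') (hf) {e : ℤ}
    (hdeg : ∀ i, ∀ x ∈ X.str.deg i, f x ∈ X'.str.deg (i + e)) {m : ℤ} {t : Tens X N}
    (ht : t ∈ Tens.deg X N m) : Tens.map N f hf t ∈ Tens.deg X' N (m + e) := by
  refine Tens.deg_induction (P := fun t => Tens.map N f hf t ∈ Tens.deg X' N (m + e)) (by simp)
    (fun _ _ h h' => by rw [map_add]; exact add_mem h h') ?_ ht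
  rintro i j x hx n hn rfl
  rw [Tens.map_tmk, show i + j + e = i + e + j by ring]
  exact tmk_mem (hdeg i x hx) hn

theorem Tens.d_map {X X' : DGMod B} (N : DGLMod B) (f : X →ₗ[k] X') (hf)
    (hdeg : ∀ i, ∀ x ∈ X.str.deg i, f x ∈ X'.str.deg i)
    (hd : ∀ x, f (X.str.d x) = X'.str.d (f x)) (t : Tens X N) :
    Tens.map N f hf (Tens.d X N t) = Tens.d X' N (Tens.map N f hf t) := by
  have : (Tens.map N f hf).comp (Tens.d X N) = (Tens.d X' N).comp (Tens.map N f hf) := by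
    refine Tens.hom_ext fun i j x hx n hn => ?_
    rw [LinearMap.comp_apply, LinearMap.comp_apply, Tens.map_tmk, Tens.d_tmk _ N hx,
      Tens.d_tmk _ N (hdeg i x hx), map_add, map_smul, Tens.map_tmk, Tens.map_tmk, hd]
  exact LinearMap.congr_fun this t

theorem Tens.map_id (N : DGLMod B) (t : Tens X N) :
    Tens.map N (LinearMap.id : X →ₗ[k] X) (fun _ _ => rfl) t = t := by
  have : Tens.map N (LinearMap.id : X →ₗ[k] X) (fun _ _ => rfl) = LinearMap.id := by
    refine Tens.hom_ext fun i j x hx n hn => ?_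
    rw [Tens.map_tmk]; rfl
  exact LinearMap.congr_fun this t

theorem Tens.map_comp {X X' X'' : DGMod B} (N : DGLMod B) (f : X →ₗ[k] X') (g : X' →ₗ[k] X'')
    (hf hg) (h) (t : Tens X N) :
    Tens.map N (g.comp f) h t = Tens.map N g hg (Tens.map N f hf t) := by
  have : Tens.map N (g.comp f) h = (Tens.map N g hg).comp (Tens.map N f hf) := by
    refine Tens.hom_ext fun i j x hx n hn => ?_
    rw [LinearMap.comp_apply, Tens.map_tmk, Tens.map_tmk, Tens.map_tmk]; rfl
  exact LinearMap.congr_fun this t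

end Tensor

section TensorModule

variable {B : DGAlg k} {E : DGAlgOver B}

/-- The trilinear map `(x, n, e) ↦ (-1) ^ (|n| |e|) x e ⊗ n`. -/
noncomputable def Tens.actAux (X : DGMod E.toDGAlg) (N : DGLMod B) :
    E.carrier →ₗ[k] X →ₗ[k] N →ₗ[k] Tens (X.restrict E.algMap) N :=
  E.str.lift fun j =>
    { toFun := fun e => (tmk (X.restrict E.algMap) N).compl₁₂ (X.act.flip e) (N.str.sgn j)
      map_add' := fun a b => by ext; simp
      map_smul' := fun c a => by ext; simp }

theorem Tens.actAux_apply (X : DGMod E.toDGAlg) (N : DGLMod B) {j l : ℤ} {e : E.carrier}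
    (he : e ∈ E.str.deg j) (x : X) {n : N} (hn : n ∈ N.str.deg l) :
    Tens.actAux X N e x n =
      (-1 : k) ^ (j * l) • tmk (X.restrict E.algMap) N (X.act x e) n := by
  simp [Tens.actAux, E.str.lift_apply _ he, N.str.sgn_apply _ hn]

/-- For a dg `B`-algebra `E`, a right dg `E`-module `X` and a left dg `B`-module `N`, the right
action of `E` on `X ⊗_B N`: `(x ⊗ n) · e = (-1) ^ (|n| |e|) x e ⊗ n`. -/
noncomputable def Tens.act (X : DGMod E.toDGAlg) (N : DGLMod B) :
    Tens (X.restrict E.algMap) N →ₗ[k] E.carrier →ₗ[k] Tens (X.restrict E.algMap) N :=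
  Tens.lift (X := X.restrict E.algMap) (N := N)
    (LinearMap.mk₂ k (fun x n => ((Tens.actAux X N).flip x).flip n)
      (fun _ _ _ => by ext; simp) (fun _ _ _ => by ext; simp)
      (fun _ _ _ => by ext; simp) (fun _ _ _ => by ext; simp)) <| by
    intro i j l x hx b hb n hn
    refine E.str.hom_ext fun p e he => ?_
    simp only [LinearMap.mk₂_apply, LinearMap.flip_apply, LinearMap.compl₂_apply]
    rw [Tens.actAux_apply X N he _ hn, Tens.actAux_apply X N he _ (N.act_mem hb hn)]
    rw [← tmk_balanced (X := X.restrict E.algMap)]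
    simp only [LinearMap.compl₂_apply, AlgHom.toLinearMap_apply]
    rw [← X.act_mul, ← X.act_mul, E.central hb he]
    simp only [map_smul, LinearMap.smul_apply, smul_smul, ← sgn_add]
    congr 1
    exact sgn_congr 0 (by ring)

theorem Tens.act_tmk (X : DGMod E.toDGAlg) (N : DGLMod B) {j l : ℤ} {e : E.carrier}
    (he : e ∈ E.str.deg j) (x : X) {n : N} (hn : n ∈ N.str.deg l) :
    Tens.act X N (tmk (X.restrict E.algMap) N x n) e =
      (-1 : k) ^ (j * l) • tmk (X.restrict E.algMap) N (X.act x e) n := by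
  rw [Tens.act, Tens.lift_tmk, LinearMap.mk₂_apply]
  exact Tens.actAux_apply X N he x hn

/-- The right dg `E`-module `X ⊗_B N`. -/
noncomputable def DGMod.tensor (X : DGMod E.toDGAlg) (N : DGLMod B) :
    DGMod E.toDGAlg where
  carrier := Tens (X.restrict E.algMap) N
  str := Tens.str (X.restrict E.algMap) N
  act := Tens.act X N
  act_one t := by
    refine Tens.induction (P := fun t => Tens.act X N t 1 = t) (by simp)
      (fun _ _ h h' => by simp [h, h']) (fun i j x hx n hn => ?_) t
    rw [Tens.act_tmk X N E.one_mem x hn, X.act_one]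
    simp
  act_mul t a b := by
    let Q := fun t a b => Tens.act X N t (a * b) = Tens.act X N (Tens.act X N t a) b
    change Q t a b
    refine E.str.induction (P := fun a => Q t a b) (by simp [Q])
      (fun _ _ h h' => by simp only [Q] at h h' ⊢; simp [add_mul, h, h']) (fun p a ha => ?_) a
    refine E.str.induction (P := fun b => Q t a b) (by simp [Q])
      (fun _ _ h h' => by simp only [Q] at h h' ⊢; simp [mul_add, h, h']) (fun q b hb => ?_) b
    refine Tens.induction (P := fun t => Q t a b) (by simp [Q])
      (fun _ _ h h' => by simp only [Q] at h h' ⊢; simp [h, h']) (fun i j x hx n hn => ?_) t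
    simp only [Q]
    rw [Tens.act_tmk X N (E.mul_mem ha hb) x hn, Tens.act_tmk X N ha x hn, map_smul,
      LinearMap.smul_apply, Tens.act_tmk X N hb _ hn, X.act_mul, smul_smul, ← sgn_add, add_mul]
  act_mem {i j t a} ht ha := by
    refine Tens.deg_induction (P := fun t => Tens.act X N t a ∈ Tens.deg _ N (i + j)) (by simp)
      (fun _ _ h h' => by
        rw [map_add, LinearMap.add_apply]; exact add_mem h h') ?_ ht
    rintro p q x hx n hn rfl
    rw [Tens.act_tmk X N ha x hn]
    refine Submodule.smul_mem _ _ ?_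
    rw [show p + q + j = p + j + q by ring]
    exact tmk_mem (X := X.restrict E.algMap) (X.act_mem hx ha) hn
  d_act {i t} a ht := by
    change Tens.d _ N _ = Tens.act X N (Tens.d _ N _) _ + _
    refine E.str.induction (P := fun a => Tens.d _ N (Tens.act X N t a) =
      Tens.act X N (Tens.d _ N t) a + (-1 : k) ^ i • Tens.act X N t (E.str.d a)) (by simp)
      (fun _ _ h h' => by simp only [map_add, h, h', smul_add]; abel) (fun p a ha => ?_) a
    refine Tens.deg_induction (P := fun t => Tens.d _ N (Tens.act X N t a) =
      Tens.act X N (Tens.d _ N t) a + (-1 : k) ^ i • Tens.act X N t (E.str.d a)) (by simp)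
      (fun _ _ h h' => by simp only [map_add, LinearMap.add_apply, h, h', smul_add]; abel) ?_ ht
    rintro q l x hx n hn rfl
    rw [Tens.act_tmk X N ha x hn, map_smul, Tens.d_tmk _ N (X.act_mem hx ha),
      Tens.d_tmk _ N hx, map_add, LinearMap.add_apply, Tens.act_tmk X N ha _ hn, map_smul,
      LinearMap.smul_apply, Tens.act_tmk X N ha _ (N.str.d_mem hn),
      Tens.act_tmk X N (E.str.d_mem ha) x hn, X.d_act _ hx]
    simp only [map_add, map_smul, LinearMap.add_apply, LinearMap.smul_apply, smul_add, smul_smul,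
      ← sgn_add]
    rw [sgn_congr (k := k) (e := q + l + (p + 1) * l) (e' := p * l + q) l (by ring),
      sgn_congr (k := k) (e := p * l + (q + p)) (e' := q + p * (l + 1)) 0 (by ring)]
    abel

theorem Tens.map_act {X Y : DGMod E.toDGAlg} (N : DGLMod B)
    (f : X.restrict E.algMap →ₗ[k] Y.restrict E.algMap)
    (hf : ∀ x a, f (X.act x a) = Y.act (f x) a)
    (hf' : ∀ x b, f ((X.restrict E.algMap).act x b) = (Y.restrict E.algMap).act (f x) b)
    (t : Tens (X.restrict E.algMap) N) (a : E.carrier) :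
    Tens.map N f hf' (Tens.act X N t a) = Tens.act Y N (Tens.map N f hf' t) a := by
  have : (Tens.act X N).compr₂ (Tens.map N f hf') = (Tens.act Y N).comp (Tens.map N f hf') := by
    refine Tens.hom_ext fun i j x hx n hn => E.str.hom_ext fun p a ha => ?_
    rw [LinearMap.compr₂_apply, LinearMap.comp_apply, Tens.act_tmk X N ha x hn, map_smul,
      Tens.map_tmk, Tens.map_tmk, Tens.act_tmk Y N ha _ hn, hf]
  exact LinearMap.congr_fun (LinearMap.congr_fun this t) a

/-- The morphism `f ⊗_B N`. -/
noncomputable def DGMod.tensorMap {X Y : DGMod E.toDGAlg} (f : X ⟶ Y) (N : DGLMod B) :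
    X.tensor N ⟶ Y.tensor N where
  lin := Tens.map (X := X.restrict E.algMap) (X' := Y.restrict E.algMap) N f.lin
    fun x b => f.map_act x _
  map_deg := fun {i t} ht => by
    have := Tens.map_mem (X := X.restrict E.algMap) (X' := Y.restrict E.algMap) N f.lin
      (fun x b => f.map_act x _) (e := 0) (fun i x hx => by simpa using f.map_deg hx) ht
    rwa [add_zero] at this
  map_d := Tens.d_map (X := X.restrict E.algMap) (X' := Y.restrict E.algMap) N f.lin
    (fun x b => f.map_act x _) (fun _ _ h => f.map_deg h) f.map_d
  map_act := Tens.map_act N f.lin f.map_act _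

/-- The functor `- ⊗_B N` on right dg `E`-modules. -/
noncomputable def DGMod.tensorFunctor (E : DGAlgOver B) (N : DGLMod B) :
    DGMod E.toDGAlg ⥤ DGMod E.toDGAlg where
  obj X := X.tensor N
  map f := DGMod.tensorMap f N
  map_id X := DGMod.hom_ext fun t => Tens.map_id (X := X.restrict E.algMap) N t
  map_comp {X Y Z} f g := DGMod.hom_ext fun t =>
    Tens.map_comp (X := X.restrict E.algMap) (X' := Y.restrict E.algMap)
      (X'' := Z.restrict E.algMap) N f.lin g.lin (fun x _ => f.map_act x _)
      (fun x _ => g.map_act x _) (fun x _ => (f ≫ g).map_act x _) t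

end TensorModule

section BaseChange

variable {S : DGAlg k} (A R : DGAlgOver S)

/-- The underlying `k`-module of `A ⊗_S R`. -/
@[reducible] def BC : Type u :=
  Tens ((DGMod.self A.toDGAlg).restrict A.algMap) ((DGLMod.self R.toDGAlg).restrict R.algMap)

variable {A R}

/-- The pure tensor `a ⊗ r` in `A ⊗_S R`. -/
def bmk : A.carrier →ₗ[k] R.carrier →ₗ[k] BC A R :=
  tmk ((DGMod.self A.toDGAlg).restrict A.algMap) ((DGLMod.self R.toDGAlg).restrict R.algMap)

theorem bmk_balanced (a : A.carrier) (s : S) (r : R.carrier) :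
    (bmk (a * A.algMap s) r : BC A R) = bmk a (R.algMap s * r) :=
  tmk_balanced (X := (DGMod.self A.toDGAlg).restrict A.algMap)
    (N := (DGLMod.self R.toDGAlg).restrict R.algMap) a s r

variable (A R) in
/-- Right multiplication by `R` on `A ⊗_S R`. -/
def BC.rmul : BC A R →ₗ[k] R.carrier →ₗ[k] BC A R :=
  Tens.lift (LinearMap.mk₂ k (fun a r => (bmk a).comp (LinearMap.mulLeft k r))
    (fun _ _ _ => by ext; simp) (fun _ _ _ => by ext; simp)
    (fun _ _ _ => by ext; simp [add_mul]) (fun _ _ _ => by ext; simp)) <| by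
    intro i j l x hx b hb n hn
    ext r
    simp only [LinearMap.mk₂_apply, LinearMap.comp_apply, LinearMap.mulLeft_apply]
    exact (bmk_balanced (A := A) (R := R) x b (n * r)).trans (by
      simp [mul_assoc])

theorem BC.rmul_bmk (a : A.carrier) (r r' : R.carrier) :
    BC.rmul A R (bmk a r) r' = bmk a (r * r') := by
  unfold BC.rmul
  erw [Tens.lift_tmk]
  rfl

variable (A R) in
/-- Right multiplication by `A` on `A ⊗_S R`: `(a ⊗ r) a' = (-1) ^ (|r| |a'|) a a' ⊗ r`. -/
noncomputable def BC.amul : BC A R →ₗ[k] A.carrier →ₗ[k] BC A R :=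
  Tens.act (DGMod.self A.toDGAlg) ((DGLMod.self R.toDGAlg).restrict R.algMap)

theorem BC.amul_bmk {i j : ℤ} (a : A.carrier) {r : R.carrier} {a' : A.carrier}
    (hr : r ∈ R.str.deg i) (ha : a' ∈ A.str.deg j) :
    BC.amul A R (bmk a r) a' = (-1 : k) ^ (i * j) • bmk (a * a') r := by
  rw [mul_comm i j]
  exact Tens.act_tmk (DGMod.self A.toDGAlg) ((DGLMod.self R.toDGAlg).restrict R.algMap) ha a hr

theorem BC.induction {P : BC A R → Prop} (zero : P 0)
    (add : ∀ s t, P s → P t → P (s + t))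
    (hom : ∀ (i j : ℤ), ∀ a ∈ A.str.deg i, ∀ r ∈ R.str.deg j, P (bmk a r))
    (t : BC A R) : P t :=
  Tens.induction zero add hom t

variable (A R) in
/-- Multiplication on `A ⊗_S R`: `(a ⊗ r) (a' ⊗ r') = (-1) ^ (|r| |a'|) a a' ⊗ r r'`. -/
noncomputable def BC.mul : BC A R →ₗ[k] BC A R →ₗ[k] BC A R :=
  LinearMap.flip <| Tens.lift (LinearMap.mk₂ k
    (fun a' r' => ((BC.rmul A R).flip r').comp ((BC.amul A R).flip a'))
    (fun _ _ _ => LinearMap.ext fun _ => by simp) (fun _ _ _ => LinearMap.ext fun _ => by simp)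
    (fun _ _ _ => LinearMap.ext fun _ => by simp)
    (fun _ _ _ => LinearMap.ext fun _ => by simp)) <| by
    intro i j l a' ha' s hs r' hr'
    refine LinearMap.ext fun t => ?_
    simp only [LinearMap.mk₂_apply, LinearMap.comp_apply, LinearMap.flip_apply]
    change BC.rmul A R (BC.amul A R t (a' * A.algMap s)) r' =
      BC.rmul A R (BC.amul A R t a') (R.algMap s * r')
    refine BC.induction (P := fun t => BC.rmul A R (BC.amul A R t (a' * A.algMap s)) r' =
      BC.rmul A R (BC.amul A R t a') (R.algMap s * r')) (by simp)
      (fun _ _ h h' => by simp [h, h']) (fun p q a ha r hr => ?_) t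
    rw [BC.amul_bmk a hr ha', BC.amul_bmk a hr (A.mul_mem ha' (A.algMap.map_deg hs)),
      map_smul, map_smul, LinearMap.smul_apply, LinearMap.smul_apply, BC.rmul_bmk, BC.rmul_bmk,
      ← mul_assoc, bmk_balanced, ← mul_assoc, ← mul_assoc, R.central hs hr, smul_mul_assoc,
      map_smul, smul_smul, ← sgn_add]
    congr 1
    exact sgn_congr (j * q) (by ring)

theorem BC.mul_bmk {i j : ℤ} (a : A.carrier) {r : R.carrier} {a' : A.carrier} (r' : R.carrier)
    (hr : r ∈ R.str.deg i) (ha : a' ∈ A.str.deg j) :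
    BC.mul A R (bmk a r) (bmk a' r') = (-1 : k) ^ (i * j) • bmk (a * a') (r * r') := by
  have : BC.mul A R (bmk a r) (bmk a' r') =
      BC.rmul A R (BC.amul A R (bmk a r) a') r' := by
    unfold BC.mul
    rw [LinearMap.flip_apply]
    erw [Tens.lift_tmk]
    rfl
  rw [this, BC.amul_bmk a hr ha, map_smul, LinearMap.smul_apply, BC.rmul_bmk]

theorem BC.mul_assoc' (x y z : BC A R) :
    BC.mul A R (BC.mul A R x y) z = BC.mul A R x (BC.mul A R y z) := by
  let Q := fun x y z => BC.mul A R (BC.mul A R x y) z = BC.mul A R x (BC.mul A R y z)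
  change Q x y z
  refine BC.induction (P := fun x => Q x y z) (by simp [Q])
    (fun _ _ h h' => by simp only [Q] at h h' ⊢; simp [h, h']) (fun i j a ha r hr => ?_) x
  refine BC.induction (P := fun y => Q _ y z) (by simp [Q])
    (fun _ _ h h' => by simp only [Q] at h h' ⊢; simp [h, h']) (fun i' j' a' ha' r' hr' => ?_) y
  refine BC.induction (P := fun z => Q _ _ z) (by simp [Q])
    (fun _ _ h h' => by simp only [Q] at h h' ⊢; simp [h, h'])
    (fun i'' j'' a'' ha'' r'' hr'' => ?_) z
  simp only [Q]
  rw [BC.mul_bmk a r' hr ha', BC.mul_bmk a' r'' hr' ha'', map_smul, map_smul,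
    LinearMap.smul_apply, BC.mul_bmk _ r'' (R.mul_mem hr hr') ha'',
    BC.mul_bmk a _ hr (A.mul_mem ha' ha''), smul_smul, smul_smul, ← sgn_add, ← sgn_add,
    mul_assoc, mul_assoc]
  congr 1
  exact sgn_congr 0 (by ring)

theorem BC.one_mul' (x : BC A R) : BC.mul A R (bmk 1 1) x = x := by
  refine BC.induction (P := fun x => BC.mul A R (bmk 1 1) x = x) (by simp)
    (fun _ _ h h' => by simp [h, h']) (fun i j a ha r hr => ?_) x
  rw [BC.mul_bmk 1 r R.one_mem ha]
  simp

theorem BC.mul_one' (x : BC A R) : BC.mul A R x (bmk 1 1) = x := by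
  refine BC.induction (P := fun x => BC.mul A R x (bmk 1 1) = x) (by simp)
    (fun _ _ h h' => by simp [h, h']) (fun i j a ha r hr => ?_) x
  rw [BC.mul_bmk a 1 hr A.one_mem]
  simp

variable (A R) in
/-- The ring structure of `A ⊗_S R`. -/
@[reducible] noncomputable def BC.ring : Ring (BC A R) :=
  { (inferInstance : AddCommGroup (BC A R)) with
    mul := fun x y => BC.mul A R x y
    one := bmk 1 1
    mul_assoc := BC.mul_assoc'
    one_mul := BC.one_mul'
    mul_one := BC.mul_one'
    zero_mul := fun x => by change BC.mul A R 0 x = 0; simp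
    mul_zero := fun x => by change BC.mul A R x 0 = 0; simp
    left_distrib := fun x y z => map_add (BC.mul A R x) y z
    right_distrib := fun x y z => by
      change BC.mul A R (x + y) z = BC.mul A R x z + BC.mul A R y z; simp }

variable (A R) in
/-- The `k`-algebra structure of `A ⊗_S R`. -/
@[reducible] noncomputable def BC.algebra :
    @Algebra k (BC A R) _ (BC.ring A R).toSemiring :=
  letI := BC.ring A R
  Algebra.ofModule (fun c x y => by
    change BC.mul A R (c • x) y = c • BC.mul A R x y; simp)
    (fun c x y => map_smul (BC.mul A R x) c y)

variable (A R) in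
/-- The grading and the differential of `A ⊗_S R`. -/
noncomputable def BC.str : DGStr k (BC A R) :=
  Tens.str ((DGMod.self A.toDGAlg).restrict A.algMap)
    ((DGLMod.self R.toDGAlg).restrict R.algMap)

theorem BC.bmk_mem {i j m : ℤ} {a : A.carrier} {r : R.carrier} (ha : a ∈ A.str.deg i)
    (hr : r ∈ R.str.deg j) (h : i + j = m) : (bmk a r : BC A R) ∈ (BC.str A R).deg m := by
  subst h
  exact tmk_mem ha hr

theorem BC.deg_induction {m : ℤ} {P : BC A R → Prop} (zero : P 0)
    (add : ∀ s t, P s → P t → P (s + t))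
    (hom : ∀ (i j : ℤ), ∀ a ∈ A.str.deg i, ∀ r ∈ R.str.deg j, i + j = m → P (bmk a r))
    {t : BC A R} (ht : t ∈ (BC.str A R).deg m) : P t :=
  Tens.deg_induction zero add hom ht

theorem BC.d_bmk {i : ℤ} {a : A.carrier} (ha : a ∈ A.str.deg i) (r : R.carrier) :
    (BC.str A R).d (bmk a r) =
      bmk (A.str.d a) r + (-1 : k) ^ i • bmk a (R.str.d r) :=
  Tens.d_tmk ((DGMod.self A.toDGAlg).restrict A.algMap)
    ((DGLMod.self R.toDGAlg).restrict R.algMap) ha r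

theorem BC.mul_mem' {i j : ℤ} {x y : BC A R} (hx : x ∈ (BC.str A R).deg i)
    (hy : y ∈ (BC.str A R).deg j) : BC.mul A R x y ∈ (BC.str A R).deg (i + j) := by
  refine BC.deg_induction (P := fun x => BC.mul A R x y ∈ (BC.str A R).deg (i + j)) (by simp)
    (fun _ _ h h' => by
      simp only [map_add, LinearMap.add_apply]; exact add_mem h h')
    (fun p q a ha r hr h => ?_) hx
  refine BC.deg_induction (P := fun y => BC.mul A R _ y ∈ (BC.str A R).deg (i + j)) (by simp)
    (fun _ _ h h' => by simp only [map_add]; exact add_mem h h')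
    (fun p' q' a' ha' r' hr' h' => ?_) hy
  rw [BC.mul_bmk a r' hr ha']
  exact Submodule.smul_mem _ _ (BC.bmk_mem (A.mul_mem ha ha') (R.mul_mem hr hr') (by omega))

theorem BC.d_mul' {i : ℤ} {x : BC A R} (y : BC A R) (hx : x ∈ (BC.str A R).deg i) :
    (BC.str A R).d (BC.mul A R x y) = BC.mul A R ((BC.str A R).d x) y +
      (-1 : k) ^ i • BC.mul A R x ((BC.str A R).d y) := by
  let Q := fun x y => (BC.str A R).d (BC.mul A R x y) = BC.mul A R ((BC.str A R).d x) y +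
      (-1 : k) ^ i • BC.mul A R x ((BC.str A R).d y)
  change Q x y
  refine BC.deg_induction (P := fun x => Q x y) (by simp [Q])
    (fun _ _ h h' => by
      simp only [Q] at h h' ⊢
      simp only [map_add, LinearMap.add_apply, h, h', smul_add]; abel)
    (fun p q a ha r hr h => ?_) hx
  refine BC.induction (P := fun y => Q _ y) (by simp [Q])
    (fun _ _ h h' => by
      simp only [Q] at h h' ⊢
      simp only [map_add, h, h', smul_add]; abel)
    (fun p' q' a' ha' r' hr' => ?_) y
  simp only [Q]
  rw [BC.mul_bmk a r' hr ha', map_smul, BC.d_bmk (A.mul_mem ha ha'), BC.d_bmk ha,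
    BC.d_bmk ha', map_add, map_add, LinearMap.add_apply, map_smul, map_smul,
    LinearMap.smul_apply, BC.mul_bmk _ r' hr ha', BC.mul_bmk _ r' (R.str.d_mem hr) ha',
    BC.mul_bmk _ r' hr (A.str.d_mem ha'), BC.mul_bmk _ _ hr ha', A.d_mul _ ha, R.d_mul _ hr,
    ← h]
  simp only [map_add, map_smul, LinearMap.add_apply, LinearMap.smul_apply, smul_add, smul_smul,
      ← sgn_add]
  rw [sgn_congr (k := k) (e := p + q + q * (p' + 1)) (e' := q * p' + p) q (by ring),
    sgn_congr (k := k) (e := p + (q + 1) * p') (e' := q * p' + (p + p')) 0 (by ring),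
    sgn_congr (k := k) (e := p + q + (p' + q * p')) (e' := q * p' + (p + p' + q)) 0 (by ring)]
  abel

variable (A R) in
/-- The dg algebra `A ⊗_S R`. -/
noncomputable def tensorAlg : DGAlg k :=
  letI := BC.ring A R
  letI := BC.algebra A R
  { carrier := BC A R
    str := BC.str A R
    one_mem := BC.bmk_mem A.one_mem R.one_mem (by simp)
    mul_mem := BC.mul_mem'
    d_mul := BC.d_mul' }

theorem tensorAlg_mul (a a' : A.carrier) (r r' : R.carrier) {i j : ℤ}
    (hr : r ∈ R.str.deg i) (ha : a' ∈ A.str.deg j) :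
    (HMul.hMul (α := tensorAlg A R) (β := tensorAlg A R) (bmk a r) (bmk a' r')) =
      (-1 : k) ^ (i * j) • bmk (a * a') (r * r') :=
  BC.mul_bmk a r' hr ha

variable (A R) in
/-- The morphism `A ⟶ A ⊗_S R`, `a ↦ a ⊗ 1`. -/
noncomputable def tensorInl : DGAlg.Hom A.toDGAlg (tensorAlg A R) where
  toAlgHom :=
    letI f : A.toDGAlg →ₗ[k] tensorAlg A R := (bmk (A := A) (R := R)).flip 1
    AlgHom.ofLinearMap f rfl fun a b => by
      refine A.str.induction (P := fun b => f (a * b) = f a * f b) (by simp)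
        (fun x y h h' => by simp only [mul_add, map_add, h, h']) (fun i b hb => ?_) b
      refine ((tensorAlg_mul (A := A) (R := R) a b 1 1 R.one_mem hb).trans ?_).symm
      simp [f]
      rfl
  map_deg h := BC.bmk_mem h R.one_mem (by simp)
  map_d a := by
    refine A.str.induction (P := fun a => (bmk (A.str.d a) 1 : BC A R) =
      (BC.str A R).d (bmk a 1)) (by simp) (fun x y h h' => by simp [h, h']) (fun i a ha => ?_) a
    rw [BC.d_bmk ha, R.d_one]
    simp

variable (A R) in
/-- The morphism `R ⟶ A ⊗_S R`, `r ↦ 1 ⊗ r`. -/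
noncomputable def tensorInr : DGAlg.Hom R.toDGAlg (tensorAlg A R) where
  toAlgHom :=
    letI f : R.toDGAlg →ₗ[k] tensorAlg A R := bmk (A := A) (R := R) 1
    AlgHom.ofLinearMap f rfl fun a b => by
      refine R.str.induction (P := fun a => f (a * b) = f a * f b) (by simp)
        (fun x y h h' => by simp only [add_mul, map_add, h, h']) (fun i a ha => ?_) a
      refine ((tensorAlg_mul (A := A) (R := R) 1 1 a b ha A.one_mem).trans ?_).symm
      simp [f]
      rfl
  map_deg h := BC.bmk_mem A.one_mem h (by simp)
  map_d a := by
    change (bmk 1 (R.str.d a) : BC A R) = (BC.str A R).d (bmk 1 a)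
    rw [BC.d_bmk A.one_mem, A.d_one]
    simp

theorem tensorInl_algMap (s : S) :
    tensorInl A R (A.algMap s) = tensorInr A R (R.algMap s) := by
  have h := bmk_balanced (A := A) (R := R) 1 s 1
  rw [one_mul, mul_one] at h
  exact h

variable (A R) in
/-- For graded commutative `R`, the dg `R`-algebra `A ⊗_S R`. -/
noncomputable def baseChange (hR : R.IsComm) : DGAlgOver R.toDGAlg where
  toDGAlg := tensorAlg A R
  algMap := tensorInr A R
  central {i j r x} hr hx := by
    change BC.mul A R (bmk 1 r) x = (-1 : k) ^ (i * j) • BC.mul A R x (bmk 1 r)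
    refine BC.deg_induction (P := fun x => BC.mul A R (bmk 1 r) x =
      (-1 : k) ^ (i * j) • BC.mul A R x (bmk 1 r)) (by simp)
      (fun _ _ h h' => by simp only [map_add, LinearMap.add_apply, h, h', smul_add])
      (fun p q a ha r' hr' h => ?_) hx
    rw [BC.mul_bmk 1 r' hr ha, BC.mul_bmk a r hr' A.one_mem, hR i q r r' hr hr', map_smul,
      smul_smul, smul_smul, ← sgn_add, ← sgn_add, one_mul, mul_one, ← h]
    congr 1
    exact sgn_congr 0 (by ring)

end BaseChange

section Homotopy

variable {B : DGAlg k}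

/-- Two morphisms of right dg modules are homotopic: `f - g = d h + h d` for some homogeneous
linear `h` of degree `-1`. -/
def DGMod.Homotopic {X Y : DGMod B} (f g : X ⟶ Y) : Prop :=
  ∃ h : X →ₗ[k] Y, (∀ i, ∀ x ∈ X.str.deg i, h x ∈ Y.str.deg (i - 1)) ∧
    (∀ x b, h (X.act x b) = Y.act (h x) b) ∧
    ∀ x, f.lin x - g.lin x = Y.str.d (h x) + h (X.str.d x)

/-- Homotopy equivalences of right dg modules. -/
def DGMod.IsHtpyEquiv {X Y : DGMod B} (f : X ⟶ Y) : Prop :=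
  ∃ g : Y ⟶ X, DGMod.Homotopic (f ≫ g) (𝟙 X) ∧ DGMod.Homotopic (g ≫ f) (𝟙 Y)

/-- The `B`-relative quasi-isomorphisms of right dg `E`-modules: the morphisms whose restriction
to `B` is a homotopy equivalence. -/
def relQis (E : DGAlgOver B) : MorphismProperty (DGMod E.toDGAlg) :=
  fun _ _ f => DGMod.IsHtpyEquiv ((DGMod.res E.algMap).map f)

/-- The `B`-relative derived category of the dg `B`-algebra `E`. -/
abbrev RelD (E : DGAlgOver B) : Type (u + 1) := (relQis E).Localization

/-- The localization functor to the relative derived category. -/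
abbrev relQ (E : DGAlgOver B) : DGMod E.toDGAlg ⥤ RelD E := (relQis E).Q

end Homotopy

section ShiftCone

variable {A : DGAlg k}

/-- The shift `X[1]`: `X[1]^p = X^(p+1)` with differential `-d`. -/
@[reducible] def DGMod.shift (X : DGMod A) : DGMod A where
  carrier := X.carrier
  str :=
    { deg := fun i => X.str.deg (i + 1)
      isInternal := by
        refine isInternal_of_proj _ (fun i => X.str.proj (i + 1))
          (fun i x hx => X.str.proj_same hx)
          (fun i j h x hx => X.str.proj_ne (by omega) hx) (fun x => ?_)
        refine X.str.induction (P := fun x => x ∈ ⨆ i, X.str.deg (i + 1)) (zero_mem _)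
          (fun _ _ h h' => add_mem h h') (fun i x hx => ?_) x
        exact Submodule.mem_iSup_of_mem (i - 1) (by simpa using hx)
      d := -X.str.d
      d_mem := fun hx => neg_mem (X.str.d_mem hx)
      d_d := fun x => by simp [X.str.d_d] }
  act := X.act
  act_one := X.act_one
  act_mul := X.act_mul
  act_mem {i j x a} hx ha := by
    change X.act x a ∈ X.str.deg (i + j + 1)
    rw [show i + j + 1 = i + 1 + j by ring]
    exact X.act_mem hx ha
  d_act {i x} a hx := by
    simp only [LinearMap.neg_apply]
    rw [X.d_act a hx, sgn_add]
    simp [add_comm]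

/-- The shift functor. -/
@[reducible] def DGMod.shiftFunctor (A : DGAlg k) : DGMod A ⥤ DGMod A where
  obj X := X.shift
  map {X Y} f := ⟨f.lin, fun h => f.map_deg h, fun x => by simp [f.map_d], f.map_act⟩

/-- The mapping cone of `f : X ⟶ Y`: `X[1] ⊕ Y` with `d (x, y) = (- d x, f x + d y)`. -/
@[reducible] def DGMod.cone {X Y : DGMod A} (f : X ⟶ Y) : DGMod A where
  carrier := X × Y
  str :=
    { deg := fun i => (X.str.deg (i + 1)).prod (Y.str.deg i)
      isInternal := by
        refine isInternal_of_proj _ (fun i => (X.str.proj (i + 1)).prodMap (Y.str.proj i))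
          (fun i x hx => Prod.ext (X.str.proj_same hx.1) (Y.str.proj_same hx.2))
          (fun i j h x hx => Prod.ext (X.str.proj_ne (by omega) hx.1) (Y.str.proj_ne h hx.2))
          (fun x => ?_)
        have h1 : ∀ x : X, (x, (0 : Y)) ∈ ⨆ i, (X.str.deg (i + 1)).prod (Y.str.deg i) := by
          intro x
          refine X.str.induction (P := fun x =>
            (x, (0 : Y)) ∈ ⨆ i, (X.str.deg (i + 1)).prod (Y.str.deg i)) (zero_mem _)
            (fun _ _ h h' => by simpa using add_mem h h') (fun i x hx => ?_) x
          exact Submodule.mem_iSup_of_mem (i - 1) ⟨by simpa using hx, zero_mem _⟩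
        have h2 : ∀ y : Y, ((0 : X), y) ∈ ⨆ i, (X.str.deg (i + 1)).prod (Y.str.deg i) := by
          intro y
          refine Y.str.induction (P := fun y =>
            ((0 : X), y) ∈ ⨆ i, (X.str.deg (i + 1)).prod (Y.str.deg i)) (zero_mem _)
            (fun _ _ h h' => by simpa using add_mem h h') (fun i y hy => ?_) y
          exact Submodule.mem_iSup_of_mem i ⟨zero_mem _, hy⟩
        have := add_mem (h1 x.1) (h2 x.2)
        simpa using this
      d := (-(X.str.d.comp (LinearMap.fst k X Y))).prod
        (f.lin.comp (LinearMap.fst k X Y) + Y.str.d.comp (LinearMap.snd k X Y))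
      d_mem := fun {i x} hx =>
        ⟨neg_mem (X.str.d_mem hx.1), add_mem (f.map_deg hx.1) (Y.str.d_mem hx.2)⟩
      d_d := fun x => by simp [X.str.d_d, Y.str.d_d, f.map_d] }
  act := LinearMap.mk₂ k (fun x a => (X.act x.1 a, Y.act x.2 a))
    (fun _ _ _ => by simp) (fun _ _ _ => by simp) (fun _ _ _ => by simp) (fun _ _ _ => by simp)
  act_one x := by simp [X.act_one, Y.act_one]
  act_mul x a b := by simp [X.act_mul, Y.act_mul]
  act_mem {i j x a} hx ha := by
    refine ⟨?_, Y.act_mem hx.2 ha⟩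
    rw [show i + j + 1 = i + 1 + j by ring]
    exact X.act_mem hx.1 ha
  d_act {i x} a hx := by
    refine Prod.ext ?_ ?_
    · simp [X.d_act a hx.1, sgn_add, add_comm]
    · simp [Y.d_act a hx.2, f.map_act, add_assoc]

/-- The morphism `cone f ⟶ Z`, `(x, y) ↦ g y`, for `g : Y ⟶ Z` with `g f = 0`. -/
def DGMod.coneDesc {X Y Z : DGMod A} (f : X ⟶ Y) (g : Y ⟶ Z)
    (w : ∀ x, g.lin (f.lin x) = 0) : DGMod.cone f ⟶ Z where
  lin := g.lin.comp (LinearMap.snd k X Y)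
  map_deg h := g.map_deg h.2
  map_d x := by simp [w, g.map_d]
  map_act x a := by simp [g.map_act]

/-- The morphism `cone f ⟶ X[1]`, `(x, y) ↦ - x`. -/
def DGMod.coneFst {X Y : DGMod A} (f : X ⟶ Y) : DGMod.cone f ⟶ X.shift where
  lin := -LinearMap.fst k X Y
  map_deg h := neg_mem h.1
  map_d x := by simp
  map_act x a := by simp

end ShiftCone

section Split

variable {S : DGAlg k} (A : DGAlgOver S) {X Y Z : DGMod A.toDGAlg}

/-- If `X ⟶ Y ⟶ Z` is split exact as a sequence of graded `S`-modules, then `cone f ⟶ Z` is an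
`S`-relative quasi-isomorphism. -/
theorem relQis_coneDesc (f : X ⟶ Y) (g : Y ⟶ Z) (w : ∀ x, g.lin (f.lin x) = 0)
    (r : Y →ₗ[k] X) (t : Z →ₗ[k] Y)
    (hr : ∀ i, ∀ y ∈ Y.str.deg i, r y ∈ X.str.deg i)
    (ht : ∀ i, ∀ z ∈ Z.str.deg i, t z ∈ Y.str.deg i)
    (hrs : ∀ y (s : S), r (Y.act y (A.algMap s)) = X.act (r y) (A.algMap s))
    (hts : ∀ z (s : S), t (Z.act z (A.algMap s)) = Y.act (t z) (A.algMap s))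
    (hrf : ∀ x, r (f.lin x) = x) (hgt : ∀ z, g.lin (t z) = z)
    (hfg : ∀ y, f.lin (r y) + t (g.lin y) = y) : relQis A (DGMod.coneDesc f g w) := by
  have hrt : ∀ z, r (t z) = 0 := by
    intro z
    have h := hfg (t z)
    rw [hgt, add_eq_right] at h
    rw [← hrf (r (t z)), h, map_zero]
  have hfr : ∀ y, f.lin (r y) = y - t (g.lin y) := fun y => eq_sub_of_add_eq (hfg y)
  let G : (DGMod.res A.algMap).obj Z ⟶ (DGMod.res A.algMap).obj (DGMod.cone f) :=
    { lin := (-(r.comp (Y.str.d.comp t))).prod t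
      map_deg := fun {i z} hz => ⟨neg_mem (hr _ _ (Y.str.d_mem (ht _ _ hz))), ht _ _ hz⟩
      map_d := fun z => by
        refine Prod.ext ?_ ?_
        · have : X.str.d (r (Y.str.d (t z))) = - r (Y.str.d (t (Z.str.d z))) := by
            rw [← hrf (X.str.d _), f.map_d, hfr, map_sub, Y.str.d_d, g.map_d, hgt, zero_sub,
              map_neg]
          simp [this]
        · simp [hfr, g.map_d, hgt]
      map_act := fun z s => by
        refine Prod.ext ?_ (hts z s)
        have : ∀ z, r (Y.str.d (t (Z.act z (A.algMap s)))) =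
            X.act (r (Y.str.d (t z))) (A.algMap s) := by
          intro z
          refine Z.str.induction (P := fun z => r (Y.str.d (t (Z.act z (A.algMap s)))) =
            X.act (r (Y.str.d (t z))) (A.algMap s)) (by simp)
            (fun _ _ h h' => by simp [h, h']) (fun i z hz => ?_) z
          rw [hts, Y.d_act _ (ht _ _ hz), map_add, map_smul, hrs, ← A.algMap.map_d, hrs, hrt]
          simp
        simpa using this z }
  refine ⟨G, ⟨-((LinearMap.inl k X Y).comp (r.comp (LinearMap.snd k X Y))), ?_, ?_, ?_⟩,
    ⟨0, by simp, by simp, ?_⟩⟩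
  · rintro i ⟨x, y⟩ ⟨hx, hy⟩
    exact ⟨neg_mem (by simpa using hr _ _ hy), by simp⟩
  · rintro ⟨x, y⟩ s
    refine Prod.ext ?_ ?_
    · simp [hrs]
    · simp
  · rintro ⟨x, y⟩
    have : r (Y.str.d (t (g.lin y))) = r (Y.str.d y) - X.str.d (r y) := by
      have h : t (g.lin y) = y - f.lin (r y) := by rw [hfr]; abel
      rw [h, map_sub, map_sub, ← f.map_d, hrf]
    refine Prod.ext ?_ ?_
    · change -r (Y.str.d (t (g.lin y))) - x = _
      simp [this, hrf]; abel
    · change t (g.lin y) - y = _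
      simp [hfr]
  · intro z
    simp [G, DGMod.coneDesc, hgt]

end Split

section Twist

variable {S : DGAlg k} (A : DGAlgOver S) (N : DGLMod S)

theorem Tens.map_act_base {X Y : DGMod A.toDGAlg}
    (f : X.restrict A.algMap →ₗ[k] Y.restrict A.algMap)
    (hf : ∀ x b, f ((X.restrict A.algMap).act x b) = (Y.restrict A.algMap).act (f x) b)
    (t : Tens (X.restrict A.algMap) N) (s : S) :
    Tens.map N f hf (Tens.act X N t (A.algMap s)) =
      Tens.act Y N (Tens.map N f hf t) (A.algMap s) := by
  have : ((Tens.act X N).compl₂ A.algMap.toAlgHom.toLinearMap).compr₂ (Tens.map N f hf) =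
      ((Tens.act Y N).compl₂ A.algMap.toAlgHom.toLinearMap).comp (Tens.map N f hf) := by
    refine Tens.hom_ext fun i j x hx n hn => S.str.hom_ext fun p s hs => ?_
    have hf' : f (X.act x (A.algMap s)) = Y.act (f x) (A.algMap s) := hf x s
    simp only [LinearMap.compr₂_apply, LinearMap.comp_apply, LinearMap.compl₂_apply,
      AlgHom.toLinearMap_apply]
    rw [Tens.act_tmk X N (A.algMap.map_deg hs) x hn, map_smul,
      Tens.map_tmk, Tens.map_tmk, Tens.act_tmk Y N (A.algMap.map_deg hs) _ hn, hf']
  exact LinearMap.congr_fun (LinearMap.congr_fun this t) s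

/-- The functor `M ↦ (M ⊗_S N)[1]` on right dg `A`-modules. -/
noncomputable def twist : DGMod A.toDGAlg ⥤ DGMod A.toDGAlg :=
  DGMod.tensorFunctor A N ⋙ DGMod.shiftFunctor A.toDGAlg

theorem Tens.map_homotopy {B : DGAlg k} {N : DGLMod B} {X X' : DGMod B} (p q h : X →ₗ[k] X')
    (hp hq hh) (hdeg : ∀ i, ∀ x ∈ X.str.deg i, h x ∈ X'.str.deg (i - 1))
    (H : ∀ x, p x - q x = X'.str.d (h x) + h (X.str.d x)) (t : Tens X N) :
    Tens.map N p hp t - Tens.map N q hq t =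
      Tens.d X' N (Tens.map N h hh t) + Tens.map N h hh (Tens.d X N t) := by
  have : Tens.map N p hp - Tens.map N q hq =
      (Tens.d X' N).comp (Tens.map N h hh) + (Tens.map N h hh).comp (Tens.d X N) := by
    refine Tens.hom_ext fun i j x hx n hn => ?_
    simp only [LinearMap.sub_apply, LinearMap.add_apply, LinearMap.comp_apply]
    rw [Tens.map_tmk, Tens.map_tmk, Tens.map_tmk, Tens.d_tmk _ N hx, map_add, map_smul,
      Tens.map_tmk, Tens.map_tmk, Tens.d_tmk _ N (hdeg i x hx), ← LinearMap.sub_apply, ← map_sub,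
      H, map_add, LinearMap.add_apply, zpow_sub₀ (by simp)]
    simp only [zpow_one, div_neg, div_one, neg_smul]
    abel
  exact LinearMap.congr_fun this t

theorem relQis_twist {X Y : DGMod A.toDGAlg} (f : X ⟶ Y) (hf : relQis A f) :
    relQis A ((twist A N).map f) := by
  have hmem : ∀ {X Y : DGMod A.toDGAlg} (h : X.restrict A.algMap →ₗ[k] Y.restrict A.algMap) (hh)
      (_ : ∀ i, ∀ x ∈ X.str.deg i, h x ∈ Y.str.deg (i - 1)) (i : ℤ) (t)
      (_ : t ∈ ((twist A N).obj X).str.deg i),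
      -Tens.map N h hh t ∈ ((twist A N).obj Y).str.deg (i - 1) := by
    intro X Y h hh hdeg i t ht
    have := neg_mem (Tens.map_mem N h hh (e := -1) hdeg ht)
    rw [show i + 1 + -1 = i - 1 + 1 by ring] at this
    exact this
  obtain ⟨g, ⟨h, hdeg, hact, H⟩, ⟨h', hdeg', hact', H'⟩⟩ := hf
  have hf : ∀ x b, f.lin ((X.restrict A.algMap).act x b) =
      (Y.restrict A.algMap).act (f.lin x) b := fun x b => f.map_act x _
  refine ⟨{ lin := Tens.map (X := Y.restrict A.algMap) (X' := X.restrict A.algMap) N g.lin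
              g.map_act
            map_deg := fun {i t} ht => ?_
            map_d := fun t => ?_
            map_act := fun t s => ?_ },
    ⟨-Tens.map (X := X.restrict A.algMap) (X' := X.restrict A.algMap) N h hact,
      fun i t ht => hmem h hact hdeg i t ht, fun t s => ?_, fun t => ?_⟩,
    ⟨-Tens.map (X := Y.restrict A.algMap) (X' := Y.restrict A.algMap) N h' hact',
      fun i t ht => hmem h' hact' hdeg' i t ht, fun t s => ?_, fun t => ?_⟩⟩
  · have := Tens.map_mem N g.lin g.map_act (e := 0)
      (fun i x hx => by simpa using g.map_deg hx) ht
    rwa [add_zero] at this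
  · have := Tens.d_map N g.lin g.map_act (fun _ _ h => g.map_deg h) g.map_d t
    change Tens.map N g.lin _ (-(Tens.d _ N t)) = -(Tens.d _ N (Tens.map N g.lin _ t))
    rw [map_neg, this]
  · exact Tens.map_act_base A N g.lin g.map_act t s
  · have := Tens.map_act_base A N h hact t s
    change -Tens.map N h hact _ = Tens.act X N (-Tens.map N h hact t) (A.algMap s)
    rw [map_neg, LinearMap.neg_apply, ← this]
    rfl
  · revert t
    intro (t : Tens (X.restrict A.algMap) N)
    have := Tens.map_homotopy (N := N) (((DGMod.res A.algMap).map f ≫ g).lin)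
      (DGMod.Hom.lin (𝟙 (X.restrict A.algMap))) h (DGMod.Hom.map_act _) (DGMod.Hom.map_act _)
      hact hdeg H t
    change Tens.map N g.lin g.map_act (Tens.map (X := X.restrict A.algMap)
      (X' := Y.restrict A.algMap) N f.lin hf t) - t =
      -(Tens.d _ N (-(Tens.map N h hact t))) + -(Tens.map N h hact (-(Tens.d _ N t)))
    rw [map_neg, map_neg, neg_neg, neg_neg, ← this]
    congr 1
    · exact (Tens.map_comp (X := X.restrict A.algMap) (X' := Y.restrict A.algMap)
        (X'' := X.restrict A.algMap) N f.lin g.lin hf g.map_act _ t).symm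
    · exact (Tens.map_id N t).symm
  · have := Tens.map_act_base A N h' hact' t s
    change -Tens.map N h' hact' _ = Tens.act Y N (-Tens.map N h' hact' t) (A.algMap s)
    rw [map_neg, LinearMap.neg_apply, ← this]
    rfl
  · revert t
    intro (t : Tens (Y.restrict A.algMap) N)
    have := Tens.map_homotopy (N := N) ((g ≫ (DGMod.res A.algMap).map f).lin)
      (DGMod.Hom.lin (𝟙 (Y.restrict A.algMap))) h' (DGMod.Hom.map_act _) (DGMod.Hom.map_act _)
      hact' hdeg' H' t
    change Tens.map (X := X.restrict A.algMap) (X' := Y.restrict A.algMap) N f.lin hf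
      (Tens.map N g.lin g.map_act t) - t =
      -(Tens.d _ N (-(Tens.map N h' hact' t))) + -(Tens.map N h' hact' (-(Tens.d _ N t)))
    rw [map_neg, map_neg, neg_neg, neg_neg, ← this]
    congr 1
    · exact (Tens.map_comp (X := Y.restrict A.algMap) (X' := X.restrict A.algMap)
        (X'' := Y.restrict A.algMap) N g.lin f.lin g.map_act hf _ t).symm
    · exact (Tens.map_id N t).symm

/-- The functor `M ↦ (M ⊗_S N)[1]` on the relative derived category. -/
noncomputable def derTwist : RelD A ⥤ RelD A :=
  Localization.Construction.lift (twist A N ⋙ relQ A) fun _ _ f hf =>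
    (relQis A).Q_inverts _ (relQis_twist A N f hf)

/-- The action of `M ↦ (M ⊗_S N)[1]` on morphisms of the relative derived category. -/
noncomputable def derTwistMap {X Y : DGMod A.toDGAlg} (f : (relQ A).obj X ⟶ (relQ A).obj Y) :
    (relQ A).obj ((twist A N).obj X) ⟶ (relQ A).obj ((twist A N).obj Y) :=
  (derTwist A N).map f

theorem derTwistMap_Q {X Y : DGMod A.toDGAlg} (f : X ⟶ Y) :
    derTwistMap A N ((relQ A).map f) = (relQ A).map ((twist A N).map f) := by
  exact (Functor.congr_hom (Localization.Construction.fac (twist A N ⋙ relQ A) fun _ _ f hf =>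
    (relQis A).Q_inverts _ (relQis_twist A N f hf)) f).trans
      ((Category.id_comp _).trans (Category.comp_id _))

theorem derTwistMap_id (X : DGMod A.toDGAlg) :
    derTwistMap A N (𝟙 ((relQ A).obj X)) = 𝟙 ((relQ A).obj ((twist A N).obj X)) :=
  (derTwist A N).map_id _

theorem derTwistMap_comp {X Y Z : DGMod A.toDGAlg} (f : (relQ A).obj X ⟶ (relQ A).obj Y)
    (g : (relQ A).obj Y ⟶ (relQ A).obj Z) :
    derTwistMap A N (f ≫ g) = derTwistMap A N f ≫ derTwistMap A N g :=
  (derTwist A N).map_comp _ _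

/-- The right action `c · f = (f⁻¹ ⊗ N[1]) ∘ c ∘ f` of the automorphism group of `M` on the
morphisms `c : M ⟶ (M ⊗_S N)[1]` of the relative derived category. -/
noncomputable instance autAction (M : DGMod A.toDGAlg) :
    MulAction (Aut ((relQ A).obj M))ᵐᵒᵖ
      ((relQ A).obj M ⟶ (relQ A).obj ((twist A N).obj M)) where
  smul f c := f.unop.hom ≫ c ≫ derTwistMap A N f.unop.inv
  one_smul c := by
    change 𝟙 _ ≫ c ≫ derTwistMap A N (𝟙 _) = c
    rw [derTwistMap_id]; simp
  mul_smul f g c := by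
    change (f.unop.hom ≫ g.unop.hom) ≫ c ≫ derTwistMap A N (g.unop.inv ≫ f.unop.inv) =
      f.unop.hom ≫ (g.unop.hom ≫ c ≫ derTwistMap A N g.unop.inv) ≫ derTwistMap A N f.unop.inv
    rw [derTwistMap_comp]; simp

end Twist

/-- An augmentation of the dg `S`-algebra `R`: a morphism of dg algebras `R ⟶ S` that is a
retraction of the structure morphism. -/
structure Augmentation {S : DGAlg k} (R : DGAlgOver S) where
  hom : DGAlg.Hom R.toDGAlg S
  hom_algMap : ∀ s, hom (R.algMap s) = s

section Reduction

variable {S : DGAlg k} {R : DGAlgOver S} (π : Augmentation R)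

/-- The square of the augmentation ideal vanishes. -/
def Augmentation.SqZero : Prop := ∀ x y : R.toDGAlg, π.hom x = 0 → π.hom y = 0 → x * y = 0

/-- The augmentation ideal `𝔫` as a left dg `R`-module. -/
@[reducible] def Augmentation.ker : DGLMod R.toDGAlg := DGLMod.ker π.hom

/-- The augmentation ideal `𝔫` as a left dg `S`-module. -/
@[reducible] def Augmentation.kerS : DGLMod S := π.ker.restrict R.algMap

/-- `S` as a left dg `R`-module via the augmentation. -/
@[reducible] def Augmentation.base : DGLMod R.toDGAlg := (DGLMod.self S).restrict π.hom

/-- The projection of `R = S ⊕ 𝔫` onto `𝔫`. -/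
def Augmentation.toKer : R.toDGAlg →ₗ[k] π.ker :=
  (LinearMap.id - R.algMap.toAlgHom.toLinearMap.comp π.hom.toAlgHom.toLinearMap).codRestrict _ <| by
    intro r
    have := π.hom_algMap (π.hom r)
    simp [this]

theorem Augmentation.coe_toKer (r : R.toDGAlg) :
    ((π.toKer r : π.ker) : R.toDGAlg) = r - R.algMap (π.hom r) := rfl

variable {E : DGAlgOver R.toDGAlg} (L : DGMod E.toDGAlg)

/-- The bilinear map `(l, x) ↦ l x` for `x` in `𝔫`. -/
def mulBil : (L.restrict E.algMap) →ₗ[k] π.ker →ₗ[k] L :=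
  L.act.compl₂ (E.algMap.toAlgHom.toLinearMap.comp
    (LinearMap.ker π.hom.toAlgHom.toLinearMap).subtype)

theorem mulBil_apply (x : L) (n : π.ker) :
    mulBil π L x n = L.act x (E.algMap (n : R.toDGAlg)) := rfl

theorem mulBil_balanced (x : L) (b : R.toDGAlg) (n : π.ker) :
    mulBil π L ((L.restrict E.algMap).act x b) n = mulBil π L x (π.ker.act b n) := by
  have : E.algMap (b * (n : R.toDGAlg)) = E.algMap b * E.algMap (n : R.toDGAlg) := map_mul _ _ _
  rw [mulBil_apply, mulBil_apply]
  refine (L.act_mul x (E.algMap b) (E.algMap (n : R.toDGAlg))).symm.trans ?_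
  rw [← this]
  rfl

/-- The linear map `L ⊗_R 𝔫 ⟶ L`, `l ⊗ x ↦ l x`. -/
def mulLin : Tens (L.restrict E.algMap) π.ker →ₗ[k] L :=
  Tens.lift (mulBil π L) fun _ _ _ x _ b _ n _ => mulBil_balanced π L x b n

theorem mulLin_tmk (x : L) (n : π.ker) :
    mulLin π L (tmk (L.restrict E.algMap) π.ker x n) = L.act x (E.algMap (n : R.toDGAlg)) := by
  rw [mulLin, Tens.lift_tmk, mulBil_apply]

theorem mulLin_deg {m : ℤ} {t} (ht : t ∈ Tens.deg (L.restrict E.algMap) π.ker m) :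
    mulLin π L t ∈ L.str.deg m := by
  refine Tens.deg_induction (P := fun t => mulLin π L t ∈ L.str.deg m) (by simp)
    (fun _ _ h h' => by rw [map_add]; exact add_mem h h') ?_ ht
  rintro i j x hx n hn rfl
  rw [mulLin_tmk]
  exact L.act_mem hx (E.algMap.map_deg hn)

theorem mulLin_d (t) : mulLin π L (Tens.d (L.restrict E.algMap) π.ker t) =
    L.str.d (mulLin π L t) := by
  have : (mulLin π L).comp (Tens.d (L.restrict E.algMap) π.ker) =
      L.str.d.comp (mulLin π L) := by
    refine Tens.hom_ext fun i j x hx n hn => ?_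
    rw [LinearMap.comp_apply, LinearMap.comp_apply, mulLin_tmk, Tens.d_tmk _ _ hx, map_add,
      map_smul, mulLin_tmk, mulLin_tmk, L.d_act _ hx, ← E.algMap.map_d]
    rfl
  exact LinearMap.congr_fun this t

theorem mulLin_act (t) (e : E.carrier) :
    mulLin π L (Tens.act L π.ker t e) = L.act (mulLin π L t) e := by
  have : (Tens.act L π.ker).compr₂ (mulLin π L) = L.act.comp (mulLin π L) := by
    refine Tens.hom_ext fun i j x hx n hn => E.str.hom_ext fun p e he => ?_
    have hn' : (n : R.toDGAlg) ∈ R.str.deg j := hn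
    rw [LinearMap.compr₂_apply, LinearMap.comp_apply, Tens.act_tmk L _ he x hn, map_smul,
      mulLin_tmk, mulLin_tmk, ← L.act_mul, ← L.act_mul, E.central hn' he, map_smul, mul_comm p]
  exact LinearMap.congr_fun (LinearMap.congr_fun this t) e

/-- The morphism `L ⊗_R 𝔫 ⟶ L`, `l ⊗ x ↦ l x`. -/
def mulMap : L.tensor π.ker ⟶ L where
  lin := mulLin π L
  map_deg ht := mulLin_deg π L ht
  map_d t := mulLin_d π L t
  map_act t e := mulLin_act π L t e

/-- The linear map `L ⟶ L ⊗_R S`, `l ↦ l ⊗ 1`. -/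
def quotLin : L →ₗ[k] Tens (L.restrict E.algMap) π.base :=
  (tmk (L.restrict E.algMap) π.base).flip (1 : S)

theorem quotLin_apply (l : L) : quotLin π L l = tmk (L.restrict E.algMap) π.base l (1 : S) := rfl

theorem quotLin_deg {m : ℤ} {l : L} (hl : l ∈ L.str.deg m) :
    quotLin π L l ∈ Tens.deg (L.restrict E.algMap) π.base m := by
  have := tmk_mem (X := L.restrict E.algMap) (N := π.base) hl S.one_mem
  rwa [add_zero] at this

theorem quotLin_d (l : L) : quotLin π L (L.str.d l) =
    Tens.d (L.restrict E.algMap) π.base (quotLin π L l) := by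
  have : (quotLin π L).comp L.str.d =
      (Tens.d (L.restrict E.algMap) π.base).comp (quotLin π L) := by
    refine L.str.hom_ext fun i x hx => ?_
    rw [LinearMap.comp_apply, LinearMap.comp_apply, quotLin_apply, quotLin_apply,
      Tens.d_tmk (L.restrict E.algMap) π.base hx, S.d_one, map_zero, smul_zero, add_zero]
  exact LinearMap.congr_fun this l

theorem quotLin_act (l : L) (e : E.carrier) : quotLin π L (L.act l e) =
    Tens.act L π.base (quotLin π L l) e := by
  have : L.act.compr₂ (quotLin π L) = (Tens.act L π.base).comp (quotLin π L) := by
    refine L.str.hom_ext fun i x hx => E.str.hom_ext fun p e he => ?_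
    rw [LinearMap.compr₂_apply, LinearMap.comp_apply, quotLin_apply, quotLin_apply,
      Tens.act_tmk L π.base he x S.one_mem, mul_zero, zpow_zero, one_smul]
  exact LinearMap.congr_fun (LinearMap.congr_fun this l) e

/-- The morphism `L ⟶ L ⊗_R S`, `l ↦ l ⊗ 1`. -/
def quotMap : L ⟶ L.tensor π.base where
  lin := quotLin π L
  map_deg hl := quotLin_deg π L hl
  map_d l := quotLin_d π L l
  map_act l e := quotLin_act π L l e

theorem quotMap_mulMap (t : L.tensor π.ker) : (quotMap π L).lin ((mulMap π L).lin t) = 0 := by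
  have : (quotLin π L).comp (mulLin π L) = 0 := by
    refine Tens.hom_ext fun i j x hx n hn => ?_
    have hn' : π.hom (n : R.toDGAlg) = 0 := n.2
    rw [LinearMap.comp_apply, mulLin_tmk, quotLin_apply]
    refine (tmk_balanced (X := L.restrict E.algMap) (N := π.base) x (n : R.toDGAlg) 1).trans ?_
    have : π.base.act (n : R.toDGAlg) 1 = 0 := by
      change π.hom (n : R.toDGAlg) * 1 = 0
      rw [hn', zero_mul]
    rw [this, map_zero, LinearMap.zero_apply]
  exact LinearMap.congr_fun this t

end Reduction

section Canonical

variable {S : DGAlg k} {R : DGAlgOver S} (π : Augmentation R) {A : DGAlgOver S}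
  {E : DGAlgOver R.toDGAlg} (j : DGAlg.Hom A.toDGAlg E.toDGAlg)
  (L : DGMod E.toDGAlg)

/-- The reduction `L ⊗_R S` as a right dg `A`-module. -/
noncomputable def redMod : DGMod A.toDGAlg := (L.tensor π.base).restrict j

/-- `L ⊗_R 𝔫` as a right dg `A`-module. -/
noncomputable def nilMod : DGMod A.toDGAlg := (L.tensor π.ker).restrict j

/-- The bilinear map `(l, x) ↦ (l ⊗ 1) ⊗ x`. -/
noncomputable def canBil : (L.restrict E.algMap) →ₗ[k] π.ker →ₗ[k]
    Tens ((redMod π j L).restrict A.algMap) π.kerS :=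
  (tmk ((redMod π j L).restrict A.algMap) π.kerS).comp (quotLin π L)

theorem canBil_apply (l : L) (x : π.ker) : canBil π j L l x =
    tmk ((redMod π j L).restrict A.algMap) π.kerS (quotLin π L l) x := rfl

theorem quotLin_act_algMap (hj : ∀ s, j (A.algMap s) = E.algMap (R.algMap s))
    (l : L) (r : R.toDGAlg) :
    quotLin π L (L.act l (E.algMap r)) =
      (redMod π j L).act (quotLin π L l) (A.algMap (π.hom r)) := by
  have h : ∀ r : R.toDGAlg, quotLin π L (L.act l (E.algMap r)) =
      tmk (L.restrict E.algMap) π.base l (π.hom r * 1) := fun r =>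
    tmk_balanced (X := L.restrict E.algMap) (N := π.base) l r 1
  change _ = Tens.act L π.base (quotLin π L l) (j (A.algMap (π.hom r)))
  rw [hj, ← quotLin_act, h, h, π.hom_algMap]

theorem canBil_balanced (hj : ∀ s, j (A.algMap s) = E.algMap (R.algMap s))
    (hπ : π.SqZero) (l : L) (r : R.toDGAlg) (x : π.ker) :
    canBil π j L ((L.restrict E.algMap).act l r) x = canBil π j L l (π.ker.act r x) := by
  rw [canBil_apply, canBil_apply]
  have h : π.ker.act r x = π.kerS.act (π.hom r) x := by
    apply Subtype.ext
    change r * (x : R.toDGAlg) = R.algMap (π.hom r) * (x : R.toDGAlg)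
    rw [← sub_eq_zero, ← sub_mul]
    exact hπ _ _ (π.toKer r).2 x.2
  rw [h]
  refine (congrArg (fun q => tmk ((redMod π j L).restrict A.algMap) π.kerS q x)
    (quotLin_act_algMap π j L hj l r)).trans ?_
  exact tmk_balanced (X := (redMod π j L).restrict A.algMap) (N := π.kerS) (quotLin π L l)
    (π.hom r) x

variable (hj : ∀ s, j (A.algMap s) = E.algMap (R.algMap s))

/-- The linear map `L ⊗_R 𝔫 ⟶ (L ⊗_R S) ⊗_S 𝔫`, `l ⊗ x ↦ (l ⊗ 1) ⊗ x`. -/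
noncomputable def canLin (hπ : π.SqZero) : Tens (L.restrict E.algMap) π.ker →ₗ[k]
    Tens ((redMod π j L).restrict A.algMap) π.kerS :=
  Tens.lift (canBil π j L) fun _ _ _ l _ r _ x _ => canBil_balanced π j L hj hπ l r x

theorem canLin_tmk (hπ : π.SqZero) (l : L) (x : π.ker) :
    canLin π j L hj hπ (tmk (L.restrict E.algMap) π.ker l x) =
      tmk ((redMod π j L).restrict A.algMap) π.kerS (quotLin π L l) x := by
  rw [canLin, Tens.lift_tmk, canBil_apply]

theorem canLin_deg (hπ : π.SqZero) {m : ℤ} {t}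
    (ht : t ∈ Tens.deg (L.restrict E.algMap) π.ker m) :
    canLin π j L hj hπ t ∈ Tens.deg ((redMod π j L).restrict A.algMap) π.kerS m := by
  refine Tens.deg_induction (P := fun t => canLin π j L hj hπ t ∈
    Tens.deg ((redMod π j L).restrict A.algMap) π.kerS m) (by simp)
    (fun _ _ h h' => by rw [map_add]; exact add_mem h h') ?_ ht
  rintro p q x hx n hn rfl
  rw [canLin_tmk]
  exact tmk_mem (X := (redMod π j L).restrict A.algMap) (N := π.kerS) (quotLin_deg π L hx) hn

theorem canLin_d (hπ : π.SqZero) (t) :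
    canLin π j L hj hπ (Tens.d (L.restrict E.algMap) π.ker t) =
      Tens.d ((redMod π j L).restrict A.algMap) π.kerS (canLin π j L hj hπ t) := by
  have : (canLin π j L hj hπ).comp (Tens.d (L.restrict E.algMap) π.ker) =
      (Tens.d ((redMod π j L).restrict A.algMap) π.kerS).comp (canLin π j L hj hπ) := by
    refine Tens.hom_ext fun p q x hx n hn => ?_
    rw [LinearMap.comp_apply, LinearMap.comp_apply, canLin_tmk, Tens.d_tmk _ _ hx, map_add,
      map_smul, canLin_tmk, canLin_tmk,
      Tens.d_tmk ((redMod π j L).restrict A.algMap) π.kerS (quotLin_deg π L hx), quotLin_d]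
    rfl
  exact LinearMap.congr_fun this t

theorem canLin_act (hπ : π.SqZero) (t) (a : A.carrier) :
    canLin π j L hj hπ (Tens.act L π.ker t (j a)) =
      Tens.act (redMod π j L) π.kerS (canLin π j L hj hπ t) a := by
  have : ((Tens.act L π.ker).compl₂ j.toAlgHom.toLinearMap).compr₂ (canLin π j L hj hπ) =
      (Tens.act (redMod π j L) π.kerS).comp (canLin π j L hj hπ) := by
    refine Tens.hom_ext fun p q x hx n hn => A.str.hom_ext fun m a ha => ?_
    rw [LinearMap.compr₂_apply, LinearMap.comp_apply, LinearMap.compl₂_apply,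
      AlgHom.toLinearMap_apply, Tens.act_tmk L π.ker (j.map_deg ha) x hn, map_smul, canLin_tmk,
      canLin_tmk]
    refine Eq.trans ?_
      (Tens.act_tmk (redMod π j L) π.kerS ha (quotLin π L x) (l := q) hn).symm
    rw [quotLin_act]
    rfl
  exact LinearMap.congr_fun (LinearMap.congr_fun this t) a

/-- The canonical morphism `L ⊗_R 𝔫 ⟶ (L ⊗_R S) ⊗_S 𝔫`, `l ⊗ x ↦ (l ⊗ 1) ⊗ x`, of right dg
`A`-modules; it exists because `𝔫 ^ 2 = 0`. -/
noncomputable def canMap (hπ : π.SqZero) : nilMod π j L ⟶ (redMod π j L).tensor π.kerS where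
  lin := canLin π j L hj hπ
  map_deg ht := canLin_deg π j L hj hπ ht
  map_d t := canLin_d π j L hj hπ t
  map_act t a := canLin_act π j L hj hπ t a

/-- The morphism `L ⊗_R 𝔫 ⟶ L` of right dg `A`-modules. -/
noncomputable def mulMapA : nilMod π j L ⟶ L.restrict j := (DGMod.res j).map (mulMap π L)

/-- The morphism `L ⟶ L ⊗_R S` of right dg `A`-modules. -/
noncomputable def quotMapA : L.restrict j ⟶ redMod π j L := (DGMod.res j).map (quotMap π L)

theorem quotMapA_mulMapA (t : nilMod π j L) :
    (quotMapA π j L).lin ((mulMapA π j L).lin t) = 0 :=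
  quotMap_mulMap π L t

end Canonical

section Splitting

theorem DGMod.IsGradedFree.exists_coord {B : DGAlg k} {X : DGMod B} (hX : X.IsGradedFree) :
    ∃ (I : Type u) (n : I → ℤ) (b : I → X) (c : X →ₗ[k] (I →₀ B)),
      (∀ i, b i ∈ X.str.deg (n i)) ∧ (∀ i a, c (X.act (b i) a) = Finsupp.single i a) ∧
      ∀ P : X → Prop, P 0 → (∀ x y, P x → P y → P (x + y)) → (∀ i a, P (X.act (b i) a)) →
        ∀ x, P x := by
  obtain ⟨I, n, b, hb, hF⟩ := hX
  let F : (I →₀ B) →ₗ[k] X := Finsupp.lsum k fun i => X.act (b i)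
  have hF' : Function.Bijective F := hF
  refine ⟨I, n, b, (LinearEquiv.ofBijective F hF').symm.toLinearMap, hb, fun i a => ?_, ?_⟩
  · refine (LinearEquiv.symm_apply_eq _).2 ?_
    simp [F]
  · intro P h0 hadd h x
    obtain ⟨f, rfl⟩ := hF'.2 x
    induction f using Finsupp.induction_linear with
    | zero => simpa using h0
    | add f g hf hg => rw [map_add]; exact hadd _ _ hf hg
    | single i a => simpa [F] using h i a

theorem DGMod.deg_induction_of_basis {B : DGAlg k} {X : DGMod B} {I : Type u} {n : I → ℤ}
    {b : I → X} (hb : ∀ i, b i ∈ X.str.deg (n i))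
    (hspan : ∀ P : X → Prop, P 0 → (∀ x y, P x → P y → P (x + y)) →
      (∀ i a, P (X.act (b i) a)) → ∀ x, P x)
    {m : ℤ} {P : X → Prop} (zero : P 0) (add : ∀ x y, P x → P y → P (x + y))
    (hom : ∀ i p a, a ∈ B.str.deg p → n i + p = m → P (X.act (b i) a)) {x : X}
    (hx : x ∈ X.str.deg m) : P x := by
  rw [← X.str.proj_same hx]
  refine hspan (fun x => P (X.str.proj m x)) (by simpa using zero)
    (fun _ _ h h' => by rw [map_add]; exact add _ _ h h') (fun i a => ?_) x
  refine B.str.induction (P := fun a => P (X.str.proj m (X.act (b i) a))) (by simpa using zero)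
    (fun _ _ h h' => by rw [map_add, map_add]; exact add _ _ h h') (fun p a ha => ?_) a
  by_cases h : n i + p = m
  · subst h
    rw [X.str.proj_same (X.act_mem (hb i) ha)]
    exact hom i p a ha rfl
  · rw [X.str.proj_ne h (X.act_mem (hb i) ha)]
    exact zero

variable {S : DGAlg k} {R : DGAlgOver S} (π : Augmentation R) {E : DGAlgOver R.toDGAlg}
  (L : DGMod E.toDGAlg)

/-- Right multiplication of `R` on `𝔫`. -/
def Augmentation.kerMul : π.ker →ₗ[k] R.toDGAlg →ₗ[k] π.ker :=
  LinearMap.mk₂ k (fun x r => ⟨(x : R.toDGAlg) * r, by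
      have h : π.hom (x : R.toDGAlg) = 0 := x.2
      change π.hom ((x : R.toDGAlg) * r) = 0
      rw [map_mul, h, zero_mul]⟩)
    (fun _ _ _ => Subtype.ext (add_mul _ _ _)) (fun _ _ _ => Subtype.ext (smul_mul_assoc _ _ _))
    (fun _ _ _ => Subtype.ext (mul_add _ _ _)) (fun _ _ _ => Subtype.ext (mul_smul_comm _ _ _))

theorem Augmentation.coe_kerMul (x : π.ker) (r : R.toDGAlg) :
    ((π.kerMul x r : π.ker) : R.toDGAlg) = (x : R.toDGAlg) * r := rfl

theorem act_algMap_ker (hR : R.IsComm) (l : L) (x : π.ker) (r : R.toDGAlg) :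
    Tens.act L π.ker (tmk (L.restrict E.algMap) π.ker l x) (E.algMap r) =
      tmk (L.restrict E.algMap) π.ker l (π.kerMul x r) := by
  refine π.ker.str.induction (P := fun x => Tens.act L π.ker
    (tmk (L.restrict E.algMap) π.ker l x) (E.algMap r) =
      tmk (L.restrict E.algMap) π.ker l (π.kerMul x r)) (by simp)
    (fun _ _ h h' => by simp only [map_add, LinearMap.add_apply, h, h'])
    (fun p x hx => ?_) x
  refine R.str.induction (P := fun r => Tens.act L π.ker
    (tmk (L.restrict E.algMap) π.ker l x) (E.algMap r) =
      tmk (L.restrict E.algMap) π.ker l (π.kerMul x r)) (by simp)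
    (fun _ _ h h' => by simp only [map_add, h, h'])
    (fun q r hr => ?_) r
  rw [Tens.act_tmk L π.ker (E.algMap.map_deg hr) l (l := p) hx]
  have h1 : tmk (L.restrict E.algMap) π.ker (L.act l (E.algMap r)) x =
    tmk (L.restrict E.algMap) π.ker l (π.ker.act r x) :=
    tmk_balanced (X := L.restrict E.algMap) (N := π.ker) l r x
  have h2 : π.ker.act r x = (-1 : k) ^ (q * p) • π.kerMul x r :=
    Subtype.ext (hR q p r (x : R.toDGAlg) hr hx)
  rw [h1, h2, map_smul, smul_smul, ← sgn_add, sgn_congr (k := k) (e' := 0) (q * p) (by ring)]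
  simp

theorem act_algMap_base (hR : R.IsComm) (l : L) (s : S) (r : R.toDGAlg) :
    Tens.act L π.base (tmk (L.restrict E.algMap) π.base l s) (E.algMap r) =
      tmk (L.restrict E.algMap) π.base l (s * π.hom r) := by
  refine S.str.induction (P := fun s => Tens.act L π.base (tmk (L.restrict E.algMap) π.base l s)
    (E.algMap r) = tmk (L.restrict E.algMap) π.base l (s * π.hom r)) (by simp)
    (fun _ _ h h' => by simp only [map_add, LinearMap.add_apply, add_mul, h, h'])
    (fun p s hs => ?_) s
  refine R.str.induction (P := fun r => Tens.act L π.base (tmk (L.restrict E.algMap) π.base l s)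
    (E.algMap r) = tmk (L.restrict E.algMap) π.base l (s * π.hom r)) (by simp)
    (fun _ _ h h' => by simp only [map_add, mul_add, h, h'])
    (fun q r hr => ?_) r
  rw [Tens.act_tmk L π.base (E.algMap.map_deg hr) l (l := p) hs]
  have h1 : tmk (L.restrict E.algMap) π.base (L.act l (E.algMap r)) s =
    tmk (L.restrict E.algMap) π.base l (π.hom r * s) :=
    tmk_balanced (X := L.restrict E.algMap) (N := π.base) l r s
  have h2 : π.hom r * s = (-1 : k) ^ (q * p) • (s * π.hom r) := by
    have := congrArg (fun x => π.hom x) (hR q p r (R.algMap s) hr (R.algMap.map_deg hs))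
    simpa [π.hom_algMap] using this
  rw [h1, h2, map_smul, smul_smul, ← sgn_add, sgn_congr (k := k) (e' := 0) (q * p) (by ring)]
  simp

variable {A : DGAlgOver S} (j : DGAlg.Hom A.toDGAlg E.toDGAlg)

theorem exists_baseSection {I : Type u} (b : I → L) (c : L →ₗ[k] (I →₀ R.toDGAlg))
    (hc : ∀ i a, c (L.act (b i) (E.algMap a)) = Finsupp.single i a)
    (hspan : ∀ P : L → Prop, P 0 → (∀ x y, P x → P y → P (x + y)) →
      (∀ i a, P (L.act (b i) (E.algMap a))) → ∀ x, P x) :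
    ∃ t : Tens (L.restrict E.algMap) π.base →ₗ[k] L, ∀ i a s,
      t (tmk (L.restrict E.algMap) π.base (L.act (b i) (E.algMap a)) s) =
        L.act (b i) (E.algMap (R.algMap (π.hom a * s))) := by
  let T0 : (I →₀ R.toDGAlg) →ₗ[k] S →ₗ[k] L := Finsupp.lsum k fun i =>
    ((LinearMap.mul k S).comp π.hom.toAlgHom.toLinearMap).compr₂
      ((L.act (b i)).comp (E.algMap.toAlgHom.toLinearMap.comp R.algMap.toAlgHom.toLinearMap))
  let T : (L.restrict E.algMap) →ₗ[k] π.base →ₗ[k] L := T0.comp c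
  have hT : ∀ i a (s : S), T (L.act (b i) (E.algMap a)) s =
      L.act (b i) (E.algMap (R.algMap (π.hom a * s))) := by
    intro i a s
    change T0 (c _) s = _
    rw [hc]
    simp [T0]
  have hbal : ∀ (l : L) (r : R.toDGAlg) (s : S),
      T (L.act l (E.algMap r)) s = T l (π.hom r * s : S) := by
    intro l r s
    refine hspan (fun l => T (L.act l (E.algMap r)) s = T l (π.hom r * s : S)) (by simp)
      (fun _ _ h h' => by simp only [map_add, LinearMap.add_apply] at h h' ⊢; rw [h, h'])
      (fun i a => ?_) l
    have h1 : π.hom (a * r) * s = π.hom a * (π.hom r * s) := by rw [map_mul, mul_assoc]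
    rw [← L.act_mul, ← map_mul, hT, hT, h1]
  have hbal' : ∀ (l : L.restrict E.algMap) (r : R.toDGAlg) (s : π.base),
      T ((L.restrict E.algMap).act l r) s = T l (π.base.act r s) := hbal
  exact ⟨Tens.lift T fun _ _ _ l _ r _ s _ => hbal' l r s, fun i a s => by
    rw [Tens.lift_tmk]; exact hT i a s⟩

theorem exists_kerRetraction {I : Type u} (b : I → L) (c : L →ₗ[k] (I →₀ R.toDGAlg))
    (hc : ∀ i a, c (L.act (b i) (E.algMap a)) = Finsupp.single i a) :
    ∃ r : L →ₗ[k] Tens (L.restrict E.algMap) π.ker, ∀ i a,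
      r (L.act (b i) (E.algMap a)) = tmk (L.restrict E.algMap) π.ker (b i) (π.toKer a) := by
  let r0 : (I →₀ R.toDGAlg) →ₗ[k] Tens (L.restrict E.algMap) π.ker := Finsupp.lsum k fun i =>
    (tmk (L.restrict E.algMap) π.ker (b i)).comp π.toKer
  refine ⟨r0.comp c, fun i a => ?_⟩
  rw [LinearMap.comp_apply, hc]
  simp [r0]

/-- For `L` free as a graded `R`-module, the morphism from the cone of `L ⊗_R 𝔫 ⟶ L` to
`L ⊗_R S` is an `S`-relative quasi-isomorphism. -/
theorem relQis_cone_mulMapA (hj : ∀ s, j (A.algMap s) = E.algMap (R.algMap s))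
    (hR : R.IsComm) (hL : (L.restrict E.algMap).IsGradedFree) :
    relQis A (DGMod.coneDesc (mulMapA π j L) (quotMapA π j L) (quotMapA_mulMapA π j L)) := by
  obtain ⟨I, n, b, c, hb, hc, hspan⟩ := hL.exists_coord
  obtain ⟨t, ht⟩ := exists_baseSection π L b c hc hspan
  obtain ⟨r, hr⟩ := exists_kerRetraction π L b c hc
  have hspan' : ∀ P : L → Prop, P 0 → (∀ x y, P x → P y → P (x + y)) →
      (∀ i a, P (L.act (b i) (E.algMap a))) → ∀ x, P x := hspan
  have htoKer : ∀ {p : ℤ} {a : R.toDGAlg}, a ∈ R.str.deg p → π.toKer a ∈ π.ker.str.deg p :=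
    fun ha => sub_mem ha (R.algMap.map_deg (π.hom.map_deg ha))
  have hrdeg : ∀ {m : ℤ} {x : L}, x ∈ L.str.deg m →
      r x ∈ Tens.deg (L.restrict E.algMap) π.ker m := by
    intro m x hx
    refine DGMod.deg_induction_of_basis (X := L.restrict E.algMap) hb hspan
      (P := fun x => r x ∈ Tens.deg (L.restrict E.algMap) π.ker m) (by simp)
      (fun _ _ h h' => by rw [map_add]; exact add_mem h h') (fun i p a ha h => ?_) hx
    have h1 : r ((L.restrict E.algMap).act (b i) a) = _ := hr i a
    rw [h1, ← h]
    exact tmk_mem (X := L.restrict E.algMap) (hb i) (htoKer ha)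
  have htdeg : ∀ {m : ℤ} {z}, z ∈ Tens.deg (L.restrict E.algMap) π.base m →
      t z ∈ L.str.deg m := by
    intro m z hz
    refine Tens.deg_induction (P := fun z => t z ∈ L.str.deg m) (by simp)
      (fun _ _ h h' => by rw [map_add]; exact add_mem h h') (fun p q l hl s hs h => ?_) hz
    subst h
    refine DGMod.deg_induction_of_basis (X := L.restrict E.algMap) hb hspan
      (P := fun l => t (tmk (L.restrict E.algMap) π.base l s) ∈ L.str.deg (p + q)) (by simp)
      (fun _ _ h h' => by simp only [map_add, LinearMap.add_apply]; exact add_mem h h')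
      (fun i p' a ha h => ?_) hl
    have h1 : t (tmk (L.restrict E.algMap) π.base ((L.restrict E.algMap).act (b i) a) s) = _ :=
      ht i a s
    rw [h1, ← h, add_assoc]
    exact L.act_mem (hb i) (E.algMap.map_deg (R.algMap.map_deg
      (S.mul_mem (π.hom.map_deg ha) hs)))
  refine relQis_coneDesc A _ _ _ r t (fun i y hy => hrdeg hy) (fun i z hz => htdeg hz)
    ?_ ?_ ?_ ?_ ?_
  · intro y s
    change r (L.act y (j (A.algMap s))) = Tens.act L π.ker (r y) (j (A.algMap s))
    rw [hj]
    refine hspan' (fun y => r (L.act y (E.algMap (R.algMap s))) =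
      Tens.act L π.ker (r y) (E.algMap (R.algMap s))) (by simp)
      (fun _ _ h h' => by simp only [map_add, LinearMap.add_apply, h, h']) (fun i a => ?_) y
    rw [← L.act_mul, ← map_mul, hr, hr, act_algMap_ker π L hR]
    congr 1
    apply Subtype.ext
    change a * R.algMap s - R.algMap (π.hom (a * R.algMap s)) =
      (a - R.algMap (π.hom a)) * R.algMap s
    rw [map_mul, π.hom_algMap, map_mul, sub_mul]
  · intro z s
    change t (Tens.act L π.base z (j (A.algMap s))) = L.act (t z) (j (A.algMap s))
    rw [hj]
    refine Tens.induction (P := fun z => t (Tens.act L π.base z (E.algMap (R.algMap s))) =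
      L.act (t z) (E.algMap (R.algMap s))) (by simp)
      (fun _ _ h h' => by simp only [map_add, LinearMap.add_apply, h, h'])
      (fun p q l _ s' _ => ?_) z
    rw [act_algMap_base π L hR, π.hom_algMap]
    refine hspan' (fun l => t (tmk (L.restrict E.algMap) π.base l (s' * s : S)) =
      L.act (t (tmk (L.restrict E.algMap) π.base l s')) (E.algMap (R.algMap s))) (by simp)
      (fun _ _ h h' => by simp only [map_add, LinearMap.add_apply, h, h']) (fun i a => ?_) l
    rw [ht, ht, ← L.act_mul, ← map_mul, ← map_mul]
    congr 3
    exact (mul_assoc (π.hom a) s' s).symm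
  · intro x
    change r (mulLin π L x) = x
    refine Tens.induction (P := fun x => r (mulLin π L x) = x) (by simp)
      (fun _ _ h h' => by simp only [map_add, h, h']) (fun p q l _ n _ => ?_) x
    rw [mulLin_tmk]
    refine hspan' (fun l => r (L.act l (E.algMap (n : R.toDGAlg))) =
      tmk (L.restrict E.algMap) π.ker l n) (by simp)
      (fun _ _ h h' => by simp only [map_add, LinearMap.add_apply, h, h']) (fun i a => ?_) l
    rw [← L.act_mul, ← map_mul, hr]
    have h1 : π.toKer (a * (n : R.toDGAlg)) = π.ker.act a n := by
      apply Subtype.ext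
      change a * (n : R.toDGAlg) - R.algMap (π.hom (a * (n : R.toDGAlg))) = a * (n : R.toDGAlg)
      have hn : π.hom (n : R.toDGAlg) = 0 := n.2
      rw [map_mul, hn, mul_zero, map_zero, sub_zero]
    rw [h1]
    exact (tmk_balanced (X := L.restrict E.algMap) (N := π.ker) (b i) a n).symm
  · intro z
    change quotLin π L (t z) = z
    refine Tens.induction (P := fun z => quotLin π L (t z) = z) (by simp)
      (fun _ _ h h' => by simp only [map_add, h, h']) (fun p q l _ s _ => ?_) z
    refine hspan' (fun l => quotLin π L (t (tmk (L.restrict E.algMap) π.base l s)) =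
      tmk (L.restrict E.algMap) π.base l s) (by simp)
      (fun _ _ h h' => by simp only [map_add, LinearMap.add_apply, h, h']) (fun i a => ?_) l
    rw [ht, quotLin_apply]
    refine (tmk_balanced (X := L.restrict E.algMap) (N := π.base) (b i) _ 1).trans ?_
    refine Eq.trans ?_ (tmk_balanced (X := L.restrict E.algMap) (N := π.base) (b i) a s).symm
    congr 1
    change π.hom (R.algMap (π.hom a * s)) * 1 = π.hom a * s
    rw [π.hom_algMap, mul_one]
  · intro y
    change mulLin π L (r y) + t (quotLin π L y) = y
    refine hspan' (fun y => mulLin π L (r y) + t (quotLin π L y) = y) (by simp)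
      (fun x y h h' => ?_) (fun i a => ?_) y
    · simp only [map_add]
      rw [add_add_add_comm, h, h']
    · rw [hr, quotLin_apply, ht, mulLin_tmk, ← map_add, ← map_add, π.coe_toKer, mul_one,
        sub_add_cancel]

end Splitting

section Deformation

variable {S : DGAlg k} {R A : DGAlgOver S} (hR : R.IsComm) (π : Augmentation R)

/-- The morphism `A ⟶ A ⊗_S R` with target the dg `R`-algebra `A ⊗_S R`. -/
noncomputable def bcInl (A : DGAlgOver S) : DGAlg.Hom A.toDGAlg (baseChange A R hR).toDGAlg :=
  tensorInl A R

theorem bcInl_algMap (s : S) :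
    bcInl hR A (A.algMap s) = (baseChange A R hR).algMap (R.algMap s) :=
  tensorInl_algMap s

/-- The reduction `L ⊗_R S` of a right dg `A ⊗_S R`-module `L`, as a right dg `A`-module. -/
noncomputable abbrev reduction (L : DGMod (baseChange A R hR).toDGAlg) : DGMod A.toDGAlg :=
  redMod π (bcInl hR A) L

/-- The connecting morphism `ε' : L ⊗_R S ⟶ (L ⊗_R 𝔫)[1]` of `D_S A`, for `L` free as a graded
`R`-module: the composite of the inverse of `cone (L ⊗_R 𝔫 ⟶ L) ⟶ L ⊗_R S` with
`cone (L ⊗_R 𝔫 ⟶ L) ⟶ (L ⊗_R 𝔫)[1]`, `(x, l) ↦ - x`. With this sign, it is represented by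
`z ↦ d (t z) - t (d z)` for a graded section `t` of `L ⟶ L ⊗_R S`. -/
noncomputable def connecting (L : DGMod (baseChange A R hR).toDGAlg)
    (hL : (L.restrict (baseChange A R hR).algMap).IsGradedFree) :
    (relQ A).obj (reduction hR π L) ⟶ (relQ A).obj (nilMod π (bcInl hR A) L).shift :=
  (Localization.isoOfHom (relQ A) (relQis A) _
    (relQis_cone_mulMapA π L (bcInl hR A) (bcInl_algMap hR) hR hL)).inv ≫
    (relQ A).map (DGMod.coneFst (mulMapA π (bcInl hR A) L))

/-- A deformation `(L, u)` of the right dg `A`-module `M`: a right dg `A ⊗_S R`-module `L`, free as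
a graded `R`-module, with an isomorphism `u : L ⊗_R S ≅ M` of `D_S A`. -/
structure Deformation (M : DGMod A.toDGAlg) where
  mod : DGMod (baseChange A R hR).toDGAlg
  free : (mod.restrict (baseChange A R hR).algMap).IsGradedFree
  iso : (relQ A).obj (reduction hR π mod) ≅ (relQ A).obj M

/-- The class `ε(L, u) : M ⟶ (M ⊗_S 𝔫)[1]` of a deformation:
`u⁻¹` followed by `ε'`, by `(L ⊗_R 𝔫)[1] ≅ ((L ⊗_R S) ⊗_S 𝔫)[1]` and by `(u ⊗ 𝔫)[1]`. -/
noncomputable def Deformation.cls {hR : R.IsComm} {π : Augmentation R} (hπ : π.SqZero)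
    {M : DGMod A.toDGAlg} (D : Deformation hR π M) :
    (relQ A).obj M ⟶ (relQ A).obj ((twist A π.kerS).obj M) :=
  D.iso.inv ≫ connecting hR π D.mod D.free ≫
    (relQ A).map ((DGMod.shiftFunctor A.toDGAlg).map
      (canMap π (bcInl hR A) D.mod (bcInl_algMap hR) hπ)) ≫
    derTwistMap A π.kerS D.iso.hom

/-- A weak deformation of `M`: a right dg `A ⊗_S R`-module `L`, free as a graded `R`-module, such
that `L ⊗_R S` is isomorphic to `M` in `D_S A`. -/
structure WeakDeformation (M : DGMod A.toDGAlg) where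
  mod : DGMod (baseChange A R hR).toDGAlg
  free : (mod.restrict (baseChange A R hR).algMap).IsGradedFree
  exists_iso : Nonempty ((relQ A).obj (reduction hR π mod) ≅ (relQ A).obj M)

/-- Isomorphism of weak deformations in `D_R (A ⊗_S R)`. -/
instance WeakDeformation.setoid (M : DGMod A.toDGAlg) : Setoid (WeakDeformation hR π M) where
  r D D' := Nonempty ((relQ (baseChange A R hR)).obj D.mod ≅ (relQ (baseChange A R hR)).obj D'.mod)
  iseqv := ⟨fun _ => ⟨Iso.refl _⟩, fun ⟨e⟩ => ⟨e.symm⟩, fun ⟨e⟩ ⟨e'⟩ => ⟨e ≪≫ e'⟩⟩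

/-- The set `Defo'(M, R → S)` of isomorphism classes of weak deformations of `M`. -/
def WeakDefo (M : DGMod A.toDGAlg) : Type (u + 1) := Quotient (WeakDeformation.setoid hR π M)

/-- The class in `Defo'(M, R → S)` of a deformation `(L, u)`, obtained by forgetting `u`. -/
def Deformation.weakClass {hR : R.IsComm} {π : Augmentation R} {M : DGMod A.toDGAlg}
    (D : Deformation hR π M) : WeakDefo hR π M :=
  Quotient.mk _ ⟨D.mod, D.free, ⟨D.iso⟩⟩

/-- The quotient of `Hom_{D_S A} (M, (M ⊗_S 𝔫)[1])` by the action of the automorphism group of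
`M` in `D_S A`. -/
abbrev HomModAut (M : DGMod A.toDGAlg) : Type (u + 1) :=
  MulAction.orbitRel.Quotient (Aut ((relQ A).obj M))ᵐᵒᵖ
    ((relQ A).obj M ⟶ (relQ A).obj ((twist A π.kerS).obj M))

end Deformation

end DGDefo

/-! Write `E = A ⊗_S R` and `L̄ = L ⊗_R S`. Since `𝔫 ^ 2 = 0`, the product `l n` depends only on the
class of `l` in `L̄`, so a module `L` that is free over `R` is an extension of `L̄` by `L̄ ⊗_S 𝔫`,
and `ε` is the class of this extension. If `L` is moreover graded free over `E`, the map `L ⟶ L̄`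
has an `A`-linear graded section `t`, and the class is represented by the honest morphism `z ↦ d (t
z) - t (d z)` (`extClass_eq_of_section`). Changing the differential of `L` by a map `L̄ ⟶ L̄ ⊗ 𝔫`
changes this cocycle, and changing it by a coboundary gives an isomorphic module: this is the usual
square-zero deformation argument.

The argument needs actual morphisms, whereas the classes and the isomorphisms live in localized
categories. The link is `IsCofib`: out of a relatively cofibrant module, morphisms of the relative
derived category are homotopy classes of morphisms of dg modules (`IsCofib.exists_relQ_map_eq`,
`IsCofib.homotopic_of_relQ_map_eq`). The bar construction provides enough such modules, and they are
graded free over the algebra because `A` is free over `S` (`exists_resolution`). Reduction modulo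
`𝔫` preserves cofibrancy (`IsCofib.red`).

Well-definedness: an isomorphism of two deformations becomes a roof of morphisms out of a common
resolution, and the extension class is natural for morphisms (`extClass_naturality`,
`Deformation.cls_orbitRel`).

Injectivity: if the classes lie in one orbit, there is an isomorphism between the reductions of two
resolutions that respects the extension classes. It is represented by a morphism, which lifts
because the obstruction is the difference of the classes (`IsRetraction.exists_redMap_eq`). The
lifts in the two directions have composites that reduce to the identity up to homotopy, and such
endomorphisms are invertible because they differ from the identity, up to homotopy, by a map of
square zero (`IsRetraction.isIso_of_redMap_homotopic`).

Surjectivity: for a resolution `P` of `M` over `A`, the module `P ⊗_A E` is the trivial deformation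
of `P`. A prescribed class is represented by a morphism out of `P`, and adding it to the
differential gives a deformation with that class (`IsRetraction.exists_split`,
`IsRetraction.exists_deform`, `exists_cls_eq`). -/

namespace DGDefo

variable {k : Type u} [Field k]

/-! ### Homogeneous linear maps between dg modules -/

section GradedHom

variable {B : DGAlg k}

/-- Homogeneous linear maps of degree `e` that commute with the action. -/
structure IsGHom (X Y : DGMod B) (e : ℤ) (f : X →ₗ[k] Y) : Prop where
  deg : ∀ {i : ℤ} {x : X}, x ∈ X.str.deg i → f x ∈ Y.str.deg (i + e)
  act : ∀ (x : X) (b : B), f (X.act x b) = Y.act (f x) b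

variable {X Y Z : DGMod B}

theorem DGMod.Hom.isGHom (f : X ⟶ Y) : IsGHom X Y 0 f.lin :=
  ⟨fun h => by rw [add_zero]; exact f.map_deg h, f.map_act⟩

theorem IsGHom.add {e : ℤ} {f g : X →ₗ[k] Y} (hf : IsGHom X Y e f) (hg : IsGHom X Y e g) :
    IsGHom X Y e (f + g) :=
  ⟨fun h => add_mem (hf.deg h) (hg.deg h), fun x b => by simp [hf.act, hg.act]⟩

theorem IsGHom.neg {e : ℤ} {f : X →ₗ[k] Y} (hf : IsGHom X Y e f) : IsGHom X Y e (-f) :=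
  ⟨fun h => neg_mem (hf.deg h), fun x b => by simp [hf.act]⟩

theorem IsGHom.sub {e : ℤ} {f g : X →ₗ[k] Y} (hf : IsGHom X Y e f) (hg : IsGHom X Y e g) :
    IsGHom X Y e (f - g) :=
  ⟨fun h => sub_mem (hf.deg h) (hg.deg h), fun x b => by simp [hf.act, hg.act]⟩

theorem IsGHom.comp {e e' e'' : ℤ} {g : Y →ₗ[k] Z} {f : X →ₗ[k] Y} (hg : IsGHom Y Z e' g)
    (hf : IsGHom X Y e f) (h : e + e' = e'') : IsGHom X Z e'' (g.comp f) :=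
  ⟨fun hx => by
    have := hg.deg (hf.deg hx)
    rwa [add_assoc, h] at this, fun x b => by simp [hf.act, hg.act]⟩

theorem IsGHom.cast {e e' : ℤ} {f : X →ₗ[k] Y} (hf : IsGHom X Y e f) (h : e = e') :
    IsGHom X Y e' f := h ▸ hf

theorem IsGHom.restrict {C : DGAlg k} (φ : DGAlg.Hom C B) {e : ℤ} {f : X →ₗ[k] Y}
    (hf : IsGHom X Y e f) : IsGHom (X.restrict φ) (Y.restrict φ) e f :=
  ⟨hf.deg, fun x b => hf.act x (φ b)⟩

/-- The morphism of dg modules given by a closed homogeneous linear map of degree zero. -/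
def IsGHom.toHom {f : X →ₗ[k] Y} (hf : IsGHom X Y 0 f)
    (hd : ∀ x, f (X.str.d x) = Y.str.d (f x)) : X ⟶ Y where
  lin := f
  map_deg h := by simpa using hf.deg h
  map_d := hd
  map_act := hf.act

/-- The (graded) commutator of a homogeneous linear map with the differentials is again
linear over the algebra. -/
theorem IsGHom.commutator {e : ℤ} {f : X →ₗ[k] Y} (hf : IsGHom X Y e f) (c : k)
    (hc : c = (-1 : k) ^ (e + 1)) : IsGHom X Y (e + 1) (Y.str.d.comp f + c • f.comp X.str.d) := by
  refine ⟨fun {i x} hx => ?_, fun x b => ?_⟩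
  · refine add_mem ?_ (Submodule.smul_mem _ _ ?_)
    · have := Y.str.d_mem (hf.deg hx)
      rwa [add_assoc] at this
    · have := hf.deg (X.str.d_mem hx)
      rwa [add_assoc, add_comm 1 e] at this
  · generalize hF : Y.str.d.comp f + c • f.comp X.str.d = F
    refine X.str.induction (P := fun x => F (X.act x b) = Y.act (F x) b) (by simp)
      (fun _ _ h h' => by simp only [map_add, LinearMap.add_apply, h, h']) (fun i x hx => ?_) x
    rw [← hF]
    simp only [LinearMap.add_apply, LinearMap.comp_apply, LinearMap.smul_apply, map_add, map_smul,
      hf.act, Y.d_act b (hf.deg hx), X.d_act b hx, smul_add, smul_smul]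
    -- The two terms `f x · d b` carry the signs `(-1) ^ (i + e)` and `(-1) ^ (e + 1 + i)`, so they
    -- cancel.
    rw [hc, ← sgn_add, sgn_congr (k := k) (e := e + 1 + i) (e' := i + e + 1) 0 (by ring),
      sgn_add (i + e) 1]
    simp only [zpow_one, mul_neg, mul_one, neg_smul]
    abel

end GradedHom

/-! ### Homotopies of morphisms and direct sums -/

section Homotopy

variable {B : DGAlg k} {X Y Z : DGMod B}

theorem DGMod.Homotopic.refl (f : X ⟶ Y) : DGMod.Homotopic f f :=
  ⟨0, by simp, by simp, by simp⟩

theorem DGMod.Homotopic.symm {f g : X ⟶ Y} : DGMod.Homotopic f g → DGMod.Homotopic g f := by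
  rintro ⟨h, h1, h2, h3⟩
  refine ⟨-h, fun i x hx => neg_mem (h1 i x hx), fun x b => by simp [h2], fun x => ?_⟩
  simp only [LinearMap.neg_apply, map_neg]
  rw [← neg_add, ← h3, neg_sub]

theorem DGMod.Homotopic.trans {f g h : X ⟶ Y} :
    DGMod.Homotopic f g → DGMod.Homotopic g h → DGMod.Homotopic f h := by
  rintro ⟨s, h1, h2, h3⟩ ⟨s', h1', h2', h3'⟩
  refine ⟨s + s', fun i x hx => add_mem (h1 i x hx) (h1' i x hx), fun x b => by simp [h2, h2'],
    fun x => ?_⟩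
  simp only [LinearMap.add_apply, map_add]
  rw [add_add_add_comm, ← h3, ← h3']
  abel

theorem DGMod.Homotopic.of_eq {f g : X ⟶ Y} (h : f = g) : DGMod.Homotopic f g := h ▸ .refl f

theorem DGMod.Homotopic.comp_right {f g : X ⟶ Y} (H : DGMod.Homotopic f g) (p : Y ⟶ Z) :
    DGMod.Homotopic (f ≫ p) (g ≫ p) := by
  obtain ⟨h, h1, h2, h3⟩ := H
  refine ⟨p.lin.comp h, fun i x hx => p.map_deg (h1 i x hx), fun x b => ?_, fun x => ?_⟩
  · simp [h2, p.map_act]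
  · simp only [DGMod.comp_lin, LinearMap.comp_apply]
    rw [← map_sub, h3, map_add, p.map_d]

theorem DGMod.Homotopic.restrict {C : DGAlg k} (φ : DGAlg.Hom C B) {f g : X ⟶ Y}
    (H : DGMod.Homotopic f g) :
    DGMod.Homotopic ((DGMod.res φ).map f) ((DGMod.res φ).map g) := by
  obtain ⟨h, h1, h2, h3⟩ := H
  exact ⟨h, h1, fun x b => h2 x (φ b), h3⟩

theorem DGMod.IsHtpyEquiv.restrict {C : DGAlg k} (φ : DGAlg.Hom C B) {f : X ⟶ Y}
    (hf : DGMod.IsHtpyEquiv f) : DGMod.IsHtpyEquiv ((DGMod.res φ).map f) := by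
  obtain ⟨g, h, h'⟩ := hf
  exact ⟨(DGMod.res φ).map g, h.restrict φ, h'.restrict φ⟩

/-- The direct sum of two right dg modules. -/
@[reducible] def DGMod.prod (X Y : DGMod B) : DGMod B where
  carrier := X × Y
  str :=
    { deg := fun i => (X.str.deg i).prod (Y.str.deg i)
      isInternal := by
        refine isInternal_of_proj _ (fun i => (X.str.proj i).prodMap (Y.str.proj i))
          (fun i x hx => Prod.ext (X.str.proj_same hx.1) (Y.str.proj_same hx.2))
          (fun i j h x hx => Prod.ext (X.str.proj_ne h hx.1) (Y.str.proj_ne h hx.2))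
          (fun x => ?_)
        have h1 : ∀ x : X, (x, (0 : Y)) ∈ ⨆ i, (X.str.deg i).prod (Y.str.deg i) := by
          intro x
          refine X.str.induction (P := fun x =>
            (x, (0 : Y)) ∈ ⨆ i, (X.str.deg i).prod (Y.str.deg i)) (zero_mem _)
            (fun _ _ h h' => by simpa using add_mem h h') (fun i x hx => ?_) x
          exact Submodule.mem_iSup_of_mem i ⟨hx, zero_mem _⟩
        have h2 : ∀ y : Y, ((0 : X), y) ∈ ⨆ i, (X.str.deg i).prod (Y.str.deg i) := by
          intro y
          refine Y.str.induction (P := fun y =>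
            ((0 : X), y) ∈ ⨆ i, (X.str.deg i).prod (Y.str.deg i)) (zero_mem _)
            (fun _ _ h h' => by simpa using add_mem h h') (fun i y hy => ?_) y
          exact Submodule.mem_iSup_of_mem i ⟨zero_mem _, hy⟩
        have := add_mem (h1 x.1) (h2 x.2)
        simpa using this
      d := X.str.d.prodMap Y.str.d
      d_mem := fun hx => ⟨X.str.d_mem hx.1, Y.str.d_mem hx.2⟩
      d_d := fun x => by simp [X.str.d_d, Y.str.d_d] }
  act := LinearMap.mk₂ k (fun x a => (X.act x.1 a, Y.act x.2 a))
    (fun _ _ _ => by simp) (fun _ _ _ => by simp) (fun _ _ _ => by simp) (fun _ _ _ => by simp)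
  act_one x := by simp [X.act_one, Y.act_one]
  act_mul x a b := by simp [X.act_mul, Y.act_mul]
  act_mem hx ha := ⟨X.act_mem hx.1 ha, Y.act_mem hx.2 ha⟩
  d_act a hx := by
    refine Prod.ext ?_ ?_
    · simp [X.d_act a hx.1]
    · simp [Y.d_act a hx.2]

end Homotopy

/-! ### Homotopic morphisms agree in the relative derived category -/

section Cylinder

variable {B : DGAlg k} (E : DGAlgOver B) {X Y : DGMod E.toDGAlg}

theorem relQis_of_isHtpyEquiv {f : X ⟶ Y} (hf : DGMod.IsHtpyEquiv f) : relQis E f :=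
  hf.restrict E.algMap

/-- The localization functor identifies homotopic morphisms. -/
theorem relQ_map_eq_of_homotopic {f g : X ⟶ Y} (H : DGMod.Homotopic f g) :
    (relQ E).map f = (relQ E).map g := by
  obtain ⟨h, h1, h2, h3⟩ := H
  -- A cylinder object: adding the contractible module `cone (𝟙 X)` does not change `X` up to
  -- homotopy, and it leaves room for two sections `i₀`, `i₁` of the projection `p`. The homotopy
  -- `h` becomes the morphism `K`, equal to `f` along `i₀` and to `g` along `i₁`.
  let C := X.prod (DGMod.cone (𝟙 X))
  let p : C ⟶ X :=
    { lin := LinearMap.fst k X (X × X)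
      map_deg := fun h => h.1
      map_d := fun _ => rfl
      map_act := fun _ _ => rfl }
  let i₀ : X ⟶ C :=
    { lin := LinearMap.id.prod (LinearMap.inr k X X)
      map_deg := fun h => ⟨h, zero_mem _, h⟩
      map_d := fun x => by simp [C]
      map_act := fun x b => by simp [C] }
  let i₁ : X ⟶ C :=
    { lin := LinearMap.inl k X (X × X)
      map_deg := fun h => ⟨h, zero_mem _, zero_mem _⟩
      map_d := fun x => by simp [C]; rfl
      map_act := fun x b => by simp [C]; rfl }
  let K : C ⟶ Y :=
    { lin := g.lin.coprod (h.coprod (f.lin - g.lin))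
      map_deg := fun {i x} hx => by
        refine add_mem (g.map_deg hx.1) (add_mem ?_ (sub_mem (f.map_deg hx.2.2)
          (g.map_deg hx.2.2)))
        simpa using h1 _ _ hx.2.1
      map_d := fun x => by
        obtain ⟨x, x', x''⟩ := x
        have := h3 x'
        change g.lin (X.str.d x) + (h (-X.str.d x') + (f.lin (x' + X.str.d x'') -
          g.lin (x' + X.str.d x''))) = Y.str.d (g.lin x + (h x' + (f.lin x'' - g.lin x'')))
        simp only [map_add, map_neg, map_sub, f.map_d, g.map_d]
        rw [sub_eq_iff_eq_add] at this
        rw [this]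
        abel
      map_act := fun x b => by simp [C, f.map_act, g.map_act, h2] }
  -- The homotopy on `C` is the standard contraction of `cone (𝟙 X)`, with the sign required by the
  -- convention `f - g = d h + h d`.
  have hp : relQis E p := by
    refine relQis_of_isHtpyEquiv E ⟨i₁, ⟨-((LinearMap.inr k X (X × X)).comp
      ((LinearMap.inl k X X).comp ((LinearMap.snd k X X).comp (LinearMap.snd k X (X × X))))),
      ?_, ?_, ?_⟩, .of_eq rfl⟩
    · rintro i ⟨x, x', x''⟩ ⟨hx, hx', hx''⟩
      refine neg_mem ⟨zero_mem _, ?_, zero_mem _⟩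
      simpa using hx''
    · rintro ⟨x, x', x''⟩ b
      simp [C]
    · rintro ⟨x, x', x''⟩
      change (x - x, (0, 0) - (x', x'')) = ((X.str.d (-0) + -0 : X), ((-X.str.d (-x'') +
        -(x' + X.str.d x'') : X), (-x'' + X.str.d (-0) + -0 : X)))
      simp
  have e0 : i₀ ≫ p = 𝟙 X := rfl
  have e1 : i₁ ≫ p = 𝟙 X := rfl
  have e2 : i₀ ≫ K = f := DGMod.hom_ext fun x => by
    change g.lin x + (h 0 + (f.lin x - g.lin x)) = f.lin x
    simp
  have e3 : i₁ ≫ K = g := DGMod.hom_ext fun x => by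
    change g.lin x + (h 0 + (f.lin 0 - g.lin 0)) = g.lin x
    simp
  have : IsIso ((relQ E).map p) := (relQis E).Q_inverts p hp
  -- Both are sections of `p`, which becomes invertible.
  have : (relQ E).map i₀ = (relQ E).map i₁ := by
    rw [← cancel_mono ((relQ E).map p), ← Functor.map_comp, ← Functor.map_comp, e0, e1]
  rw [← e2, ← e3, Functor.map_comp, Functor.map_comp, this]

theorem isIso_relQ_map {f : X ⟶ Y} (hf : relQis E f) : IsIso ((relQ E).map f) :=
  (relQis E).Q_inverts f hf

end Cylinder

/-! ### Contractibility of cones -/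

section Contractible

variable {B : DGAlg k} {X Y : DGMod B}

/-- A right dg module is contractible if its identity is the (graded) commutator of the
differential with a homogeneous linear map of degree `-1`. -/
def DGMod.IsContractible (Y : DGMod B) : Prop :=
  ∃ h : Y →ₗ[k] Y, IsGHom Y Y (-1) h ∧ ∀ y, Y.str.d (h y) + h (Y.str.d y) = y

/-- The cone of a homotopy equivalence is contractible. -/
theorem DGMod.IsHtpyEquiv.isContractible_cone {f : X ⟶ Y} (hf : DGMod.IsHtpyEquiv f) :
    (DGMod.cone f).IsContractible := by
  obtain ⟨g, ⟨h, h1, h2, h3⟩, ⟨h', h1', h2', h3'⟩⟩ := hf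
  have hh : IsGHom X X (-1) h := ⟨fun hx => h1 _ _ hx, h2⟩
  have hh' : IsGHom Y Y (-1) h' := ⟨fun hx => h1' _ _ hx, h2'⟩
  have H : ∀ x, h (X.str.d x) = g.lin (f.lin x) - x - X.str.d (h x) := fun x =>
    eq_sub_of_add_eq' (h3 x).symm
  have H' : ∀ y, h' (Y.str.d y) = f.lin (g.lin y) - y - Y.str.d (h' y) := fun x =>
    eq_sub_of_add_eq' (h3' x).symm
  -- The naive contraction `s (x, y) = (h x + g y, -h' y)` satisfies `d s + s d = 1 + N` with `N (x,
  -- y) = (0, e x)`, as `h` and `h'` need not be compatible. Since `e` anticommutes with `d`, `N`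
  -- commutes with the differential of the cone, and `N ^ 2 = 0`, so `(1 - N) s` is a true
  -- contraction. Its second row is given by `b` and `c`.
  let e : X →ₗ[k] Y := f.lin.comp h - h'.comp f.lin
  have he : IsGHom X Y (-1) e := (f.isGHom.comp hh (by simp)).sub (hh'.comp f.isGHom (by simp))
  have hed : ∀ x, e (X.str.d x) = - Y.str.d (e x) := by
    intro x
    change f.lin (h (X.str.d x)) - h' (f.lin (X.str.d x)) =
      -Y.str.d (f.lin (h x) - h' (f.lin x))
    rw [H, f.map_d, H', map_sub, map_sub, map_sub, f.map_d]
    abel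
  let c : Y →ₗ[k] Y := -h' - e.comp g.lin
  have hc : IsGHom Y Y (-1) c := hh'.neg.sub (he.comp g.isGHom (by simp))
  let b : X →ₗ[k] Y := -(e.comp h)
  have hb : IsGHom X Y (-2) b := (he.comp hh (by simp)).neg
  refine ⟨(h.coprod g.lin).prod (b.coprod c), ⟨?_, ?_⟩, ?_⟩
  · rintro i ⟨x, y⟩ ⟨hx, hy⟩
    refine ⟨add_mem ?_ ?_, add_mem ?_ ?_⟩
    · have := hh.deg hx
      rwa [add_right_comm] at this
    · simpa using g.map_deg hy
    · have := hb.deg hx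
      rwa [show i + 1 + -2 = i + -1 by ring] at this
    · exact hc.deg hy
  · rintro ⟨x, y⟩ a
    refine Prod.ext ?_ ?_
    · change h (X.act x a) + g.lin (Y.act y a) = X.act (h x + g.lin y) a
      simp [h2, g.map_act]
    · change b (X.act x a) + c (Y.act y a) = Y.act (b x + c y) a
      simp [hb.act, hc.act]
  · rintro ⟨x, y⟩
    refine Prod.ext ?_ ?_
    · change -X.str.d (h x + g.lin y) + (h (-X.str.d x) + g.lin (f.lin x + Y.str.d y)) = x
      simp only [map_add, map_neg, g.map_d, H]
      abel
    · change f.lin (h x + g.lin y) + Y.str.d (b x + c y) +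
        (b (-X.str.d x) + c (f.lin x + Y.str.d y)) = y
      have h5 : Y.str.d (b x) = - Y.str.d (e (h x)) := by simp [b]
      have h6 : b (-X.str.d x) = e (g.lin (f.lin x)) - e x + Y.str.d (e (h x)) := by
        simp [b, H, hed]
      have h7 : Y.str.d (c y) = - Y.str.d (h' y) - Y.str.d (e (g.lin y)) := by simp [c]
      have h8 : c (Y.str.d y) = -(f.lin (g.lin y) - y - Y.str.d (h' y)) +
          Y.str.d (e (g.lin y)) := by simp [c, H', g.map_d, hed]
      have h9 : c (f.lin x) = - h' (f.lin x) - e (g.lin (f.lin x)) := by simp [c]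
      have h10 : e x = f.lin (h x) - h' (f.lin x) := rfl
      rw [map_add, map_add, map_add, h5, h6, h7, h8, h9, h10]
      abel

end Contractible

/-! ### Relatively cofibrant modules -/

section Cofibrant

variable {B : DGAlg k} (E : DGAlgOver B) {P X Y Z : DGMod E.toDGAlg}

/-- `P` is relatively cofibrant: every closed homogeneous `E`-linear map from `P` to a right dg
`E`-module that is contractible over `B` is null-homotopic. -/
def IsCofib (P : DGMod E.toDGAlg) : Prop :=
  ∀ (Y : DGMod E.toDGAlg), (Y.restrict E.algMap).IsContractible → ∀ (e : ℤ) (f : P →ₗ[k] Y),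
    IsGHom P Y e f → (∀ x, Y.str.d (f x) = (-1 : k) ^ e • f (P.str.d x)) →
      ∃ g : P →ₗ[k] Y, IsGHom P Y (e - 1) g ∧
        ∀ x, Y.str.d (g x) + (-1 : k) ^ e • g (P.str.d x) = f x

variable {E}

theorem isContractible_restrict_cone {f : Y ⟶ Z} (hf : relQis E f) :
    ((DGMod.cone f).restrict E.algMap).IsContractible :=
  DGMod.IsHtpyEquiv.isContractible_cone hf

/-- The composite of `φ` with the inclusion of `Z` in `cone f` is null-homotopic, since the cone is
contractible over the base. The two components of a null-homotopy are the lift and, up to sign, the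
homotopy. -/
theorem IsCofib.exists_lift (hP : IsCofib E P) {f : Y ⟶ Z} (hf : relQis E f) (φ : P ⟶ Z) :
    ∃ ψ : P ⟶ Y, DGMod.Homotopic (ψ ≫ f) φ := by
  have hi : IsGHom P (DGMod.cone f) 0 ((LinearMap.inr k Y Z).comp φ.lin) :=
    ⟨fun hx => ⟨zero_mem _, by simpa using φ.map_deg hx⟩, fun x a => by
      refine Prod.ext ?_ (φ.map_act x a)
      change 0 = Y.act 0 a
      simp⟩
  obtain ⟨g, hg, H⟩ := hP _ (isContractible_restrict_cone hf) 0 _ hi (fun x => by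
    refine Prod.ext ?_ ?_
    · change -Y.str.d 0 = ((-1 : k) ^ (0 : ℤ) • (0 : Y))
      simp
    · change f.lin 0 + Z.str.d (φ.lin x) = (-1 : k) ^ (0 : ℤ) • φ.lin (P.str.d x)
      simp [φ.map_d])
  have H1 : ∀ x, -Y.str.d (g x).1 + (g (P.str.d x)).1 = 0 := fun x => by
    have := congrArg Prod.fst (H x)
    rw [zpow_zero, one_smul] at this
    exact this
  have H2 : ∀ x, f.lin (g x).1 + Z.str.d (g x).2 + (g (P.str.d x)).2 = φ.lin x := fun x => by
    have := congrArg Prod.snd (H x)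
    rw [zpow_zero, one_smul] at this
    exact this
  refine ⟨{ lin := (LinearMap.fst k Y Z).comp g
            map_deg := fun {i x} hx => ?_
            map_d := fun x => ?_
            map_act := fun x a => congrArg Prod.fst (hg.act x a) },
    -(LinearMap.snd k Y Z).comp g, fun i x hx => neg_mem (hg.deg hx).2, fun x a => ?_,
    fun x => ?_⟩
  · have := (hg.deg hx).1
    rw [show i + (0 - 1) + 1 = i by ring] at this
    exact this
  · change (g (P.str.d x)).1 = Y.str.d (g x).1
    have := H1 x
    linear_combination (norm := abel) this
  · have : (g (P.act x a)).2 = Z.act (g x).2 a := congrArg Prod.snd (hg.act x a)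
    change -(g (P.act x a)).2 = Z.act (-(g x).2) a
    simp [this]
  · change f.lin (g x).1 - φ.lin x = Z.str.d (-(g x).2) + -(g (P.str.d x)).2
    have := H2 x
    rw [map_neg]
    linear_combination (norm := abel) this

/-- A homotopy `u` from `ψ f` to `ψ' f` makes the pair `(ψ - ψ', -u)` a closed map of degree `-1` to
`cone f`. The first component of a null-homotopy of this pair is, up to sign, a homotopy from `ψ` to
`ψ'`. -/
theorem IsCofib.homotopic_of_comp (hP : IsCofib E P) {f : Y ⟶ Z} (hf : relQis E f)
    {ψ ψ' : P ⟶ Y} (H : DGMod.Homotopic (ψ ≫ f) (ψ' ≫ f)) : DGMod.Homotopic ψ ψ' := by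
  obtain ⟨u, u1, u2, u3⟩ := H
  have hu : IsGHom P Z (-1) u := ⟨fun hx => u1 _ _ hx, u2⟩
  have hF : IsGHom P (DGMod.cone f) (-1) ((ψ.lin - ψ'.lin).prod (-u)) := by
    refine ⟨fun {i x} hx => ⟨?_, neg_mem (hu.deg hx)⟩, fun x a => Prod.ext ?_ ?_⟩
    · rw [neg_add_cancel_right]
      exact sub_mem (ψ.map_deg hx) (ψ'.map_deg hx)
    · change ψ.lin (P.act x a) - ψ'.lin (P.act x a) = Y.act (ψ.lin x - ψ'.lin x) a
      simp [ψ.map_act, ψ'.map_act]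
    · change -u (P.act x a) = Z.act (-u x) a
      simp [u2]
  obtain ⟨g, hg, H⟩ := hP _ (isContractible_restrict_cone hf) (-1) _ hF (fun x => by
    have hs : (-1 : k) ^ (-1 : ℤ) = -1 := by simp [zpow_neg]
    rw [hs, neg_smul, one_smul]
    refine Prod.ext ?_ ?_
    · change -Y.str.d (ψ.lin x - ψ'.lin x) = -(ψ.lin (P.str.d x) - ψ'.lin (P.str.d x))
      rw [map_sub, ψ.map_d, ψ'.map_d]
    · change f.lin (ψ.lin x - ψ'.lin x) + Z.str.d (-u x) = -(-u (P.str.d x))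
      have : f.lin (ψ.lin x) - f.lin (ψ'.lin x) = Z.str.d (u x) + u (P.str.d x) := u3 x
      rw [map_sub, map_neg, this]
      abel)
  have hs : (-1 : k) ^ (-1 : ℤ) = -1 := by simp [zpow_neg]
  have H1 : ∀ x, -Y.str.d (g x).1 + -(g (P.str.d x)).1 = ψ.lin x - ψ'.lin x := fun x => by
    have := congrArg Prod.fst (H x)
    rw [hs, neg_smul, one_smul] at this
    exact this
  refine ⟨-(LinearMap.fst k Y Z).comp g, fun i x hx => ?_, fun x a => ?_, fun x => ?_⟩
  · have := neg_mem (hg.deg hx).1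
    rw [show i + (-1 - 1) + 1 = i - 1 by ring] at this
    exact this
  · have : (g (P.act x a)).1 = Y.act (g x).1 a := congrArg Prod.fst (hg.act x a)
    change -(g (P.act x a)).1 = Y.act (-(g x).1) a
    simp [this]
  · change ψ.lin x - ψ'.lin x = Y.str.d (-(g x).1) + -(g (P.str.d x)).1
    rw [map_neg, H1]

end Cofibrant

/-! ### Morphisms of the derived category out of a cofibrant module -/

section HomotopyClasses

variable {B : DGAlg k} (E : DGAlgOver B)

/-- The homotopy relation on morphisms of right dg modules. -/
def DGMod.homotopySetoid {A : DGAlg k} (X Y : DGMod A) : Setoid (X ⟶ Y) where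
  r := DGMod.Homotopic
  iseqv := ⟨DGMod.Homotopic.refl, DGMod.Homotopic.symm, DGMod.Homotopic.trans⟩

/-- Homotopy classes of morphisms from `P`, as a functor. -/
def DGMod.homotopyClasses {A : DGAlg k} (P : DGMod A) : DGMod A ⥤ Type u where
  obj Y := Quotient (DGMod.homotopySetoid P Y)
  map {Y Z} f := TypeCat.ofHom (Quotient.map' (fun g => g ≫ f) fun _ _ h => h.comp_right f)
  map_id Y := by
    ext x
    induction x using Quotient.inductionOn with
    | _ g => rfl
  map_comp f g := by
    ext x
    induction x using Quotient.inductionOn with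
    | _ g => rfl

/-- Surjectivity on homotopy classes is `IsCofib.exists_lift`, injectivity is
`IsCofib.homotopic_of_comp`. Hence homotopy classes out of `P` form a functor on the localized
category. -/
theorem IsCofib.inverts_homotopyClasses {E : DGAlgOver B} {P : DGMod E.toDGAlg}
    (hP : IsCofib E P) : (relQis E).IsInvertedBy (DGMod.homotopyClasses P) := by
  intro Y Z f hf
  rw [isIso_iff_bijective]
  constructor
  · intro a b
    induction a using Quotient.inductionOn with | _ a =>
    induction b using Quotient.inductionOn with | _ b =>
    intro h
    exact Quotient.sound (hP.homotopic_of_comp hf (Quotient.exact h))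
  · intro b
    induction b using Quotient.inductionOn with | _ b =>
    obtain ⟨a, ha⟩ := hP.exists_lift hf b
    exact ⟨Quotient.mk _ a, Quotient.sound ha⟩

variable {E} {P : DGMod E.toDGAlg}

/-- The functor of homotopy classes from a relatively cofibrant module on the relative derived
category. -/
noncomputable def IsCofib.derClasses (hP : IsCofib E P) : RelD E ⥤ Type u :=
  Localization.Construction.lift (DGMod.homotopyClasses P) hP.inverts_homotopyClasses

theorem IsCofib.derClasses_map (hP : IsCofib E P) {Y Z : DGMod E.toDGAlg} (f : Y ⟶ Z)
    (g : P ⟶ Y) :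
    hP.derClasses.map ((relQ E).map f) (Quotient.mk (DGMod.homotopySetoid P Y) g) =
      Quotient.mk (DGMod.homotopySetoid P Z) (g ≫ f) := by
  have h : hP.derClasses.map ((relQ E).map f) = (DGMod.homotopyClasses P).map f :=
    (Functor.congr_hom (Localization.Construction.fac (DGMod.homotopyClasses P)
      hP.inverts_homotopyClasses) f).trans ((Category.id_comp _).trans (Category.comp_id _))
  exact congrArg (fun (F : (DGMod.homotopyClasses P).obj Y ⟶ (DGMod.homotopyClasses P).obj Z) =>
    F (Quotient.mk (DGMod.homotopySetoid P Y) g)) h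

/-- The morphism of the relative derived category given by a homotopy class. -/
noncomputable def relQClass {P Y : DGMod E.toDGAlg} :
    (DGMod.homotopyClasses P).obj Y → ((relQ E).obj P ⟶ (relQ E).obj Y) :=
  Quotient.lift (fun g => (relQ E).map g) fun _ _ h => relQ_map_eq_of_homotopic E h

/-- A Yoneda argument: the comparison from homotopy classes to morphisms of the derived category is
natural in every morphism of the localization. Evaluated at the class of the identity, it shows that
the comparison is surjective. Naturality need only be tested on images of dg morphisms and on the
formal inverses. -/
theorem IsCofib.relQClass_map (hP : IsCofib E P) {Y Z : RelD E} (α : Y ⟶ Z) :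
    ∀ x : hP.derClasses.obj Y, relQClass (Y := (Localization.Construction.objEquiv _).symm Z)
      (hP.derClasses.map α x) = relQClass (Y := (Localization.Construction.objEquiv _).symm Y)
        x ≫ α := by
  let T : MorphismProperty (RelD E) := fun Y Z α => ∀ x : hP.derClasses.obj Y,
    relQClass (Y := (Localization.Construction.objEquiv _).symm Z)
      (hP.derClasses.map α x) = relQClass (Y := (Localization.Construction.objEquiv _).symm Y)
        x ≫ α
  have : T.IsStableUnderComposition := ⟨fun f g hf hg x => by
    rw [Functor.map_comp]
    exact (hg _).trans ((congrArg (fun t => t ≫ g) (hf x)).trans (Category.assoc _ _ _))⟩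
  have hQ : ∀ ⦃Y Z : DGMod E.toDGAlg⦄ (f : Y ⟶ Z), T ((relQ E).map f) := by
    intro Y Z f x
    induction x using Quotient.inductionOn with | _ g =>
    exact (congrArg relQClass (hP.derClasses_map f g)).trans ((relQ E).map_comp g f)
  have hT : T = ⊤ := by
    -- For a formal inverse of `w`, naturality for `w` is applied to the image of the class under
    -- the inverse, and `w` is then cancelled.
    refine Localization.Construction.morphismProperty_eq_top T hQ ?_
    intro Y Z w hw x
    have h := hQ w (hP.derClasses.map (Localization.Construction.wIso w hw).inv x)
    have h1 : hP.derClasses.map ((relQ E).map w)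
        (hP.derClasses.map (Localization.Construction.wIso w hw).inv x) = x := by
      have h2 := hP.derClasses.map_comp (Localization.Construction.wIso w hw).inv
        (Localization.Construction.wIso w hw).hom
      rw [Iso.inv_hom_id, CategoryTheory.Functor.map_id] at h2
      exact (congrArg (fun F => F x) h2).symm
    rw [h1] at h
    have h3 := congrArg (fun t => t ≫ (Localization.Construction.wIso w hw).inv) h
    refine Eq.trans ?_ h3.symm
    refine (Category.comp_id _).symm.trans (Eq.trans ?_ (Category.assoc _ _ _).symm)
    congr 1
    exact (Localization.Construction.wIso w hw).hom_inv_id.symm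
  have : T α := by rw [hT]; trivial
  exact this

/-- Every morphism of the relative derived category out of a relatively cofibrant module comes
from a morphism of dg modules. -/
theorem IsCofib.exists_relQ_map_eq (hP : IsCofib E P) {Y : DGMod E.toDGAlg}
    (α : (relQ E).obj P ⟶ (relQ E).obj Y) : ∃ f : P ⟶ Y, (relQ E).map f = α := by
  have h := hP.relQClass_map α (Quotient.mk (DGMod.homotopySetoid P P) (𝟙 P))
  obtain ⟨f, hf⟩ := Quotient.exists_rep
    (hP.derClasses.map α (Quotient.mk (DGMod.homotopySetoid P P) (𝟙 P)) :
      (DGMod.homotopyClasses P).obj Y)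
  refine ⟨f, ?_⟩
  have h1 : (relQ E).map f = (relQ E).map (𝟙 P) ≫ α := (congrArg relQClass hf).trans h
  exact h1.trans ((congrArg (· ≫ α) ((relQ E).map_id P)).trans (Category.id_comp α))

/-- Morphisms of dg modules out of a relatively cofibrant module that agree in the relative
derived category are homotopic. -/
theorem IsCofib.homotopic_of_relQ_map_eq (hP : IsCofib E P) {Y : DGMod E.toDGAlg} {f g : P ⟶ Y}
    (h : (relQ E).map f = (relQ E).map g) : DGMod.Homotopic f g := by
  -- The functor `derClasses` sees only the images of `f` and `g` in the derived category, yet it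
  -- sends the class of the identity to the homotopy classes of `f` and `g`.
  have hf := hP.derClasses_map f (𝟙 P)
  have hg := hP.derClasses_map g (𝟙 P)
  rw [h, hg] at hf
  have := Quotient.exact hf
  simp only [Category.id_comp] at this
  exact DGMod.Homotopic.symm this

end HomotopyClasses

/-! ### Graded free modules by coordinates -/

section Free

/-- A converse to `DGMod.IsGradedFree.exists_coord`: the coordinate map is a left inverse of the map
defined by the basis, which gives injectivity, and the induction principle gives surjectivity. -/
theorem DGMod.IsGradedFree.of_coord {B : DGAlg k} {X : DGMod B} {I : Type u} {n : I → ℤ}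
    {b : I → X} (c : X →ₗ[k] (I →₀ B)) (hb : ∀ i, b i ∈ X.str.deg (n i))
    (hc : ∀ i a, c (X.act (b i) a) = Finsupp.single i a)
    (hspan : ∀ P : X → Prop, P 0 → (∀ x y, P x → P y → P (x + y)) →
      (∀ i a, P (X.act (b i) a)) → ∀ x, P x) : X.IsGradedFree := by
  have h1 : ∀ f : I →₀ B, c (f.sum fun i a => X.act (b i) a) = f := by
    intro f
    rw [Finsupp.sum, map_sum]
    simp only [hc]
    exact f.sum_single
  refine ⟨I, n, b, hb, Function.LeftInverse.injective h1, fun x => ?_⟩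
  refine hspan (fun x => ∃ f : I →₀ B, (f.sum fun i a => X.act (b i) a) = x) ⟨0, by simp⟩ ?_ ?_ x
  · rintro _ _ ⟨f, rfl⟩ ⟨g, rfl⟩
    exact ⟨f + g, Finsupp.sum_add_index' (by simp) (by simp)⟩
  · intro i a
    exact ⟨Finsupp.single i a, by simp⟩

/-- Coordinates on `X ⊗_B N` for a graded free right module `X`. -/
theorem Tens.exists_coord {B : DGAlg k} {X : DGMod B} (N : DGLMod B) {I : Type u} {b : I → X}
    (c : X →ₗ[k] (I →₀ B)) (hc : ∀ i a, c (X.act (b i) a) = Finsupp.single i a)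
    (hspan : ∀ P : X → Prop, P 0 → (∀ x y, P x → P y → P (x + y)) →
      (∀ i a, P (X.act (b i) a)) → ∀ x, P x) :
    ∃ c' : Tens X N →ₗ[k] (I →₀ N), (∀ i n, c' (tmk X N (b i) n) = Finsupp.single i n) ∧
      ∀ P : Tens X N → Prop, P 0 → (∀ x y, P x → P y → P (x + y)) →
        (∀ i n, P (tmk X N (b i) n)) → ∀ x, P x := by
  -- Dictated by `b i · a ⊗ n = b i ⊗ a n`.
  let T0 : (I →₀ B) →ₗ[k] N →ₗ[k] (I →₀ N) := Finsupp.lsum k fun i =>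
    N.act.compr₂ (Finsupp.lsingle i)
  let T : X →ₗ[k] N →ₗ[k] (I →₀ N) := T0.comp c
  have hT : ∀ i a n, T (X.act (b i) a) n = Finsupp.single i (N.act a n) := by
    intro i a n
    change T0 (c _) n = _
    rw [hc]
    simp [T0]
  have hbal : ∀ x r n, T (X.act x r) n = T x (N.act r n) := by
    intro x r n
    refine hspan (fun x => T (X.act x r) n = T x (N.act r n)) (by simp)
      (fun _ _ h h' => by simp only [map_add, LinearMap.add_apply, h, h']) (fun i a => ?_) x
    rw [← X.act_mul, hT, hT, N.mul_act]
  refine ⟨Tens.lift T fun _ _ _ x _ r _ n _ => hbal x r n, fun i n => ?_, fun P h0 hadd h x => ?_⟩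
  · rw [Tens.lift_tmk, ← X.act_one (b i), hT, N.one_act]
  · refine Tens.induction h0 hadd (fun _ _ x _ n _ => ?_) x
    refine hspan (fun x => P (tmk X N x n)) (by simpa using h0)
      (fun _ _ h h' => by simpa using hadd _ _ h h') (fun i a => ?_) x
    rw [tmk_balanced]
    exact h i _

end Free

/-! ### Extension of scalars `V ⊗_B E` -/

section Induce

variable {B E : DGAlg k} (V : DGMod B) (φ : DGAlg.Hom B E)

/-- `E` as a left dg `B`-module. -/
@[reducible] def DGAlg.Hom.leftMod : DGLMod B := (DGLMod.self E).restrict φ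

/-- The right action of `E` on `V ⊗_B E`. -/
def induceAct : Tens V φ.leftMod →ₗ[k] E →ₗ[k] Tens V φ.leftMod :=
  Tens.lift (LinearMap.mk₂ k (fun v e => (tmk V φ.leftMod v).comp (LinearMap.mulLeft k e))
    (fun _ _ _ => by ext; simp) (fun _ _ _ => by ext; simp)
    (fun _ _ _ => by ext; simp [add_mul]) (fun _ _ _ => by ext; simp)) <| by
    intro i j l x hx b hb n hn
    ext e
    simp only [LinearMap.mk₂_apply, LinearMap.comp_apply, LinearMap.mulLeft_apply]
    refine (tmk_balanced (X := V) (N := φ.leftMod) x b (n * e : E)).trans ?_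
    congr 1
    exact (mul_assoc (φ b) n e).symm

theorem induceAct_tmk (v : V) (e e' : E) :
    induceAct V φ (tmk V φ.leftMod v e) e' = tmk V φ.leftMod v (e * e' : E) := by
  rw [induceAct, Tens.lift_tmk, LinearMap.mk₂_apply]
  rfl

/-- The right dg `E`-module `V ⊗_B E`. -/
@[reducible] noncomputable def DGMod.induce : DGMod E where
  carrier := Tens V φ.leftMod
  str := Tens.str V φ.leftMod
  act := induceAct V φ
  act_one t := by
    refine Tens.induction (P := fun t => induceAct V φ t 1 = t) (by simp)
      (fun _ _ h h' => by simp [h, h']) (fun i j x hx n hn => ?_) t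
    rw [induceAct_tmk, mul_one]
  act_mul t a b := by
    refine Tens.induction (P := fun t => induceAct V φ t (a * b) =
      induceAct V φ (induceAct V φ t a) b) (by simp)
      (fun _ _ h h' => by simp only [map_add, LinearMap.add_apply, h, h'])
      (fun i j x hx n hn => ?_) t
    rw [induceAct_tmk, induceAct_tmk, induceAct_tmk, mul_assoc]
  act_mem {i j t a} ht ha := by
    refine Tens.deg_induction (P := fun t => induceAct V φ t a ∈ Tens.deg V φ.leftMod (i + j))
      (by simp) (fun _ _ h h' => by rw [map_add, LinearMap.add_apply]; exact add_mem h h') ?_ ht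
    rintro p q x hx n hn rfl
    rw [induceAct_tmk, add_assoc]
    exact tmk_mem (X := V) (N := φ.leftMod) hx (E.mul_mem hn ha)
  d_act {i t} a ht := by
    refine Tens.deg_induction (P := fun t => Tens.d V φ.leftMod (induceAct V φ t a) =
      induceAct V φ (Tens.d V φ.leftMod t) a + (-1 : k) ^ i • induceAct V φ t (E.str.d a))
      (by simp) (fun _ _ h h' => by
        simp only [map_add, LinearMap.add_apply, h, h', smul_add]; abel) ?_ ht
    rintro p q x hx n hn rfl
    have h1 : φ.leftMod.str.d (n * a : E) = (E.str.d n * a + (-1 : k) ^ q • (n * E.str.d a) : E) :=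
      E.d_mul a hn
    rw [induceAct_tmk, induceAct_tmk, Tens.d_tmk _ _ hx, Tens.d_tmk _ _ hx, h1]
    simp only [map_add, map_smul, LinearMap.add_apply, LinearMap.smul_apply, smul_add, smul_smul,
      sgn_add]
    rw [add_assoc, induceAct_tmk]
    erw [induceAct_tmk V φ x (E.str.d n) a]

variable {V φ}

theorem induce_act_tmk (v : V) (e e' : E) :
    (V.induce φ).act (tmk V φ.leftMod v e) e' = tmk V φ.leftMod v (e * e' : E) :=
  induceAct_tmk V φ v e e'

/-- The `B`-linear unit `v ↦ v ⊗ 1`. -/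
noncomputable def induceUnit : V ⟶ (V.induce φ).restrict φ where
  lin := (tmk V φ.leftMod).flip (1 : E)
  map_deg {i v} hv := by
    have := tmk_mem (X := V) (N := φ.leftMod) hv E.one_mem
    rwa [add_zero] at this
  map_d v := by
    refine V.str.induction (P := fun v => tmk V φ.leftMod (V.str.d v) (1 : E) =
      Tens.d V φ.leftMod (tmk V φ.leftMod v (1 : E))) (by simp)
      (fun _ _ h h' => by simp only [map_add, LinearMap.add_apply, h, h']) (fun i v hv => ?_) v
    have h1 : φ.leftMod.str.d (1 : E) = 0 := E.d_one
    rw [Tens.d_tmk _ _ hv, h1, map_zero, smul_zero, add_zero]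
  map_act v b := by
    change tmk V φ.leftMod (V.act v b) (1 : E) = induceAct V φ (tmk V φ.leftMod v (1 : E)) (φ b)
    rw [induceAct_tmk]
    refine (tmk_balanced (X := V) (N := φ.leftMod) v b (1 : E)).trans ?_
    congr 1
    exact (mul_one (φ b)).trans (one_mul (φ b)).symm

theorem induceUnit_lin (v : V) :
    (induceUnit : V ⟶ (V.induce φ).restrict φ).lin v = tmk V φ.leftMod v (1 : E) := rfl

/-- No compatibility with degrees or differentials is required, so the principle also applies to
homotopies and to graded commutators. -/
theorem induce_ext {W : Type u} [AddCommGroup W] [Module k W] {Y : DGMod E}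
    {f g : V.induce φ →ₗ[k] Y} (hf : ∀ x a, f ((V.induce φ).act x a) = Y.act (f x) a)
    (hg : ∀ x a, g ((V.induce φ).act x a) = Y.act (g x) a)
    (h : ∀ v, f (tmk V φ.leftMod v (1 : E)) = g (tmk V φ.leftMod v (1 : E))) : f = g := by
  refine Tens.hom_ext fun i j v _ e _ => ?_
  have : tmk V φ.leftMod v e = (V.induce φ).act (tmk V φ.leftMod v (1 : E)) e := by
    rw [induce_act_tmk, one_mul]
  rw [this, hf, hg, h]

/-- The `E`-linear map on `V ⊗_B E` given by a `B`-linear map. -/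
def induceLift {Y : DGMod E} (γ : V →ₗ[k] Y)
    (hγ : ∀ v b, γ (V.act v b) = (Y.restrict φ).act (γ v) b) : V.induce φ →ₗ[k] Y :=
  Tens.lift (X := V) (N := φ.leftMod) (Y.act.comp γ) fun _ _ _ v _ b _ e _ => by
    rw [LinearMap.comp_apply, LinearMap.comp_apply, hγ]
    exact (Y.act_mul _ _ _).symm

theorem induceLift_tmk {Y : DGMod E} (γ : V →ₗ[k] Y) (hγ) (v : V) (e : E) :
    induceLift (φ := φ) γ hγ (tmk V φ.leftMod v e) = Y.act (γ v) e := by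
  rw [induceLift, Tens.lift_tmk]; rfl

theorem isGHom_induceLift {Y : DGMod E} {γ : V →ₗ[k] Y} {e : ℤ}
    (hγ : IsGHom V (Y.restrict φ) e γ) :
    IsGHom (V.induce φ) Y e (induceLift (φ := φ) γ hγ.act) := by
  refine ⟨fun {i x} hx => ?_, fun x a => ?_⟩
  · refine Tens.deg_induction (X := V) (N := φ.leftMod)
      (P := fun x => induceLift (φ := φ) γ hγ.act x ∈ Y.str.deg (i + e)) (by simp)
      (fun _ _ h h' => by rw [map_add]; exact add_mem h h') ?_ hx
    rintro p q v hv a ha rfl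
    rw [induceLift_tmk, show p + q + e = p + e + q by ring]
    exact Y.act_mem (hγ.deg hv) ha
  · refine Tens.induction (X := V) (N := φ.leftMod)
      (P := fun x => induceLift (φ := φ) γ hγ.act (induceAct V φ x a) =
        Y.act (induceLift (φ := φ) γ hγ.act x) a) (by simp)
      (fun _ _ h h' => by simp only [map_add, LinearMap.add_apply, h, h'])
      (fun _ _ v _ e' _ => ?_) x
    rw [induceAct_tmk, induceLift_tmk, induceLift_tmk, Y.act_mul]

theorem DGMod.IsGradedFree.induce (hV : V.IsGradedFree) (φ : DGAlg.Hom B E) :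
    (V.induce φ).IsGradedFree := by
  obtain ⟨I, n, b, c, hb, hc, hspan⟩ := hV.exists_coord
  obtain ⟨c', hc', hspan'⟩ := Tens.exists_coord φ.leftMod c hc hspan
  have hact : ∀ i (a : E), (V.induce φ).act (tmk V φ.leftMod (b i) (1 : E)) a =
      tmk V φ.leftMod (b i) a := fun i a => by rw [induce_act_tmk, one_mul]
  refine DGMod.IsGradedFree.of_coord (X := V.induce φ) (n := n)
    (b := fun i => tmk V φ.leftMod (b i) (1 : E)) c' (fun i => ?_) (fun i a => ?_)
    (fun P h0 hadd h x => hspan' P h0 hadd (fun i a => ?_) x)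
  · exact (induceUnit : V ⟶ (V.induce φ).restrict φ).map_deg (hb i)
  · rw [hact, hc']
  · rw [← hact]; exact h i a

/-- A graded free module over a graded free algebra is graded free over the base. -/
theorem DGMod.IsGradedFree.restrict {X : DGMod E} (hX : X.IsGradedFree)
    (hE : ((DGMod.self E).restrict φ).IsGradedFree) : (X.restrict φ).IsGradedFree := by
  obtain ⟨I, n, b, c, hb, hc, hspan⟩ := hX.exists_coord
  obtain ⟨J, m, b', c', hb', hc', hspan'⟩ := hE.exists_coord
  let T : (I →₀ E) →ₗ[k] (I × J →₀ B) := Finsupp.lsum k fun i =>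
    (Finsupp.lmapDomain B k (Prod.mk i)).comp c'
  refine DGMod.IsGradedFree.of_coord (X := X.restrict φ) (I := I × J)
    (n := fun p => n p.1 + m p.2) (b := fun p => X.act (b p.1) (b' p.2)) (T.comp c)
    (fun p => X.act_mem (hb p.1) (hb' p.2)) ?_ ?_
  · rintro ⟨i, j⟩ a
    change T (c (X.act (X.act (b i) (b' j)) (φ a))) = _
    rw [← X.act_mul, hc]
    have h := hc' j a
    change c' (HMul.hMul (α := E) (b' j) (φ a)) = _ at h
    simp only [T, Finsupp.lsum_apply]
    rw [Finsupp.sum_single_index (by simp)]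
    simp only [LinearMap.comp_apply]
    rw [h]
    simp
  · intro P h0 hadd h
    refine hspan P h0 hadd fun i => ?_
    refine hspan' (fun a => P (X.act (b i) a)) (by simpa using h0)
      (fun _ _ h h' => by simpa using hadd _ _ h h') fun j a => ?_
    have := h (i, j) a
    change P (X.act (X.act (b i) (b' j)) (φ a)) at this
    rw [← X.act_mul] at this
    exact this

end Induce

/-! ### Induced modules are relatively cofibrant -/

section RelativelyFree

variable {B : DGAlg k} (E : DGAlgOver B)

/-- By adjunction, an `E`-linear null-homotopy on `V ⊗_B E` amounts to a `B`-linear one on `V`, and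
a contraction `h` of the target over `B` provides it: compose the restriction of `f` to `V` with
`h`. -/
theorem isCofib_induce (V : DGMod B) : IsCofib E (V.induce E.algMap) := by
  rintro Y ⟨h, hh, H⟩ e f hf hfd
  let γ : V →ₗ[k] Y := h.comp (f.comp (induceUnit (φ := E.algMap) (V := V)).lin)
  have hγ : IsGHom V (Y.restrict E.algMap) (e - 1) γ :=
    hh.comp ((hf.restrict E.algMap).comp (induceUnit (φ := E.algMap) (V := V)).isGHom
      (zero_add e)) (by ring)
  have hg := isGHom_induceLift (φ := E.algMap) hγ
  refine ⟨_, hg, ?_⟩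
  -- The graded commutator is `E`-linear, so it can be compared with `f` on the elements `v ⊗ 1`.
  -- There the identity reduces to `d h + h d = 1` and the closedness of `f`.
  have hcomm := hg.commutator ((-1 : k) ^ e) (by rw [sub_add_cancel])
  have : Y.str.d.comp (induceLift (φ := E.algMap) γ hγ.act) + (-1 : k) ^ e •
      (induceLift (φ := E.algMap) γ hγ.act).comp (V.induce E.algMap).str.d = f := by
    refine induce_ext (W := Y) hcomm.act hf.act fun v => ?_
    have hu := (induceUnit (φ := E.algMap) (V := V)).map_d v
    have hu' : (V.induce E.algMap).str.d (tmk V E.algMap.leftMod v (1 : E.toDGAlg)) =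
      tmk V E.algMap.leftMod (V.str.d v) (1 : E.toDGAlg) := hu.symm
    simp only [LinearMap.add_apply, LinearMap.comp_apply, LinearMap.smul_apply]
    rw [hu', induceLift_tmk, induceLift_tmk, Y.act_one, Y.act_one]
    change Y.str.d (h (f (tmk V E.algMap.leftMod v (1 : E.toDGAlg)))) + (-1 : k) ^ e •
      h (f (tmk V E.algMap.leftMod (V.str.d v) (1 : E.toDGAlg))) = _
    have h2 := H (f (tmk V E.algMap.leftMod v (1 : E.toDGAlg)))
    change Y.str.d _ + h (Y.str.d _) = _ at h2
    rw [hfd, hu', map_smul] at h2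
    exact h2
  exact LinearMap.congr_fun this

end RelativelyFree

/-! ### Total module of a complex of dg modules -/

section Total

variable {A : DGAlg k} (Z : ℕ → DGMod A) (δ : ∀ n, Z (n + 1) ⟶ Z n)

/-- The inclusion of the `n`-th summand. -/
def totalι (n : ℕ) : Z n →ₗ[k] DirectSum ℕ fun n => (Z n).carrier :=
  DirectSum.lof k ℕ (fun n => (Z n).carrier) n

/-- The linear map on the direct sum given by its components. -/
def totalLift {W : Type u} [AddCommGroup W] [Module k W] (f : ∀ n, Z n →ₗ[k] W) :
    (DirectSum ℕ fun n => (Z n).carrier) →ₗ[k] W := DirectSum.toModule k ℕ W f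

variable {Z}

@[simp] theorem totalLift_ι {W : Type u} [AddCommGroup W] [Module k W] (f : ∀ n, Z n →ₗ[k] W)
    (n : ℕ) (z : Z n) : totalLift Z f (totalι Z n z) = f n z :=
  DirectSum.toModule_lof (M := fun n => (Z n).carrier) (φ := f) k n z

theorem total_induction {P : (DirectSum ℕ fun n => (Z n).carrier) → Prop} (zero : P 0)
    (add : ∀ x y, P x → P y → P (x + y)) (hom : ∀ n z, P (totalι Z n z)) (x) : P x := by
  induction x using DirectSum.induction_on with
  | zero => exact zero
  | of n z => exact hom n z
  | add x y hx hy => exact add x y hx hy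

/-- The component of the differential of the total module that lowers the index. -/
def totalDown : ∀ n, Z n →ₗ[k] DirectSum ℕ fun n => (Z n).carrier
  | 0 => 0
  | n + 1 => (totalι Z n).comp (δ n).lin

/-- The differential of the total module. -/
noncomputable def totalD :
    (DirectSum ℕ fun n => (Z n).carrier) →ₗ[k] DirectSum ℕ fun n => (Z n).carrier :=
  totalLift Z fun n => (-1 : k) ^ (n : ℤ) • (totalι Z n).comp (Z n).str.d + totalDown δ n

theorem totalD_ι (n : ℕ) (z : Z n) : totalD δ (totalι Z n z) =
    (-1 : k) ^ (n : ℤ) • totalι Z n ((Z n).str.d z) + totalDown δ n z := by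
  simp [totalD]

variable (Z) in
/-- The action on the total module. -/
noncomputable def totalAct : (DirectSum ℕ fun n => (Z n).carrier) →ₗ[k] A →ₗ[k]
    DirectSum ℕ fun n => (Z n).carrier :=
  totalLift Z fun n => (Z n).act.compr₂ (totalι Z n)

theorem totalAct_ι (n : ℕ) (z : Z n) (a : A) :
    totalAct Z (totalι Z n z) a = totalι Z n ((Z n).act z a) := by
  simp [totalAct]

variable (Z) in
/-- The degree `m` part of the total module. -/
def totalDeg (m : ℤ) : Submodule k (DirectSum ℕ fun n => (Z n).carrier) :=
  ⨆ n : ℕ, ((Z n).str.deg (m + n)).map (totalι Z n)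

theorem totalι_mem {n : ℕ} {m j : ℤ} {z : Z n} (hz : z ∈ (Z n).str.deg j) (h : m + n = j) :
    totalι Z n z ∈ totalDeg Z m :=
  Submodule.mem_iSup_of_mem n ⟨z, by subst h; exact hz, rfl⟩

theorem totalDeg_induction {m : ℤ} {P : (DirectSum ℕ fun n => (Z n).carrier) → Prop}
    (zero : P 0) (add : ∀ x y, P x → P y → P (x + y))
    (hom : ∀ n, ∀ z ∈ (Z n).str.deg (m + n), P (totalι Z n z)) {x} (hx : x ∈ totalDeg Z m) :
    P x := by
  induction hx using Submodule.iSup_induction' with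
  | mem n x hx =>
    obtain ⟨z, hz, rfl⟩ := hx
    exact hom n z hz
  | zero => exact zero
  | add x y _ _ hx hy => exact add x y hx hy

/-- The cross terms of the square of the differential: `δ` commutes with the internal differentials,
whose signs `(-1) ^ n` alternate, so these terms cancel. The component that lowers the index twice
vanishes by `δ ∘ δ = 0`. -/
theorem totalD_down (hδ : ∀ n x, (δ n).lin ((δ (n + 1)).lin x) = 0) (n : ℕ) (z : Z n) :
    totalD δ (totalDown δ n z) = -((-1 : k) ^ (n : ℤ) • totalDown δ n ((Z n).str.d z)) := by
  cases n with
  | zero => simp [totalDown]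
  | succ n =>
    have h : totalDown δ n ((δ n).lin z) = 0 := by
      cases n with
      | zero => rfl
      | succ n => simp [totalDown, hδ]
    simp only [totalDown, LinearMap.comp_apply]
    rw [totalD_ι, h, add_zero, (δ n).map_d]
    push_cast
    rw [sgn_add]
    simp

variable (hδ : ∀ n x, (δ n).lin ((δ (n + 1)).lin x) = 0)

/-- The total module of a complex of right dg modules: `⨁ Z n [n]` with differential
`(-1) ^ n d + δ` on the `n`-th summand. -/
@[reducible] noncomputable def DGMod.total : DGMod A where
  carrier := DirectSum ℕ fun n => (Z n).carrier
  str :=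
    { deg := totalDeg Z
      isInternal := by
        have key : ∀ (m : ℤ) n (z : Z n), totalLift Z (fun n => (totalι Z n).comp
            ((Z n).str.proj (m + n))) (totalι Z n z) = totalι Z n ((Z n).str.proj (m + n) z) := by
          intro m n z
          simp
        refine isInternal_of_proj _ (fun m => totalLift Z fun n => (totalι Z n).comp
          ((Z n).str.proj (m + n))) ?_ ?_ ?_
        · intro m x hx
          refine totalDeg_induction (P := fun x => totalLift Z (fun n => (totalι Z n).comp
            ((Z n).str.proj (m + n))) x = x) (map_zero _) (fun _ _ h h' => by rw [map_add, h, h'])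
            (fun n z hz => ?_) hx
          rw [key, (Z n).str.proj_same hz]
        · intro m m' hm x hx
          refine totalDeg_induction (P := fun x => totalLift Z (fun n => (totalι Z n).comp
            ((Z n).str.proj (m' + n))) x = 0) (map_zero _)
            (fun _ _ h h' => by rw [map_add, h, h', add_zero]) (fun n z hz => ?_) hx
          rw [key, (Z n).str.proj_ne (by omega) hz, map_zero]
        · intro x
          refine total_induction (P := fun x => x ∈ ⨆ m, totalDeg Z m) (zero_mem _)
            (fun _ _ h h' => add_mem h h') (fun n z => ?_) x
          refine (Z n).str.induction (P := fun z => totalι Z n z ∈ ⨆ m, totalDeg Z m) (by simp)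
            (fun _ _ h h' => by rw [map_add]; exact add_mem h h') (fun i z hz => ?_) z
          -- The `n`-th summand is shifted by `n`, so degree `i` in `Z n` is total degree `i - n`.
          exact Submodule.mem_iSup_of_mem (i - n) (totalι_mem hz (by ring))
      d := totalD δ
      d_mem := fun {m x} hx => by
        refine totalDeg_induction (P := fun x => totalD δ x ∈ totalDeg Z (m + 1)) (by simp)
          (fun _ _ h h' => by rw [map_add]; exact add_mem h h') (fun n z hz => ?_) hx
        rw [totalD_ι]
        refine add_mem (Submodule.smul_mem _ _ (totalι_mem ((Z n).str.d_mem hz) (by ring))) ?_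
        cases n with
        | zero => exact zero_mem _
        | succ n => exact totalι_mem ((δ n).map_deg hz) (by push_cast; ring)
      d_d := fun x => by
        refine total_induction (P := fun x => totalD δ (totalD δ x) = 0) (by simp)
          (fun _ _ h h' => by rw [map_add, map_add, h, h', add_zero]) (fun n z => ?_) x
        rw [totalD_ι, map_add, map_smul, totalD_ι, totalD_down δ hδ, (Z n).str.d_d]
        simp }
  act := totalAct Z
  act_one x := by
    refine total_induction (P := fun x => totalAct Z x 1 = x) (by simp)
      (fun _ _ h h' => by rw [map_add, LinearMap.add_apply, h, h']) (fun n z => ?_) x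
    rw [totalAct_ι, (Z n).act_one]
  act_mul x a b := by
    refine total_induction (P := fun x => totalAct Z x (a * b) = totalAct Z (totalAct Z x a) b)
      (by simp) (fun _ _ h h' => by simp only [map_add, LinearMap.add_apply, h, h'])
      (fun n z => ?_) x
    rw [totalAct_ι, totalAct_ι, totalAct_ι, (Z n).act_mul]
  act_mem {i j x a} hx ha := by
    refine totalDeg_induction (P := fun x => totalAct Z x a ∈ totalDeg Z (i + j)) (by simp)
      (fun _ _ h h' => by rw [map_add, LinearMap.add_apply]; exact add_mem h h')
      (fun n z hz => ?_) hx
    rw [totalAct_ι]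
    exact totalι_mem ((Z n).act_mem hz ha) (by ring)
  d_act {i x} a hx := by
    have hdown : ∀ n (z : Z n), totalDown δ n ((Z n).act z a) = totalAct Z (totalDown δ n z) a := by
      intro n z
      cases n with
      | zero => simp [totalDown]
      | succ n => simp [totalDown, totalAct_ι, (δ n).map_act]
    refine totalDeg_induction (P := fun x => totalD δ (totalAct Z x a) =
      totalAct Z (totalD δ x) a + (-1 : k) ^ i • totalAct Z x (A.str.d a)) (by simp)
      (fun _ _ h h' => by simp only [map_add, LinearMap.add_apply, h, h', smul_add]; abel)
      (fun n z hz => ?_) hx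
    rw [totalAct_ι, totalAct_ι, totalD_ι, totalD_ι, (Z n).d_act a hz, hdown]
    simp only [map_add, map_smul, LinearMap.add_apply, LinearMap.smul_apply, totalAct_ι,
      smul_add, smul_smul, ← sgn_add]
    rw [sgn_congr (k := k) (e := n + (i + n)) (e' := i) n (by ring)]
    abel

/-- The null-homotopy is built one summand at a time. On `Z (n + 1)` the map `f` is not closed for
the internal differential, its defect being `f ∘ δ`; subtracting the homotopy already found on `Z
n`, composed with `δ`, removes the defect, and cofibrancy of `Z (n + 1)` applies. -/
theorem isCofib_total {B : DGAlg k} {E : DGAlgOver B} {Z : ℕ → DGMod E.toDGAlg}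
    (δ : ∀ n, Z (n + 1) ⟶ Z n) (hδ : ∀ n x, (δ n).lin ((δ (n + 1)).lin x) = 0)
    (hZ : ∀ n, IsCofib E (Z n)) : IsCofib E (DGMod.total δ hδ) := by
  intro Y hY e f hf hfd
  let F : ∀ n, Z n →ₗ[k] Y := fun n => f.comp (totalι Z n)
  have hF : ∀ n, IsGHom (Z n) Y (e - n) (F n) := fun n =>
    ⟨fun {i z} hz => by
      have := hf.deg (i := i - n) (totalι_mem hz (by ring))
      rwa [show i - n + e = i + (e - n) by ring] at this, fun z a => by
      have := hf.act (totalι Z n z) a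
      change f (totalAct Z _ a) = _ at this
      rw [totalAct_ι] at this
      exact this⟩
  have hFd : ∀ n (z : Z n), Y.str.d (F n z) = (-1 : k) ^ (e - n) • F n ((Z n).str.d z) +
      (-1 : k) ^ e • f (totalDown δ n z) := by
    intro n z
    have := hfd (totalι Z n z)
    change _ = (-1 : k) ^ e • f (totalD δ _) at this
    rw [totalD_ι, map_add, map_smul, smul_add, smul_smul, ← sgn_add,
      sgn_congr (k := k) (e := e + n) (e' := e - n) n (by ring)] at this
    exact this
  -- The data passed along the recursion. The homotopy identity is recorded only on the image of `δ
  -- n`: this is all that the next step uses, and there it does not mention the preceding component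
  -- of the homotopy.
  let T : ℕ → Type u := fun n => {g : Z n →ₗ[k] Y // IsGHom (Z n) Y (e - n - 1) g ∧
    ∀ z, Y.str.d (g ((δ n).lin z)) + (-1 : k) ^ (e - n) • g ((Z n).str.d ((δ n).lin z)) =
      F n ((δ n).lin z)}
  obtain ⟨g₀, hg₀, H₀⟩ := hZ 0 Y hY (e - (0 : ℕ)) (F 0) (hF 0) fun z => by
    rw [hFd]; simp [totalDown]
  have step : ∀ n (g : T n), ∃ g' : T (n + 1), ∀ z, Y.str.d (g'.1 z) +
      (-1 : k) ^ (e - (n + 1 : ℕ)) • g'.1 ((Z (n + 1)).str.d z) =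
        F (n + 1) z - (-1 : k) ^ e • g.1 ((δ n).lin z) := by
    rintro n ⟨g, hg, H⟩
    have hgδ : IsGHom (Z (n + 1)) Y (e - (n + 1 : ℕ)) ((-1 : k) ^ e • g.comp (δ n).lin) := by
      have := hg.comp (δ n).isGHom (e'' := e - (n + 1 : ℕ)) (by push_cast; ring)
      exact ⟨fun hx => Submodule.smul_mem _ _ (this.deg hx), fun x a => by
        simp [(δ n).map_act, hg.act]⟩
    -- The remaining goal is the closedness of the corrected map `F (n + 1) - (-1) ^ e g δ`.
    obtain ⟨g', hg', H'⟩ := hZ (n + 1) Y hY _ _ ((hF (n + 1)).sub hgδ) fun z => by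
      have h1 := H z
      rw [← eq_sub_iff_add_eq] at h1
      simp only [LinearMap.sub_apply, LinearMap.smul_apply, LinearMap.comp_apply, map_sub,
        map_smul, hFd, h1]
      rw [(δ n).map_d, totalDown]
      simp only [smul_sub, smul_smul, ← sgn_add]
      rw [sgn_congr (k := k) (e := e + (e - n)) (e' := n) (e - n) (by ring),
        sgn_congr (k := k) (e := e - (n + 1 : ℕ) + e) (e' := n + 1) (e - n - 1)
          (by push_cast; ring), sgn_add (n : ℤ) 1]
      simp only [F, LinearMap.comp_apply, zpow_one, mul_neg, mul_one, neg_smul]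
      abel
    -- On the image of `δ (n + 1)` the correction term vanishes by `δ ∘ δ = 0`.
    refine ⟨⟨g', hg', fun z => ?_⟩, H'⟩
    have := H' ((δ (n + 1)).lin z)
    rw [this]
    simp [hδ]
  choose s hs using step
  let G : ∀ n, T n := fun n => Nat.rec (motive := T)
    ⟨g₀, hg₀, fun z => H₀ ((δ 0).lin z)⟩ s n
  refine ⟨totalLift Z fun n => (G n).1, ⟨fun {i x} hx => ?_, fun x a => ?_⟩, fun x => ?_⟩
  · refine totalDeg_induction (P := fun x => totalLift Z (fun n => (G n).1) x ∈
      Y.str.deg (i + (e - 1))) (by simp) (fun _ _ h h' => by rw [map_add]; exact add_mem h h')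
      (fun n z hz => ?_) hx
    rw [totalLift_ι]
    have := (G n).2.1.deg hz
    rwa [show i + n + (e - n - 1) = i + (e - 1) by ring] at this
  · refine total_induction (P := fun x => totalLift Z (fun n => (G n).1) (totalAct Z x a) =
      Y.act (totalLift Z (fun n => (G n).1) x) a) (by simp)
      (fun _ _ h h' => by simp only [map_add, LinearMap.add_apply, h, h']) (fun n z => ?_) x
    rw [totalAct_ι, totalLift_ι, totalLift_ι, (G n).2.1.act]
  · refine total_induction (P := fun x => Y.str.d (totalLift Z (fun n => (G n).1) x) +
      (-1 : k) ^ e • totalLift Z (fun n => (G n).1) (totalD δ x) = f x) (by simp)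
      (fun _ _ h h' => by
        rw [map_add, map_add, map_add, map_add, map_add, ← h, ← h', smul_add]; abel)
      (fun n z => ?_) x
    rw [totalD_ι, map_add, map_smul, totalLift_ι, totalLift_ι, smul_add, smul_smul, ← sgn_add,
      sgn_congr (k := k) (e := e + n) (e' := e - n) n (by ring), ← add_assoc]
    cases n with
    | zero =>
      have := H₀ z
      simp only [totalDown, LinearMap.zero_apply, map_zero, smul_zero, add_zero]
      exact this
    | succ n =>
      have := hs n (G n) z
      simp only [totalDown, LinearMap.comp_apply, totalLift_ι]
      exact (congrArg (· + _) this).trans (sub_add_cancel _ _)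

theorem isGradedFree_total (hZ : ∀ n, (Z n).IsGradedFree) : (DGMod.total δ hδ).IsGradedFree := by
  choose I d b c hb hc hspan using fun n => (hZ n).exists_coord
  -- The basis is the disjoint union of the bases of the summands, with degrees lowered by `n` on
  -- the `n`-th.
  refine DGMod.IsGradedFree.of_coord (X := DGMod.total δ hδ) (I := Σ n, I n)
    (n := fun i => d i.1 i.2 - i.1) (b := fun i => totalι Z i.1 (b i.1 i.2))
    (totalLift Z fun n => (Finsupp.lmapDomain A k (Sigma.mk n)).comp (c n))
    (fun i => totalι_mem (hb i.1 i.2) (by ring)) ?_ ?_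
  · rintro ⟨n, i⟩ a
    change totalLift Z _ (totalAct Z _ a) = _
    rw [totalAct_ι, totalLift_ι, LinearMap.comp_apply, hc]
    simp
  · intro P h0 hadd h
    refine total_induction h0 hadd fun n => ?_
    refine hspan n (fun z => P (totalι Z n z)) (by simpa using h0)
      (fun _ _ h h' => by simpa using hadd _ _ h h') fun i a => ?_
    have := h ⟨n, i⟩ a
    change P (totalAct Z _ a) at this
    rw [totalAct_ι] at this
    exact this

end Total

/-! ### Augmented complexes contractible over the base -/

section TotalResolution

variable {B : DGAlg k} {E : DGAlgOver B} {X : DGMod E.toDGAlg} {Z : ℕ → DGMod E.toDGAlg}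
  (δ : ∀ n, Z (n + 1) ⟶ Z n) (hδ : ∀ n x, (δ n).lin ((δ (n + 1)).lin x) = 0)
  (ε : Z 0 ⟶ X)

/-- The components of the augmentation of a total module. -/
def totalAugComp : ∀ n, Z n →ₗ[k] X
  | 0 => ε.lin
  | _ + 1 => 0

/-- The augmentation of a total module. -/
noncomputable def totalAug (hε : ∀ x, ε.lin ((δ 0).lin x) = 0) : DGMod.total δ hδ ⟶ X where
  lin := totalLift Z (totalAugComp ε)
  map_deg {i x} hx := by
    refine totalDeg_induction (P := fun x => totalLift Z (totalAugComp ε) x ∈ X.str.deg i)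
      (by simp) (fun _ _ h h' => by rw [map_add]; exact add_mem h h') (fun n z hz => ?_) hx
    rw [totalLift_ι]
    cases n with
    | zero => exact ε.map_deg (by simpa using hz)
    | succ n => exact zero_mem _
  map_d x := by
    refine total_induction (P := fun x => totalLift Z (totalAugComp ε) (totalD δ x) =
      X.str.d (totalLift Z (totalAugComp ε) x)) (by simp)
      (fun _ _ h h' => by simp only [map_add, h, h']) (fun n z => ?_) x
    rw [totalD_ι, map_add, map_smul, totalLift_ι, totalLift_ι]
    match n with
    | 0 => simp [totalDown, totalAugComp, ε.map_d]
    | 1 => simp [totalDown, totalAugComp, hε]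
    | n + 2 => simp [totalDown, totalAugComp]
  map_act x a := by
    refine total_induction (P := fun x => totalLift Z (totalAugComp ε) (totalAct Z x a) =
      X.act (totalLift Z (totalAugComp ε) x) a) (by simp)
      (fun _ _ h h' => by simp only [map_add, LinearMap.add_apply, h, h']) (fun n z => ?_) x
    rw [totalAct_ι, totalLift_ι, totalLift_ι]
    cases n with
    | zero => exact ε.map_act z a
    | succ n => simp [totalAugComp]

/-- The augmentation of the total module of a complex that is contractible over the base is a
relative quasi-isomorphism. -/
theorem relQis_totalAug (hε : ∀ x, ε.lin ((δ 0).lin x) = 0)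
    (τ : X.restrict E.algMap ⟶ (Z 0).restrict E.algMap)
    (σ : ∀ n, (Z n).restrict E.algMap ⟶ (Z (n + 1)).restrict E.algMap)
    (hτ : ∀ x, ε.lin (τ.lin x) = x)
    (hσ₀ : ∀ x : Z 0, (δ 0).lin ((σ 0).lin x) = x - τ.lin (ε.lin x))
    (hσ : ∀ n (x : Z (n + 1)), (δ (n + 1)).lin ((σ (n + 1)).lin x) = x - (σ n).lin ((δ n).lin x)) :
    relQis E (totalAug δ hδ ε hε) := by
  let τ' : X →ₗ[k] Z 0 := τ.lin
  let σ' : ∀ n, Z n →ₗ[k] Z (n + 1) := fun n => (σ n).lin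
  have hτd : ∀ x, τ' (X.str.d x) = (Z 0).str.d (τ' x) := τ.map_d
  have hσd : ∀ n x, σ' n ((Z n).str.d x) = (Z (n + 1)).str.d (σ' n x) := fun n => (σ n).map_d
  have hτa : ∀ x b, τ' (X.act x (E.algMap b)) = (Z 0).act (τ' x) (E.algMap b) := τ.map_act
  have hσa : ∀ n x b, σ' n ((Z n).act x (E.algMap b)) = (Z (n + 1)).act (σ' n x) (E.algMap b) :=
    fun n => (σ n).map_act
  let s : X.restrict E.algMap ⟶ (DGMod.total δ hδ).restrict E.algMap :=
    { lin := (totalι Z 0).comp τ'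
      map_deg := fun {i x} hx => totalι_mem (τ.map_deg hx) (by simp)
      map_d := fun x => by
        change totalι Z 0 (τ' (X.str.d x)) = totalD δ (totalι Z 0 (τ' x))
        rw [totalD_ι, hτd]
        simp [totalDown]
      map_act := fun x b => by
        change totalι Z 0 (τ' (X.act x (E.algMap b))) = totalAct Z (totalι Z 0 (τ' x)) (E.algMap b)
        rw [totalAct_ι, hτa] }
  -- The contraction `σ` of the augmented complex. In `D h + h D` the internal differentials cancel,
  -- because `σ` commutes with them and their signs alternate; what is left is the identity minus `τ
  -- ε` on the zeroth summand. The homotopy is therefore `-h`.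
  let h : (DirectSum ℕ fun n => (Z n).carrier) →ₗ[k] DirectSum ℕ fun n => (Z n).carrier :=
    totalLift Z fun n => (totalι Z (n + 1)).comp (σ' n)
  have hι : ∀ n z, h (totalι Z n z) = totalι Z (n + 1) (σ' n z) := fun n z => by simp [h]
  refine ⟨s, ⟨-h, fun i x hx => ?_, fun x b => ?_, fun x => ?_⟩, .of_eq (DGMod.hom_ext fun x => ?_)⟩
  · refine neg_mem (totalDeg_induction (P := fun x => h x ∈ totalDeg Z (i - 1))
      (by simp) (fun _ _ h h' => by rw [map_add]; exact add_mem h h') (fun n z hz => ?_) hx)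
    rw [hι]
    exact totalι_mem ((σ n).map_deg hz) (by push_cast; ring)
  · have : h (totalAct Z x (E.algMap b)) = totalAct Z (h x) (E.algMap b) := by
      refine total_induction (P := fun x => h (totalAct Z x (E.algMap b)) =
        totalAct Z (h x) (E.algMap b)) (by simp)
        (fun _ _ h h' => by simp only [map_add, LinearMap.add_apply, h, h']) (fun n z => ?_) x
      rw [totalAct_ι, hι, hι, totalAct_ι, hσa]
    change -h (totalAct Z x (E.algMap b)) = totalAct Z (-h x) (E.algMap b)
    rw [this, map_neg, LinearMap.neg_apply]
  · change totalι Z 0 (τ' (totalLift Z (totalAugComp ε) x)) - x =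
      totalD δ (-h x) + -h (totalD δ x)
    have key : totalι Z 0 (τ' (totalLift Z (totalAugComp ε) x)) - x =
        -(totalD δ (h x) + h (totalD δ x)) := by
      refine total_induction (P := fun x => totalι Z 0 (τ' (totalLift Z (totalAugComp ε) x)) - x =
        -(totalD δ (h x) + h (totalD δ x))) (by simp) (fun x y h h' => ?_) (fun n z => ?_) x
      · simp only [map_add]
        rw [add_sub_add_comm, h, h']
        abel
      · rw [totalLift_ι, hι, totalD_ι, totalD_ι, map_add, map_smul, hι, ← hσd]
        cases n with
        | zero =>
          have h1 : (δ 0).lin (σ' 0 z) = z - τ' (ε.lin z) := hσ₀ z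
          simp only [totalDown, LinearMap.comp_apply, LinearMap.zero_apply, map_zero, h1, map_sub,
            totalAugComp]
          simp
        | succ n =>
          have h1 : (δ (n + 1)).lin (σ' (n + 1) z) = z - σ' n ((δ n).lin z) := hσ n z
          simp only [totalDown, LinearMap.comp_apply, LinearMap.zero_apply, map_zero, h1, map_sub,
            totalAugComp, hι]
          push_cast
          rw [sgn_add ((n : ℤ) + 1) 1]
          simp only [zpow_one, mul_neg, mul_one, neg_smul]
          abel
    rw [key, map_neg, neg_add]
  · change totalLift Z (totalAugComp ε) (totalι Z 0 (τ' x)) = x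
    rw [totalLift_ι]
    exact hτ x

end TotalResolution

/-! ### The bar resolution -/

section Bar

variable {B : DGAlg k} {E : DGAlgOver B}

/-- The difference of two morphisms of dg modules. -/
def DGMod.homSub {A : DGAlg k} {X Y : DGMod A} (f g : X ⟶ Y) : X ⟶ Y where
  lin := f.lin - g.lin
  map_deg h := sub_mem (f.map_deg h) (g.map_deg h)
  map_d x := by simp [f.map_d, g.map_d]
  map_act x a := by simp [f.map_act, g.map_act]

/-- The morphism `V ⊗_B E ⟶ Y` given by a `B`-linear morphism `V ⟶ Y`. -/
noncomputable def induceDesc {B E : DGAlg k} {φ : DGAlg.Hom B E} {V : DGMod B} {Y : DGMod E}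
    (f : V ⟶ Y.restrict φ) : V.induce φ ⟶ Y :=
  (isGHom_induceLift f.isGHom).toHom <| by
    have h := isGHom_induceLift f.isGHom
    generalize hF : induceLift (V := V) (φ := φ) f.lin _ = F at h
    have hF1 : ∀ v : V, F (tmk V φ.leftMod v (1 : E)) = f.lin v := by
      intro v
      rw [← hF, induceLift_tmk]
      exact Y.act_one _
    have hd : ∀ v : V, (V.induce φ).str.d (tmk V φ.leftMod v (1 : E)) =
        tmk V φ.leftMod (V.str.d v) (1 : E) := fun v =>
      ((induceUnit (V := V) (φ := φ)).map_d v).symm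
    have hfd : ∀ v, f.lin (V.str.d v) = Y.str.d (f.lin v) := f.map_d
    have hc := h.commutator (-1) (by simp)
    have : Y.str.d.comp F + (-1 : k) • F.comp (V.induce φ).str.d = 0 := by
      refine induce_ext (W := Y) hc.act (by simp) fun v => ?_
      simp only [LinearMap.add_apply, LinearMap.comp_apply, LinearMap.smul_apply,
        LinearMap.zero_apply]
      rw [hd, hF1, hF1, hfd]
      simp
    intro x
    have h1 := LinearMap.congr_fun this x
    simp only [LinearMap.add_apply, LinearMap.comp_apply,
        LinearMap.zero_apply, neg_smul, one_smul] at h1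
    exact (add_neg_eq_zero.1 h1).symm

theorem induceDesc_unit {B E : DGAlg k} {φ : DGAlg.Hom B E} {V : DGMod B} {Y : DGMod E}
    (f : V ⟶ Y.restrict φ) (v : V) :
    (induceDesc f).lin ((induceUnit (V := V) (φ := φ)).lin v) = f.lin v :=
  (induceLift_tmk (φ := φ) f.lin f.map_act v 1).trans (Y.act_one _)

theorem induce_hom_ext {B E : DGAlg k} {φ : DGAlg.Hom B E} {V : DGMod B} {Y : DGMod E}
    {f g : V.induce φ ⟶ Y} (h : ∀ v, f.lin ((induceUnit (V := V) (φ := φ)).lin v) =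
      g.lin ((induceUnit (V := V) (φ := φ)).lin v)) : f = g :=
  DGMod.Hom.ext (induce_ext (W := Y) f.map_act g.map_act h)

/-- The relatively free module `X ⊗_B E`. -/
noncomputable def relFree (X : DGMod E.toDGAlg) : DGMod E.toDGAlg :=
  (X.restrict E.algMap).induce E.algMap

/-- The `B`-linear morphism `x ↦ x ⊗ 1`. -/
noncomputable def relFreeUnit (X : DGMod E.toDGAlg) :
    X.restrict E.algMap ⟶ (relFree X).restrict E.algMap :=
  induceUnit (V := X.restrict E.algMap) (φ := E.algMap)

theorem relFree_hom_ext {X Y : DGMod E.toDGAlg} {f g : relFree X ⟶ Y}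
    (h : ∀ x : X, f.lin ((relFreeUnit X).lin x) = g.lin ((relFreeUnit X).lin x)) : f = g :=
  induce_hom_ext (V := X.restrict E.algMap) (φ := E.algMap) h

/-- The action `X ⊗_B E ⟶ X`. -/
noncomputable def relFreeAct (X : DGMod E.toDGAlg) : relFree X ⟶ X :=
  induceDesc (𝟙 (X.restrict E.algMap))

theorem relFreeAct_unit (X : DGMod E.toDGAlg) (x : X) :
    (relFreeAct X).lin ((relFreeUnit X).lin x) = x :=
  induceDesc_unit (𝟙 (X.restrict E.algMap)) x

/-- Functoriality of `X ⊗_B E`. -/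
noncomputable def relFreeMap {X Y : DGMod E.toDGAlg} (f : X ⟶ Y) : relFree X ⟶ relFree Y :=
  induceDesc ((DGMod.res E.algMap).map f ≫ relFreeUnit Y)

theorem relFreeMap_unit {X Y : DGMod E.toDGAlg} (f : X ⟶ Y) (x : X) :
    (relFreeMap f).lin ((relFreeUnit X).lin x) = (relFreeUnit Y).lin (f.lin x) :=
  induceDesc_unit ((DGMod.res E.algMap).map f ≫ relFreeUnit Y) x

theorem relFreeMap_comp_act {X Y : DGMod E.toDGAlg} (f : X ⟶ Y) :
    relFreeMap f ≫ relFreeAct Y = relFreeAct X ≫ f :=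
  relFree_hom_ext fun x => by
    rw [DGMod.comp_lin, DGMod.comp_lin, relFreeMap_unit, relFreeAct_unit, relFreeAct_unit]

theorem isCofib_relFree (X : DGMod E.toDGAlg) : IsCofib E (relFree X) :=
  isCofib_induce E (X.restrict E.algMap)

/-- The zero morphism. -/
def DGMod.homZero {A : DGAlg k} (X Y : DGMod A) : X ⟶ Y where
  lin := 0
  map_deg _ := zero_mem _
  map_d _ := by simp
  map_act _ _ := by simp

theorem relFreeMap_zero {X Y Z : DGMod E.toDGAlg} {f : X ⟶ Y} {g : Y ⟶ Z}
    (h : ∀ x, g.lin (f.lin x) = 0) (x : relFree X) :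
    (relFreeMap g).lin ((relFreeMap f).lin x) = 0 := by
  have : relFreeMap f ≫ relFreeMap g = DGMod.homZero _ _ := relFree_hom_ext fun x => by
    rw [DGMod.comp_lin, relFreeMap_unit, relFreeMap_unit, h, map_zero]
    rfl
  exact congrArg (fun F => DGMod.Hom.lin F x) this

/-- A right dg module `X` with a morphism `X ⊗_B E ⟶ X`: a step of the bar complex. -/
structure BarStage (E : DGAlgOver B) where
  obj : DGMod E.toDGAlg
  δ : relFree obj ⟶ obj

/-- The next step of the bar complex. -/
noncomputable def BarStage.next (s : BarStage E) : BarStage E where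
  obj := relFree s.obj
  δ := DGMod.homSub (relFreeAct (relFree s.obj)) (relFreeMap s.δ)

theorem BarStage.next_δ (s : BarStage E) (x : relFree (relFree s.obj)) :
    s.next.δ.lin x = (relFreeAct (relFree s.obj)).lin x - (relFreeMap s.δ).lin x := rfl

/-- This makes the units `x ↦ x ⊗ 1` a contraction of the bar complex over the base: they play the
part of the extra degeneracy. -/
theorem BarStage.next_δ_unit (s : BarStage E) (x : relFree s.obj) :
    s.next.δ.lin ((relFreeUnit (relFree s.obj)).lin x) = x - (relFreeUnit s.obj).lin (s.δ.lin x) :=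
  congrArg₂ (· - ·) (relFreeAct_unit (relFree s.obj) x) (relFreeMap_unit s.δ x)

/-- The condition on a step of the bar complex that makes the next differential compose to zero. -/
def BarStage.Good (s : BarStage E) : Prop := ∀ x : relFree (relFree s.obj),
  (relFreeAct s.obj).lin ((relFreeMap s.δ).lin x) = s.δ.lin ((relFreeMap s.δ).lin x)

/-- The action is natural, so composing `δ` with the action part of the next differential gives the
left side of `Good`, while composing it with the other part gives the right side. -/
theorem BarStage.Good.δ_δ {s : BarStage E} (hs : s.Good) (x : relFree (relFree s.obj)) :
    s.δ.lin (s.next.δ.lin x) = 0 := by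
  have h : (relFreeAct s.obj).lin ((relFreeMap s.δ).lin x) =
      s.δ.lin ((relFreeAct (relFree s.obj)).lin x) :=
    congrArg (fun F => DGMod.Hom.lin F x) (relFreeMap_comp_act s.δ)
  rw [BarStage.next_δ, map_sub, ← h, hs, sub_self]

/-- By definition `s.next.δ` is the action minus the map induced by `s.δ`. The latter kills the
image of the map induced by `s.next.δ`, since `s.δ` composed with `s.next.δ` is zero. -/
theorem BarStage.Good.next {s : BarStage E} (hs : s.Good) : s.next.Good := by
  intro x
  have h := relFreeMap_zero (f := s.next.δ) (g := s.δ) hs.δ_δ x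
  exact ((s.next_δ ((relFreeMap s.next.δ).lin x)).trans
    ((congrArg (_ - ·) h).trans (sub_zero _))).symm

/-- The steps of the bar complex of `X`. -/
noncomputable def barStage (X : DGMod E.toDGAlg) : ℕ → BarStage E
  | 0 => ⟨X, relFreeAct X⟩
  | n + 1 => (barStage X n).next

theorem barStage_good (X : DGMod E.toDGAlg) : ∀ n, (barStage X n).Good
  | 0 => fun _ => rfl
  | n + 1 => (barStage_good X n).next

/-- The terms of the bar complex. -/
noncomputable def barObj (X : DGMod E.toDGAlg) (n : ℕ) : DGMod E.toDGAlg :=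
  relFree (barStage X n).obj

/-- The differentials of the bar complex. -/
noncomputable def barδ (X : DGMod E.toDGAlg) (n : ℕ) : barObj X (n + 1) ⟶ barObj X n :=
  (barStage X n).next.δ

/-- Over an algebra that is graded free over the base, every module that is graded free over the
base has a relatively cofibrant resolution that is graded free over the algebra. -/
theorem exists_resolution (hE : ((DGMod.self E.toDGAlg).restrict E.algMap).IsGradedFree)
    (X : DGMod E.toDGAlg) (hX : (X.restrict E.algMap).IsGradedFree) :
    ∃ (P : DGMod E.toDGAlg) (q : P ⟶ X), relQis E q ∧ IsCofib E P ∧ P.IsGradedFree := by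
  have hδ : ∀ n x, (barδ X n).lin ((barδ X (n + 1)).lin x) = 0 := fun n =>
    (barStage_good X (n + 1)).δ_δ
  -- Freeness over the base persists: a `B`-free module induces an `E`-free one, which is `B`-free
  -- because `E` is.
  have hfree : ∀ n, ((barStage X n).obj.restrict E.algMap).IsGradedFree := by
    intro n
    induction n with
    | zero => exact hX
    | succ n ih => exact (ih.induce E.algMap).restrict hE
  have hε : ∀ x, (relFreeAct X).lin ((barδ X 0).lin x) = 0 := (barStage_good X 0).δ_δ
  refine ⟨DGMod.total (barδ X) hδ, totalAug (barδ X) hδ (relFreeAct X) hε, ?_,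
    isCofib_total _ hδ fun n => isCofib_relFree (barStage X n).obj,
    isGradedFree_total _ hδ fun n => (hfree n).induce E.algMap⟩
  -- The contraction consists of the units, which are linear over the base only.
  exact relQis_totalAug (barδ X) hδ (relFreeAct X) hε (relFreeUnit X)
    (fun n => relFreeUnit (barObj X n)) (relFreeAct_unit X)
    (BarStage.next_δ_unit (barStage X 0))
    fun n => BarStage.next_δ_unit (barStage X (n + 1))

end Bar

/-! ### Tensor products preserve relative quasi-isomorphisms -/

section TensorRelQis

variable {B : DGAlg k} {E : DGAlgOver B} (N : DGLMod B)

/-- Homotopies over the base are compatible with tensor products. -/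
theorem homotopic_tensor {X Y : DGMod E.toDGAlg}
    {p q : X.restrict E.algMap ⟶ Y.restrict E.algMap} (H : DGMod.Homotopic p q) :
    ∃ h : X.tensor N →ₗ[k] Y.tensor N,
      (∀ i, ∀ x ∈ (X.tensor N).str.deg i, h x ∈ (Y.tensor N).str.deg (i - 1)) ∧
      (∀ x b, h ((X.tensor N).act x (E.algMap b)) = (Y.tensor N).act (h x) (E.algMap b)) ∧
      ∀ x : X.tensor N, Tens.map N p.lin p.map_act x - Tens.map N q.lin q.map_act x =
        (Y.tensor N).str.d (h x) + h ((X.tensor N).str.d x) := by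
  obtain ⟨h, h1, h2, h3⟩ := H
  exact ⟨Tens.map (X := X.restrict E.algMap) (X' := Y.restrict E.algMap) N h h2,
    fun i x hx => Tens.map_mem N h h2 (e := -1) h1 hx,
    fun x b => Tens.map_act_base E N h h2 x b,
    fun x => Tens.map_homotopy (N := N) p.lin q.lin h p.map_act q.map_act h2 h1 h3 x⟩

/-- The morphism `f ⊗_B N` of dg `B`-modules, for `f` linear over the base. -/
noncomputable def tensorMapBase {X Y : DGMod E.toDGAlg}
    (f : X.restrict E.algMap ⟶ Y.restrict E.algMap) :
    (X.tensor N).restrict E.algMap ⟶ (Y.tensor N).restrict E.algMap where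
  lin := Tens.map (X := X.restrict E.algMap) (X' := Y.restrict E.algMap) N f.lin f.map_act
  map_deg {i x} hx := by
    have := Tens.map_mem N f.lin f.map_act (e := 0) (fun i x hx => by simpa using f.map_deg hx) hx
    rwa [add_zero] at this
  map_d := Tens.d_map N f.lin f.map_act (fun _ _ h => f.map_deg h) f.map_d
  map_act x b := Tens.map_act_base E N f.lin f.map_act x b

/-- The homotopy inverse and the homotopies are linear over `B`, and the tensor product is taken
over `B`, so it applies to them too. -/
theorem relQis_tensorMap {X Y : DGMod E.toDGAlg} {f : X ⟶ Y} (hf : relQis E f) :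
    relQis E (DGMod.tensorMap f N) := by
  obtain ⟨g, H, H'⟩ := hf
  obtain ⟨h, h1, h2, h3⟩ := homotopic_tensor (X := X) (Y := X) N H
  obtain ⟨h', h1', h2', h3'⟩ := homotopic_tensor (X := Y) (Y := Y) N H'
  refine ⟨tensorMapBase (X := Y) (Y := X) N g, ⟨h, h1, h2, fun x => ?_⟩,
    ⟨h', h1', h2', fun x => ?_⟩⟩
  · refine Eq.trans ?_ (h3 x)
    refine congrArg₂ (· - ·) ?_ ?_
    · exact (Tens.map_comp (X := X.restrict E.algMap) (X' := Y.restrict E.algMap)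
        (X'' := X.restrict E.algMap) N f.lin g.lin (fun x b => f.map_act x _) g.map_act _ x).symm
    · exact (Tens.map_id N x).symm
  · refine Eq.trans ?_ (h3' x)
    refine congrArg₂ (· - ·) ?_ ?_
    · exact (Tens.map_comp (X := Y.restrict E.algMap) (X' := X.restrict E.algMap)
        (X'' := Y.restrict E.algMap) N g.lin f.lin g.map_act (fun x b => f.map_act x _) _ x).symm
    · exact (Tens.map_id N x).symm

end TensorRelQis

/-! ### Reduction modulo the augmentation ideal -/

section ReductionFunctor

variable {S : DGAlg k} {R : DGAlgOver S} (π : Augmentation R) {A : DGAlgOver S}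
  {E : DGAlgOver R.toDGAlg} (j : DGAlg.Hom A.toDGAlg E.toDGAlg)

/-- The reduction functor `L ↦ L ⊗_R S`. -/
noncomputable def redFunctor : DGMod E.toDGAlg ⥤ DGMod A.toDGAlg :=
  DGMod.tensorFunctor E π.base ⋙ DGMod.res j

/-- The reduction of a morphism. -/
noncomputable def redMap {L L' : DGMod E.toDGAlg} (f : L ⟶ L') : redMod π j L ⟶ redMod π j L' :=
  (redFunctor π j).map f

theorem redMap_comp {L L' L'' : DGMod E.toDGAlg} (f : L ⟶ L') (g : L' ⟶ L'') :
    redMap π j (f ≫ g) = redMap π j f ≫ redMap π j g :=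
  (redFunctor π j).map_comp f g

/-- The projection `L ⟶ L ⊗_R S`. -/
noncomputable def redq (L : DGMod E.toDGAlg) : L →ₗ[k] redMod π j L := quotLin π L

theorem redq_deg {L : DGMod E.toDGAlg} {m : ℤ} {l : L} (hl : l ∈ L.str.deg m) :
    redq π j L l ∈ (redMod π j L).str.deg m := quotLin_deg π L hl

theorem redMap_redq {L L' : DGMod E.toDGAlg} (f : L ⟶ L') (l : L) :
    (redMap π j f).lin (redq π j L l) = redq π j L' (f.lin l) :=
  Tens.map_tmk (X := L.restrict E.algMap) (X' := L'.restrict E.algMap) π.base f.lin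
    (fun x _ => f.map_act x _) l (1 : S)

/-- The inverse and the homotopies over `R` are in particular linear over `S`, which acts through
`R` in `E` in the same way as through `A`. -/
theorem relQis_of_restrict (hj : ∀ s, j (A.algMap s) = E.algMap (R.algMap s))
    {X Y : DGMod E.toDGAlg} {f : X ⟶ Y} (hf : relQis E f) :
    relQis A ((DGMod.res j).map f) := by
  obtain ⟨g, ⟨h, h1, h2, h3⟩, ⟨h', h1', h2', h3'⟩⟩ := hf
  refine ⟨⟨g.lin, fun h => g.map_deg h, g.map_d, fun x s => ?_⟩, ⟨h, h1, fun x s => ?_, h3⟩,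
    ⟨h', h1', fun x s => ?_, h3'⟩⟩
  · have := g.map_act x (R.algMap s)
    change g.lin (Y.act x (E.algMap (R.algMap s))) =
      X.act (g.lin x) (E.algMap (R.algMap s)) at this
    rw [← hj] at this
    exact this
  · have := h2 x (R.algMap s)
    change h (X.act x (E.algMap (R.algMap s))) = X.act (h x) (E.algMap (R.algMap s)) at this
    rw [← hj] at this
    exact this
  · have := h2' x (R.algMap s)
    change h' (Y.act x (E.algMap (R.algMap s))) = Y.act (h' x) (E.algMap (R.algMap s)) at this
    rw [← hj] at this
    exact this

theorem relQis_redMap (hj : ∀ s, j (A.algMap s) = E.algMap (R.algMap s))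
    {L L' : DGMod E.toDGAlg} {f : L ⟶ L'} (hf : relQis E f) :
    relQis A (redMap π j f) :=
  relQis_of_restrict j hj (relQis_tensorMap π.base hf)

/-- The reduction functor on relative derived categories. -/
noncomputable def derRed (hj : ∀ s, j (A.algMap s) = E.algMap (R.algMap s)) : RelD E ⥤ RelD A :=
  Localization.Construction.lift (redFunctor π j ⋙ relQ A) fun _ _ _ hf =>
    (relQis A).Q_inverts _ (relQis_redMap π j hj hf)

/-- A morphism may become invertible in the derived category without being known to be a relative
quasi-isomorphism, hence the passage through the functor `derRed`. -/
theorem isIso_redMap (hj : ∀ s, j (A.algMap s) = E.algMap (R.algMap s))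
    {L L' : DGMod E.toDGAlg} (f : L ⟶ L') [IsIso ((relQ E).map f)] :
    IsIso ((relQ A).map (redMap π j f)) := by
  have h : (derRed π j hj).map ((relQ E).map f) = (relQ A).map (redMap π j f) :=
    (Functor.congr_hom (Localization.Construction.fac (redFunctor π j ⋙ relQ A) fun _ _ f hf =>
      (relQis A).Q_inverts _ (relQis_redMap π j hj hf)) f).trans
        ((Category.id_comp _).trans (Category.comp_id _))
  have h2 : IsIso ((derRed π j hj).map ((relQ E).map f)) := inferInstance
  exact h ▸ h2

theorem tmk_base_eq (L : DGMod E.toDGAlg) (l : L) (s : S) :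
    tmk (L.restrict E.algMap) π.base l s = redq π j L (L.act l (E.algMap (R.algMap s))) := by
  have h := tmk_balanced (X := L.restrict E.algMap) (N := π.base) l (R.algMap s) (1 : S)
  refine Eq.trans ?_ h.symm
  congr 1
  change s = π.hom (R.algMap s) * 1
  rw [π.hom_algMap, mul_one]

theorem redq_surjective (L : DGMod E.toDGAlg) : Function.Surjective (redq π j L) := by
  intro z
  refine Tens.induction (P := fun z => ∃ l, redq π j L l = z) ⟨0, map_zero _⟩ ?_ ?_ z
  · rintro _ _ ⟨l, rfl⟩ ⟨l', rfl⟩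
    exact ⟨l + l', map_add _ _ _⟩
  · intro p q l _ s _
    exact ⟨_, (tmk_base_eq π j L l s).symm⟩

/-- A homogeneous element of the reduction lifts to a homogeneous element of the same degree,
because `l ⊗ s = (l s) ⊗ 1`. No closure under addition is needed. -/
theorem red_deg_induction {L : DGMod E.toDGAlg} {m : ℤ} {P : redMod π j L → Prop}
    (hom : ∀ l ∈ L.str.deg m, P (redq π j L l)) {z} (hz : z ∈ (redMod π j L).str.deg m) :
    P z := by
  have : ∃ l ∈ L.str.deg m, redq π j L l = z := by
    refine Tens.deg_induction (P := fun z => ∃ l ∈ L.str.deg m, redq π j L l = z)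
      ⟨0, zero_mem _, map_zero _⟩ ?_ ?_ hz
    · rintro _ _ ⟨l, hl, rfl⟩ ⟨l', hl', rfl⟩
      exact ⟨l + l', add_mem hl hl', map_add _ _ _⟩
    · rintro p q l hl s hs rfl
      exact ⟨_, L.act_mem hl (E.algMap.map_deg (R.algMap.map_deg hs)),
        (tmk_base_eq π j L l s).symm⟩
  obtain ⟨l, hl, rfl⟩ := this
  exact hom l hl

/-- The linear map on `L ⊗_R S` given by a linear map on `L`. -/
noncomputable def redLift {L : DGMod E.toDGAlg} {Y : DGMod A.toDGAlg} (g : L →ₗ[k] Y)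
    (hg : ∀ l r, g (L.act l (E.algMap r)) = Y.act (g l) (A.algMap (π.hom r))) :
    redMod π j L →ₗ[k] Y :=
  Tens.lift (X := L.restrict E.algMap) (N := π.base)
    ((Y.act.compl₂ A.algMap.toAlgHom.toLinearMap).comp g) fun _ _ _ l _ r _ s _ => by
    have h := hg l r
    change Y.act (g (L.act l (E.algMap r))) (A.algMap s) =
      Y.act (g l) (A.algMap (π.hom r * s))
    rw [h, map_mul, Y.act_mul]

theorem redLift_redq {L : DGMod E.toDGAlg} {Y : DGMod A.toDGAlg} (g : L →ₗ[k] Y) (hg) (l : L) :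
    redLift π j g hg (redq π j L l) = g l := by
  refine (Tens.lift_tmk (X := L.restrict E.algMap) (N := π.base) _ _ l (1 : S)).trans ?_
  change Y.act (g l) (A.algMap (1 : S)) = g l
  rw [map_one, Y.act_one]

theorem redq_d (L : DGMod E.toDGAlg) (l : L) :
    redq π j L (L.str.d l) = (redMod π j L).str.d (redq π j L l) := quotLin_d π L l

theorem redq_act (L : DGMod E.toDGAlg) (l : L) (a : A.toDGAlg) :
    redq π j L (L.act l (j a)) = (redMod π j L).act (redq π j L l) a :=
  quotLin_act π L l (j a)

theorem redq_act_algMap (hj : ∀ s, j (A.algMap s) = E.algMap (R.algMap s))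
    (L : DGMod E.toDGAlg) (l : L) (r : R.toDGAlg) :
    redq π j L (L.act l (E.algMap r)) =
      (redMod π j L).act (redq π j L l) (A.algMap (π.hom r)) :=
  quotLin_act_algMap π j L hj l r

/-- `E` is generated by `A` and `R`, and `p : E ⟶ A` is a retraction of `A ⟶ E` over the
augmentation. -/
structure IsRetraction (p : DGAlg.Hom E.toDGAlg A.toDGAlg) : Prop where
  base : ∀ s, j (A.algMap s) = E.algMap (R.algMap s)
  left : ∀ a, p (j a) = a
  right : ∀ r, p (E.algMap r) = A.algMap (π.hom r)
  gen : ∀ Q : E.toDGAlg → Prop, (∀ x y, Q x → Q y → Q (x + y)) → Q 0 →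
    (∀ a r, Q (j a * E.algMap r)) → ∀ e, Q e

variable {π j} in
theorem IsRetraction.redq_act {p : DGAlg.Hom E.toDGAlg A.toDGAlg} (hp : IsRetraction π j p)
    (L : DGMod E.toDGAlg) (l : L) (e : E.toDGAlg) :
    redq π j L (L.act l e) = (redMod π j L).act (redq π j L l) (p e) := by
  refine hp.gen (fun e => redq π j L (L.act l e) = (redMod π j L).act (redq π j L l) (p e))
    (fun _ _ h h' => by simp only [map_add, h, h']) (by simp only [map_zero]) (fun a r => ?_) e
  rw [L.act_mul, redq_act_algMap π j hp.base, map_mul, hp.left, hp.right, DGMod.act_mul,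
    DGDefo.redq_act]

/-- Reduction preserves relatively cofibrant modules. -/
theorem IsCofib.red {p : DGAlg.Hom E.toDGAlg A.toDGAlg} (hp : IsRetraction π j p)
    {P : DGMod E.toDGAlg} (hP : IsCofib E P) : IsCofib A (redMod π j P) := by
  rintro Y ⟨c, hc, H⟩ e f hf hfd
  -- Along the retraction `p : E ⟶ A`, the target becomes an `E`-module on which `R` acts through
  -- the augmentation, so an `S`-linear contraction is `R`-linear.
  have hc2 : ((Y.restrict p).restrict E.algMap).IsContractible := by
    refine ⟨c, ⟨hc.deg, fun y r => ?_⟩, H⟩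
    have := hc.act y (π.hom r)
    change c (Y.act y (A.algMap (π.hom r))) = Y.act (c y) (A.algMap (π.hom r)) at this
    rw [← hp.right] at this
    exact this
  obtain ⟨g, hg, hgd⟩ := hP (Y.restrict p) hc2 e (f.comp (redq π j P)) ⟨fun {i l} hl =>
      hf.deg (redq_deg π j hl), fun l x => by
      change f (redq π j P (P.act l x)) = Y.act (f (redq π j P l)) (p x)
      rw [hp.redq_act, hf.act]⟩ (fun l => by
      change Y.str.d (f (redq π j P l)) = (-1 : k) ^ e • f (redq π j P (P.str.d l))
      rw [hfd, redq_d])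
  have hgr : ∀ l r, g (P.act l (E.algMap r)) = Y.act (g l) (A.algMap (π.hom r)) := by
    intro l r
    have := hg.act l (E.algMap r)
    change g _ = Y.act (g l) (p (E.algMap r)) at this
    rw [hp.right] at this
    exact this
  -- The null-homotopy on `P` is linear over `R`, which acts on the target through `S`, so it
  -- factors through the reduction of `P`.
  refine ⟨redLift π j g hgr, ⟨fun {i z} hz => ?_, fun z a => ?_⟩, fun z => ?_⟩
  · refine red_deg_induction π j (P := fun z => redLift π j g hgr z ∈ Y.str.deg (i + (e - 1)))
      (fun l hl => ?_) hz
    rw [redLift_redq]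
    exact hg.deg hl
  · obtain ⟨l, rfl⟩ := redq_surjective π j P z
    have := hg.act l (j a)
    change g _ = Y.act (g l) (p (j a)) at this
    rw [hp.left] at this
    rw [← DGDefo.redq_act, redLift_redq, redLift_redq, this]
  · obtain ⟨l, rfl⟩ := redq_surjective π j P z
    rw [← redq_d, redLift_redq, redLift_redq]
    exact hgd l

end ReductionFunctor

/-! ### The extension of `L ⊗_R S` by `(L ⊗_R S) ⊗_S 𝔫` -/

section NilInclusion

variable {S : DGAlg k} {R : DGAlgOver S} (π : Augmentation R) {A : DGAlgOver S}
  {E : DGAlgOver R.toDGAlg} (j : DGAlg.Hom A.toDGAlg E.toDGAlg)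

/-- The trilinear map `(l, s, n) ↦ l (s n)`. -/
def nilTri (L : DGMod E.toDGAlg) : L →ₗ[k] S →ₗ[k] π.kerS →ₗ[k] L :=
  LinearMap.mk₂ k (fun l s => (L.act l).comp (E.algMap.toAlgHom.toLinearMap.comp
      ((LinearMap.mulLeft k (R.algMap s)).comp
        (LinearMap.ker π.hom.toAlgHom.toLinearMap).subtype)))
    (fun _ _ _ => by ext; simp) (fun _ _ _ => by ext; simp)
    (fun _ _ _ => by ext; simp [add_mul]) (fun _ _ _ => by ext; simp)

theorem nilTri_apply (L : DGMod E.toDGAlg) (l : L) (s : S) (n : π.kerS) :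
    nilTri π L l s n = L.act l (E.algMap (R.algMap s * (n : R.toDGAlg))) := rfl

/-- The difference between `r` and its image in `S` lies in `𝔫`, hence multiplies `𝔫` to zero. -/
theorem nilTri_balanced (hπ : π.SqZero) (L : DGMod E.toDGAlg) (l : L) (r : R.toDGAlg) (s : S) :
    nilTri π L (L.act l (E.algMap r)) s = nilTri π L l (π.hom r * s) := by
  refine LinearMap.ext fun n => ?_
  rw [nilTri_apply, nilTri_apply, ← L.act_mul, ← map_mul, ← mul_assoc]
  congr 2
  rw [← sub_eq_zero, ← sub_mul]
  refine hπ _ _ ?_ n.2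
  rw [map_sub, map_mul, π.hom_algMap, π.hom_algMap, sub_self]

/-- The bilinear map `(z, n) ↦ l n` for a lift `l` of `z`; it is well defined as `𝔫 ^ 2 = 0`. -/
noncomputable def nilBil (hπ : π.SqZero) (L : DGMod E.toDGAlg) :
    redMod π j L →ₗ[k] π.kerS →ₗ[k] L :=
  Tens.lift (X := L.restrict E.algMap) (N := π.base) (nilTri π L)
    fun _ _ _ l _ r _ s _ => nilTri_balanced π hπ L l r s

theorem nilBil_redq (hπ : π.SqZero) (L : DGMod E.toDGAlg) (l : L) (n : π.kerS) :
    nilBil π j hπ L (redq π j L l) n = L.act l (E.algMap (n : R.toDGAlg)) := by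
  have h : nilBil π j hπ L (redq π j L l) = nilTri π L l (1 : S) :=
    Tens.lift_tmk (X := L.restrict E.algMap) (N := π.base) _ _ l (1 : S)
  rw [h, nilTri_apply, map_one, one_mul]

theorem nilBil_balanced (hj : ∀ s, j (A.algMap s) = E.algMap (R.algMap s)) (hπ : π.SqZero)
    (L : DGMod E.toDGAlg) (z : redMod π j L) (s : S) (n : π.kerS) :
    nilBil π j hπ L (((redMod π j L).restrict A.algMap).act z s) n =
      nilBil π j hπ L z (π.kerS.act s n) := by
  obtain ⟨l, rfl⟩ := redq_surjective π j L z
  change nilBil π j hπ L ((redMod π j L).act (redq π j L l) (A.algMap s)) n = _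
  rw [← redq_act, nilBil_redq, nilBil_redq, ← L.act_mul, hj, ← map_mul]
  rfl

/-- The linear map `(L ⊗_R S) ⊗_S 𝔫 ⟶ L`, `(l ⊗ 1) ⊗ n ↦ l n`. -/
noncomputable def nilLin (hj : ∀ s, j (A.algMap s) = E.algMap (R.algMap s)) (hπ : π.SqZero)
    (L : DGMod E.toDGAlg) : Tens ((redMod π j L).restrict A.algMap) π.kerS →ₗ[k] L :=
  Tens.lift (nilBil π j hπ L) fun _ _ _ z _ s _ n _ => nilBil_balanced π j hj hπ L z s n

variable (hj : ∀ s, j (A.algMap s) = E.algMap (R.algMap s)) (hπ : π.SqZero)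

theorem nilLin_tmk (L : DGMod E.toDGAlg) (l : L) (n : π.kerS) :
    nilLin π j hj hπ L (tmk ((redMod π j L).restrict A.algMap) π.kerS (redq π j L l) n) =
      L.act l (E.algMap (n : R.toDGAlg)) := by
  rw [nilLin, Tens.lift_tmk, nilBil_redq]

/-- To prove a property of the elements of degree `m` of `(L ⊗_R S) ⊗_S 𝔫`, it suffices to
consider the elements `(l ⊗ 1) ⊗ n`. -/
theorem nil_deg_induction {L : DGMod E.toDGAlg} {m : ℤ}
    {P : Tens ((redMod π j L).restrict A.algMap) π.kerS → Prop} (zero : P 0)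
    (add : ∀ s t, P s → P t → P (s + t))
    (hom : ∀ p q, ∀ l ∈ L.str.deg p, ∀ n ∈ π.kerS.str.deg q, p + q = m →
      P (tmk ((redMod π j L).restrict A.algMap) π.kerS (redq π j L l) n))
    {w} (hw : w ∈ Tens.deg ((redMod π j L).restrict A.algMap) π.kerS m) : P w := by
  refine Tens.deg_induction (P := P) zero add (fun p q z hz n hn h => ?_) hw
  exact red_deg_induction π j (P := fun z =>
    P (tmk ((redMod π j L).restrict A.algMap) π.kerS z n)) (fun l hl => hom p q l hl n hn h) hz

theorem nil_hom_ext {L : DGMod E.toDGAlg} {Y : Type u} [AddCommGroup Y] [Module k Y]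
    {f g : Tens ((redMod π j L).restrict A.algMap) π.kerS →ₗ[k] Y}
    (h : ∀ p q, ∀ l ∈ L.str.deg p, ∀ n ∈ π.kerS.str.deg q,
      f (tmk ((redMod π j L).restrict A.algMap) π.kerS (redq π j L l) n) =
        g (tmk ((redMod π j L).restrict A.algMap) π.kerS (redq π j L l) n)) : f = g := by
  refine (Tens.str ((redMod π j L).restrict A.algMap) π.kerS).hom_ext fun m w hw => ?_
  exact nil_deg_induction π j (P := fun w => f w = g w) (by simp)
    (fun _ _ h h' => by rw [map_add, map_add, h, h']) (fun p q l hl n hn _ => h p q l hl n hn) hw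

theorem tensor_d_redq {L : DGMod E.toDGAlg} {p : ℤ} {l : L} (hl : l ∈ L.str.deg p) (n : π.kerS) :
    Tens.d ((redMod π j L).restrict A.algMap) π.kerS
        (tmk ((redMod π j L).restrict A.algMap) π.kerS (redq π j L l) n) =
      tmk ((redMod π j L).restrict A.algMap) π.kerS (redq π j L (L.str.d l)) n +
        (-1 : k) ^ p • tmk ((redMod π j L).restrict A.algMap) π.kerS (redq π j L l)
          (π.kerS.str.d n) := by
  rw [redq_d]
  exact Tens.d_tmk (X := (redMod π j L).restrict A.algMap) (N := π.kerS) (redq_deg π j hl) n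

theorem tensor_act_redq {L : DGMod E.toDGAlg} {p q : ℤ} {a : A.toDGAlg} (ha : a ∈ A.str.deg p)
    (l : L) {n : π.kerS} (hn : n ∈ π.kerS.str.deg q) :
    Tens.act (redMod π j L) π.kerS
        (tmk ((redMod π j L).restrict A.algMap) π.kerS (redq π j L l) n) a =
      (-1 : k) ^ (p * q) • tmk ((redMod π j L).restrict A.algMap) π.kerS
        (redq π j L (L.act l (j a))) n := by
  rw [redq_act]
  exact Tens.act_tmk (redMod π j L) π.kerS ha (redq π j L l) hn

theorem nilLin_deg (L : DGMod E.toDGAlg) {m : ℤ} {w}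
    (hw : w ∈ Tens.deg ((redMod π j L).restrict A.algMap) π.kerS m) :
    nilLin π j hj hπ L w ∈ L.str.deg m := by
  refine nil_deg_induction π j (P := fun w => nilLin π j hj hπ L w ∈ L.str.deg m) (by simp)
    (fun _ _ h h' => by rw [map_add]; exact add_mem h h') (fun p q l hl n hn h => ?_) hw
  rw [nilLin_tmk, ← h]
  exact L.act_mem hl (E.algMap.map_deg hn)

theorem nilLin_d (L : DGMod E.toDGAlg) (w) :
    nilLin π j hj hπ L (Tens.d ((redMod π j L).restrict A.algMap) π.kerS w) =
      L.str.d (nilLin π j hj hπ L w) := by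
  have : (nilLin π j hj hπ L).comp (Tens.d ((redMod π j L).restrict A.algMap) π.kerS) =
      L.str.d.comp (nilLin π j hj hπ L) := by
    refine nil_hom_ext π j fun p q l hl n hn => ?_
    rw [LinearMap.comp_apply, LinearMap.comp_apply, tensor_d_redq π j hl, map_add, map_smul,
      nilLin_tmk, nilLin_tmk, nilLin_tmk, L.d_act _ hl, ← E.algMap.map_d]
    rfl
  exact LinearMap.congr_fun this w

theorem nilLin_act (L : DGMod E.toDGAlg) (w) (a : A.toDGAlg) :
    nilLin π j hj hπ L (Tens.act (redMod π j L) π.kerS w a) =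
      L.act (nilLin π j hj hπ L w) (j a) := by
  have : (Tens.act (redMod π j L) π.kerS).compr₂ (nilLin π j hj hπ L) =
      (L.act.compl₂ j.toAlgHom.toLinearMap).comp (nilLin π j hj hπ L) := by
    refine nil_hom_ext π j fun p q l hl n hn => A.str.hom_ext fun m a ha => ?_
    have hn' : (n : R.toDGAlg) ∈ R.str.deg q := hn
    rw [LinearMap.compr₂_apply, tensor_act_redq π j ha l hn, map_smul, nilLin_tmk,
      LinearMap.comp_apply, nilLin_tmk, LinearMap.compl₂_apply, AlgHom.toLinearMap_apply,
      ← L.act_mul, ← L.act_mul, E.central hn' (j.map_deg ha), map_smul, mul_comm m]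
  exact LinearMap.congr_fun (LinearMap.congr_fun this w) a

/-- The morphism `(L ⊗_R S) ⊗_S 𝔫 ⟶ L`, `(l ⊗ 1) ⊗ n ↦ l n`, of right dg `A`-modules. -/
noncomputable def nilIncl (L : DGMod E.toDGAlg) : (redMod π j L).tensor π.kerS ⟶ L.restrict j where
  lin := nilLin π j hj hπ L
  map_deg h := nilLin_deg π j hj hπ L h
  map_d := nilLin_d π j hj hπ L
  map_act := nilLin_act π j hj hπ L

theorem redq_nilIncl (L : DGMod E.toDGAlg) (w) : redq π j L ((nilIncl π j hj hπ L).lin w) = 0 := by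
  have : (redq π j L).comp (nilLin π j hj hπ L) = 0 := by
    refine nil_hom_ext π j fun p q l hl n hn => ?_
    have hn' : π.hom (n : R.toDGAlg) = 0 := n.2
    rw [LinearMap.comp_apply, nilLin_tmk, redq_act_algMap π j hj, hn', map_zero, map_zero]
    rfl
  exact LinearMap.congr_fun this w

/-- The product `l n` depends only on the reduction of `l`. -/
theorem act_ker_of_redq (hπ : π.SqZero) {L : DGMod E.toDGAlg} {l : L} (hl : redq π j L l = 0) (n : π.kerS) :
    L.act l (E.algMap (n : R.toDGAlg)) = 0 := by
  rw [← nilBil_redq π j hπ, hl, map_zero]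
  rfl

/-- This compares the map `L ⊗_R 𝔫 ⟶ L`, used to define the connecting morphism, with the inclusion
of `(L ⊗_R S) ⊗_S 𝔫`, in which the cocycles take their values. -/
theorem nilIncl_canMap (L : DGMod E.toDGAlg) (x) :
    (nilIncl π j hj hπ L).lin ((canMap π j L hj hπ).lin x) = (mulMapA π j L).lin x := by
  have : (nilLin π j hj hπ L).comp (canLin π j L hj hπ) = mulLin π L := by
    refine Tens.hom_ext fun p q l hl n hn => ?_
    rw [LinearMap.comp_apply, canLin_tmk, mulLin_tmk]
    exact nilLin_tmk π j hj hπ L l n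
  exact LinearMap.congr_fun this x

variable {π j hj} in
-- The image of the inclusion is killed by `𝔫`, so `E` acts on it through `p`. Consequently
-- `A`-linear maps to `(L ⊗_R S) ⊗_S 𝔫`, composed with the reduction and the inclusion, are
-- `E`-linear.
theorem IsRetraction.nilIncl_act {p : DGAlg.Hom E.toDGAlg A.toDGAlg} (hp : IsRetraction π j p)
    (L : DGMod E.toDGAlg) (w) (e : E.toDGAlg) :
    L.act ((nilIncl π j hj hπ L).lin w) e =
      (nilIncl π j hj hπ L).lin (((redMod π j L).tensor π.kerS).act w (p e)) := by
  refine hp.gen (fun e => L.act ((nilIncl π j hj hπ L).lin w) e =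
      (nilIncl π j hj hπ L).lin (((redMod π j L).tensor π.kerS).act w (p e)))
    (fun _ _ h h' => by simp only [map_add, h, h']) (by simp only [map_zero]) (fun a r => ?_) e
  have h1 : ∀ (l : L), redq π j L l = 0 →
      L.act l (E.algMap r) = L.act l (E.algMap (R.algMap (π.hom r))) := by
    intro l hl
    have := act_ker_of_redq π j hπ hl (π.toKer r)
    rw [π.coe_toKer, map_sub, map_sub, sub_eq_zero] at this
    exact this
  have h2 : L.act ((nilIncl π j hj hπ L).lin w) (j a) =
      (nilIncl π j hj hπ L).lin (((redMod π j L).tensor π.kerS).act w a) :=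
    ((nilIncl π j hj hπ L).map_act w a).symm
  rw [L.act_mul, h2, h1 _ (redq_nilIncl π j hj hπ L _), ← hj, map_mul, hp.left, hp.right,
    DGMod.act_mul]
  exact ((nilIncl π j hj hπ L).map_act _ _).symm

/-- Naturality of the inclusion for maps that need not commute with the differentials, as is
required for graded lifts of a morphism. -/
theorem nilIncl_map {L L' : DGMod E.toDGAlg} (f : L →ₗ[k] L')
    (hf : ∀ l r, f (L.act l (E.algMap r)) = L'.act (f l) (E.algMap r))
    (g : redMod π j L →ₗ[k] redMod π j L')
    (hg : ∀ z s, g (((redMod π j L).restrict A.algMap).act z s) =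
      ((redMod π j L').restrict A.algMap).act (g z) s)
    (h : ∀ l, redq π j L' (f l) = g (redq π j L l)) (w) :
    f ((nilIncl π j hj hπ L).lin w) = (nilIncl π j hj hπ L').lin
      (Tens.map (X := (redMod π j L).restrict A.algMap) (X' := (redMod π j L').restrict A.algMap)
        π.kerS g hg w) := by
  have : f.comp (nilLin π j hj hπ L) = (nilLin π j hj hπ L').comp
      (Tens.map (X := (redMod π j L).restrict A.algMap) (X' := (redMod π j L').restrict A.algMap)
        π.kerS g hg) := by
    refine nil_hom_ext π j fun p q l hl n hn => ?_
    rw [LinearMap.comp_apply, LinearMap.comp_apply, nilLin_tmk, hf, Tens.map_tmk, ← h, nilLin_tmk]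
  exact LinearMap.congr_fun this w

/-- For `L` free as a graded `R`-module, the sequence `0 ⟶ (L ⊗_R S) ⊗_S 𝔫 ⟶ L ⟶ L ⊗_R S ⟶ 0` is
split exact. -/
theorem exists_nilRetraction {L : DGMod E.toDGAlg} (hL : (L.restrict E.algMap).IsGradedFree) :
    ∃ ρ : L →ₗ[k] (redMod π j L).tensor π.kerS,
      (∀ {m : ℤ} {l : L}, l ∈ L.str.deg m → ρ l ∈ ((redMod π j L).tensor π.kerS).str.deg m) ∧
      (∀ w, ρ ((nilIncl π j hj hπ L).lin w) = w) ∧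
      ∀ l, redq π j L l = 0 → (nilIncl π j hj hπ L).lin (ρ l) = l := by
  obtain ⟨I, n, b, c, hb, hc, hspan⟩ := hL.exists_coord
  obtain ⟨t, ht⟩ := exists_baseSection π L b c hc hspan
  obtain ⟨r, hr⟩ := exists_kerRetraction π L b c hc
  have hspan' : ∀ P : L → Prop, P 0 → (∀ x y, P x → P y → P (x + y)) →
      (∀ i a, P (L.act (b i) (E.algMap a))) → ∀ x, P x := hspan
  have htoKer : ∀ {p : ℤ} {a : R.toDGAlg}, a ∈ R.str.deg p → π.toKer a ∈ π.ker.str.deg p :=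
    fun ha => sub_mem ha (R.algMap.map_deg (π.hom.map_deg ha))
  have hrdeg : ∀ {m : ℤ} {x : L}, x ∈ L.str.deg m →
      r x ∈ Tens.deg (L.restrict E.algMap) π.ker m := by
    intro m x hx
    refine DGMod.deg_induction_of_basis (X := L.restrict E.algMap) hb hspan
      (P := fun x => r x ∈ Tens.deg (L.restrict E.algMap) π.ker m) (by simp)
      (fun _ _ h h' => by rw [map_add]; exact add_mem h h') (fun i p a ha h => ?_) hx
    have h1 : r ((L.restrict E.algMap).act (b i) a) = _ := hr i a
    rw [h1, ← h]
    exact tmk_mem (X := L.restrict E.algMap) (hb i) (htoKer ha)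
  have hrn : ∀ (l : L) (n : π.ker), r (L.act l (E.algMap (n : R.toDGAlg))) =
      tmk (L.restrict E.algMap) π.ker l n := by
    intro l n
    refine hspan' (fun l => r (L.act l (E.algMap (n : R.toDGAlg))) =
      tmk (L.restrict E.algMap) π.ker l n) (by simp)
      (fun _ _ h h' => by simp only [map_add, LinearMap.add_apply, h, h']) (fun i a => ?_) l
    rw [← L.act_mul, ← map_mul, hr]
    have h1 : π.toKer (a * (n : R.toDGAlg)) = π.ker.act a n := by
      apply Subtype.ext
      change a * (n : R.toDGAlg) - R.algMap (π.hom (a * (n : R.toDGAlg))) = a * (n : R.toDGAlg)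
      have hn : π.hom (n : R.toDGAlg) = 0 := n.2
      rw [map_mul, hn, mul_zero, map_zero, sub_zero]
    rw [h1]
    exact (tmk_balanced (X := L.restrict E.algMap) (N := π.ker) (b i) a n).symm
  -- In coordinates this is the decomposition `R = 𝔫 ⊕ S`.
  have hrt : ∀ l, mulLin π L (r l) + t (quotLin π L l) = l := by
    intro l
    refine hspan' (fun y => mulLin π L (r y) + t (quotLin π L y) = y) (by simp)
      (fun x y h h' => ?_) (fun i a => ?_) l
    · simp only [map_add]
      rw [add_add_add_comm, h, h']
    · rw [hr, quotLin_apply, ht, mulLin_tmk, ← map_add, ← map_add, π.coe_toKer, mul_one,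
        sub_add_cancel]
  -- If `l` reduces to zero, the decomposition above leaves only its component in `L ⊗_R 𝔫`.
  refine ⟨(canLin π j L hj hπ).comp r, fun hl => canLin_deg π j L hj hπ (hrdeg hl), fun w => ?_,
    fun l hl => ?_⟩
  · have : ((canLin π j L hj hπ).comp r).comp (nilLin π j hj hπ L) = LinearMap.id := by
      refine nil_hom_ext π j fun p q l hl n hn => ?_
      rw [LinearMap.comp_apply, nilLin_tmk, LinearMap.comp_apply, hrn, canLin_tmk]
      rfl
    exact LinearMap.congr_fun this w
  · have h1 : quotLin π L l = 0 := hl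
    have h2 := hrt l
    rw [h1, map_zero, add_zero] at h2
    refine Eq.trans ?_ h2
    exact nilIncl_canMap π j hj hπ L (r l)

end NilInclusion

/-! ### The extension class: naturality and cocycles -/

section ExtensionClass

variable {S : DGAlg k} {R : DGAlgOver S} (π : Augmentation R) {A : DGAlgOver S}
  {E : DGAlgOver R.toDGAlg} (j : DGAlg.Hom A.toDGAlg E.toDGAlg)
  (hj : ∀ s, j (A.algMap s) = E.algMap (R.algMap s)) (hR : R.IsComm) (hπ : π.SqZero)

/-- The morphism from the cone of `L ⊗_R 𝔫 ⟶ L` to `((L ⊗_R S) ⊗_S 𝔫)[1]`. -/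
noncomputable def coneCan (L : DGMod E.toDGAlg) :
    DGMod.cone (mulMapA π j L) ⟶ (twist A π.kerS).obj (redMod π j L) :=
  DGMod.coneFst (mulMapA π j L) ≫ (DGMod.shiftFunctor A.toDGAlg).map (canMap π j L hj hπ)

/-- The class `L ⊗_R S ⟶ ((L ⊗_R S) ⊗_S 𝔫)[1]` of the extension
`0 ⟶ (L ⊗_R S) ⊗_S 𝔫 ⟶ L ⟶ L ⊗_R S ⟶ 0`, for `L` free as a graded `R`-module. -/
noncomputable def extClass (L : DGMod E.toDGAlg) (hL : (L.restrict E.algMap).IsGradedFree) :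
    (relQ A).obj (redMod π j L) ⟶ (relQ A).obj ((twist A π.kerS).obj (redMod π j L)) :=
  (Localization.isoOfHom (relQ A) (relQis A) _ (relQis_cone_mulMapA π L j hj hR hL)).inv ≫
    (relQ A).map (coneCan π j hj hπ L)

/-- The class contains a formal inverse. Moving it to the other side turns an identity about the
class into one about the morphisms from the cone. -/
theorem extClass_eq_iff (L : DGMod E.toDGAlg) (hL : (L.restrict E.algMap).IsGradedFree)
    {X : RelD A} (g : (relQ A).obj ((twist A π.kerS).obj (redMod π j L)) ⟶ X)
    (α : (relQ A).obj (redMod π j L) ⟶ X) :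
    extClass π j hj hR hπ L hL ≫ g = α ↔ (relQ A).map (coneCan π j hj hπ L) ≫ g =
      (relQ A).map (DGMod.coneDesc (mulMapA π j L) (quotMapA π j L) (quotMapA_mulMapA π j L)) ≫
        α := by
  rw [extClass, Category.assoc, Iso.inv_comp_eq, Localization.isoOfHom_hom]

/-- Functoriality of `L ⊗_R 𝔫`. -/
noncomputable def nilMap {L L' : DGMod E.toDGAlg} (f : L ⟶ L') : nilMod π j L ⟶ nilMod π j L' :=
  (DGMod.tensorFunctor E π.ker ⋙ DGMod.res j).map f

theorem nilMap_tmk {L L' : DGMod E.toDGAlg} (f : L ⟶ L') (l : L) (n : π.ker) :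
    (nilMap π j f).lin (tmk (L.restrict E.algMap) π.ker l n) =
      tmk (L'.restrict E.algMap) π.ker (f.lin l) n :=
  Tens.map_tmk (X := L.restrict E.algMap) (X' := L'.restrict E.algMap) π.ker f.lin
    (fun x _ => f.map_act x _) l n

theorem mulMapA_nilMap {L L' : DGMod E.toDGAlg} (f : L ⟶ L') (x) :
    (mulMapA π j L').lin ((nilMap π j f).lin x) = f.lin ((mulMapA π j L).lin x) := by
  have : (mulMapA π j L').lin.comp (nilMap π j f).lin = f.lin.comp (mulMapA π j L).lin := by
    refine Tens.hom_ext (X := L.restrict E.algMap) (N := π.ker) fun p q l hl n hn => ?_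
    change mulLin π L' ((nilMap π j f).lin (tmk (L.restrict E.algMap) π.ker l n)) =
      f.lin (mulLin π L (tmk (L.restrict E.algMap) π.ker l n))
    rw [nilMap_tmk, mulLin_tmk, mulLin_tmk]
    exact (f.map_act _ _).symm
  exact LinearMap.congr_fun this x

theorem canMap_nilMap {L L' : DGMod E.toDGAlg} (f : L ⟶ L') (x) :
    (canMap π j L' hj hπ).lin ((nilMap π j f).lin x) =
      (DGMod.tensorMap (redMap π j f) π.kerS).lin ((canMap π j L hj hπ).lin x) := by
  have : (canMap π j L' hj hπ).lin.comp (nilMap π j f).lin =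
      (DGMod.tensorMap (redMap π j f) π.kerS).lin.comp (canMap π j L hj hπ).lin := by
    refine Tens.hom_ext (X := L.restrict E.algMap) (N := π.ker) fun p q l hl n hn => ?_
    change canLin π j L' hj hπ ((nilMap π j f).lin (tmk (L.restrict E.algMap) π.ker l n)) =
      (DGMod.tensorMap (redMap π j f) π.kerS).lin
        (canLin π j L hj hπ (tmk (L.restrict E.algMap) π.ker l n))
    rw [nilMap_tmk, canLin_tmk, canLin_tmk]
    have h : quotLin π L' (f.lin l) = (redMap π j f).lin (quotLin π L l) :=
      (redMap_redq π j f l).symm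
    rw [h]
    exact (Tens.map_tmk (X := (redMod π j L).restrict A.algMap)
      (X' := (redMod π j L').restrict A.algMap) π.kerS (redMap π j f).lin
      (fun x b => (redMap π j f).map_act x _) _ n).symm
  exact LinearMap.congr_fun this x

/-- Functoriality of the cone of `L ⊗_R 𝔫 ⟶ L`. -/
noncomputable def nilConeMap {L L' : DGMod E.toDGAlg} (f : L ⟶ L') :
    DGMod.cone (mulMapA π j L) ⟶ DGMod.cone (mulMapA π j L') where
  lin := LinearMap.prodMap (nilMap π j f).lin f.lin
  map_deg h := ⟨(nilMap π j f).map_deg h.1, f.map_deg h.2⟩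
  map_d := by
    rintro ⟨x, l⟩
    refine Prod.ext ?_ ?_
    · change (nilMap π j f).lin (-(nilMod π j L).str.d x) =
        -(nilMod π j L').str.d ((nilMap π j f).lin x)
      rw [map_neg, (nilMap π j f).map_d]
    · change f.lin ((mulMapA π j L).lin x + L.str.d l) =
        (mulMapA π j L').lin ((nilMap π j f).lin x) + L'.str.d (f.lin l)
      rw [map_add, mulMapA_nilMap, f.map_d]
  map_act x a := Prod.ext ((nilMap π j f).map_act _ _) (f.map_act _ _)

/-- A morphism `f` induces a morphism of cones that commutes strictly with both legs of the roof
defining the class. -/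
theorem extClass_naturality {L L' : DGMod E.toDGAlg} (hL : (L.restrict E.algMap).IsGradedFree)
    (hL' : (L'.restrict E.algMap).IsGradedFree) (f : L ⟶ L') :
    extClass π j hj hR hπ L hL ≫ (relQ A).map ((twist A π.kerS).map (redMap π j f)) =
      (relQ A).map (redMap π j f) ≫ extClass π j hj hR hπ L' hL' := by
  have h1 := (extClass_eq_iff π j hj hR hπ L' hL' (𝟙 _) _).1 (Category.comp_id _)
  have h2 : DGMod.coneDesc (mulMapA π j L) (quotMapA π j L) (quotMapA_mulMapA π j L) ≫
      redMap π j f = nilConeMap π j f ≫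
        DGMod.coneDesc (mulMapA π j L') (quotMapA π j L') (quotMapA_mulMapA π j L') :=
    DGMod.hom_ext fun x => redMap_redq π j f x.2
  have h3 : coneCan π j hj hπ L ≫ (twist A π.kerS).map (redMap π j f) =
      nilConeMap π j f ≫ coneCan π j hj hπ L' :=
    DGMod.hom_ext fun x => by
      change (DGMod.tensorMap (redMap π j f) π.kerS).lin ((canMap π j L hj hπ).lin (-x.1)) =
        (canMap π j L' hj hπ).lin (-(nilMap π j f).lin x.1)
      rw [← map_neg, canMap_nilMap]
  rw [Category.comp_id] at h1
  rw [extClass_eq_iff, ← Category.assoc, ← CategoryTheory.Functor.map_comp,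
    ← CategoryTheory.Functor.map_comp, h2,
    CategoryTheory.Functor.map_comp _ (nilConeMap π j f), Category.assoc, ← h1,
    ← CategoryTheory.Functor.map_comp, ← h3]

/-- A graded section `t` of `L ⟶ L ⊗_R S` computes the class of the extension. -/
theorem extClass_eq_of_section {L : DGMod E.toDGAlg} (hL : (L.restrict E.algMap).IsGradedFree)
    {t : redMod π j L →ₗ[k] L} (ht : IsGHom (redMod π j L) (L.restrict j) 0 t)
    (hqt : ∀ z, redq π j L (t z) = z)
    (e : redMod π j L ⟶ (twist A π.kerS).obj (redMod π j L))
    (he : ∀ z, (nilIncl π j hj hπ L).lin (e.lin z) =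
      L.str.d (t z) - t ((redMod π j L).str.d z)) :
    extClass π j hj hR hπ L hL = (relQ A).map e := by
  obtain ⟨ρ, hρ, hρι, hιρ⟩ := exists_nilRetraction π j hj hπ hL
  have hinj : Function.Injective (nilIncl π j hj hπ L).lin :=
    Function.LeftInverse.injective hρι
  have hH : ∀ l : L, (nilIncl π j hj hπ L).lin (ρ (l - t (redq π j L l))) =
      l - t (redq π j L l) := fun l => hιρ _ (by rw [map_sub, hqt, sub_self])
  rw [← Category.comp_id (extClass π j hj hR hπ L hL), extClass_eq_iff, Category.comp_id,
    ← CategoryTheory.Functor.map_comp]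
  -- On the cone, the homotopy sends `(x, l)` to minus the component of `l` in `(L ⊗_R S) ⊗_S 𝔫`
  -- determined by the section `t`. The identities are checked after the injective map `nilIncl`,
  -- where this component becomes `l - t (redq l)`.
  refine relQ_map_eq_of_homotopic A ⟨-(ρ.comp ((LinearMap.id - t.comp (redq π j L)).comp
    (LinearMap.snd k (nilMod π j L) L))), ?_, ?_, ?_⟩
  · rintro i ⟨x, l⟩ ⟨_, hl⟩
    have h0 := ht.deg (redq_deg π j hl)
    rw [add_zero] at h0
    have := neg_mem (hρ (sub_mem hl h0))
    change -ρ (l - t (redq π j L l)) ∈ ((redMod π j L).tensor π.kerS).str.deg (i - 1 + 1)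
    rwa [sub_add_cancel]
  · rintro ⟨x, l⟩ a
    change -ρ (L.act l (j a) - t (redq π j L (L.act l (j a)))) =
      ((redMod π j L).tensor π.kerS).act (-ρ (l - t (redq π j L l))) a
    refine hinj ?_
    have h1 : t ((redMod π j L).act (redq π j L l) a) = L.act (t (redq π j L l)) (j a) :=
      ht.act _ _
    rw [map_neg, hH, (nilIncl π j hj hπ L).map_act, map_neg, hH, redq_act, h1]
    change _ = L.act (-(l - t (redq π j L l))) (j a)
    rw [map_neg, map_sub]
    rfl
  · rintro ⟨x, l⟩
    refine hinj ?_
    have h1 := nilIncl_canMap π j hj hπ L x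
    let e' : redMod π j L →ₗ[k] (redMod π j L).tensor π.kerS := e.lin
    have h2 : (nilIncl π j hj hπ L).lin (e' (redq π j L l)) = _ := he (redq π j L l)
    have h3 : redq π j L ((mulMapA π j L).lin x) = 0 := quotMapA_mulMapA π j L x
    change (nilIncl π j hj hπ L).lin ((canMap π j L hj hπ).lin (-x) - e' (redq π j L l)) =
      (nilIncl π j hj hπ L).lin (-((redMod π j L).tensor π.kerS).str.d
        (-ρ (l - t (redq π j L l))) + -ρ ((mulMapA π j L).lin x + L.str.d l -
          t (redq π j L ((mulMapA π j L).lin x + L.str.d l))))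
    have h4 : ∀ y y' : L, (nilIncl π j hj hπ L).lin (-((redMod π j L).tensor π.kerS).str.d
        (-ρ y) + -ρ y') = L.str.d ((nilIncl π j hj hπ L).lin (ρ y)) -
          (nilIncl π j hj hπ L).lin (ρ y') := fun y y' => by
      rw [map_neg, neg_neg, map_add, (nilIncl π j hj hπ L).map_d, map_neg, sub_eq_add_neg]
    rw [h4, hH, hH, map_sub, map_neg, map_neg, h1, h2, map_add (redq π j L), h3, zero_add,
      redq_d, map_sub]
    abel

/-- Existence of the representative of the class of the extension given by a section. -/
theorem exists_section_hom {L : DGMod E.toDGAlg} (hL : (L.restrict E.algMap).IsGradedFree)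
    {t : redMod π j L →ₗ[k] L} (ht : IsGHom (redMod π j L) (L.restrict j) 0 t)
    (hqt : ∀ z, redq π j L (t z) = z) :
    ∃ e : redMod π j L ⟶ (twist A π.kerS).obj (redMod π j L),
      ∀ z, (nilIncl π j hj hπ L).lin (e.lin z) =
        L.str.d (t z) - t ((redMod π j L).str.d z) := by
  obtain ⟨ρ, hρ, hρι, hιρ⟩ := exists_nilRetraction π j hj hπ hL
  have hinj : Function.Injective (nilIncl π j hj hπ L).lin :=
    Function.LeftInverse.injective hρι
  -- The commutator of `t` with the differentials is `A`-linear, and it reduces to zero because `t`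
  -- is a section. It therefore factors through the inclusion.
  have hθ := ht.commutator (-1) (by norm_num)
  have hq : ∀ z, (nilIncl π j hj hπ L).lin (ρ (L.str.d (t z) - t ((redMod π j L).str.d z))) =
      L.str.d (t z) - t ((redMod π j L).str.d z) := fun z => hιρ _ (by
    rw [map_sub, redq_d, hqt, hqt, sub_self])
  have hθ' : ∀ z, ((L.restrict j).str.d.comp t + (-1 : k) • t.comp (redMod π j L).str.d) z =
      L.str.d (t z) - t ((redMod π j L).str.d z) := fun z => by
    rw [LinearMap.add_apply, LinearMap.smul_apply, neg_one_smul, sub_eq_add_neg]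
    rfl
  refine ⟨⟨ρ.comp (L.str.d.comp t - t.comp (redMod π j L).str.d), fun {i z} hz => ?_,
    fun z => ?_, fun z a => ?_⟩, hq⟩
  · have := hθ.deg hz
    rw [hθ'] at this
    exact hρ this
  · refine hinj ?_
    change (nilIncl π j hj hπ L).lin (ρ (L.str.d (t ((redMod π j L).str.d z)) -
      t ((redMod π j L).str.d ((redMod π j L).str.d z)))) = (nilIncl π j hj hπ L).lin
        (-((redMod π j L).tensor π.kerS).str.d
          (ρ (L.str.d (t z) - t ((redMod π j L).str.d z))))
    rw [hq, map_neg, (nilIncl π j hj hπ L).map_d, hq]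
    change _ = -L.str.d (L.str.d (t z) - t ((redMod π j L).str.d z))
    rw [map_sub, L.str.d_d, (redMod π j L).str.d_d, map_zero]
    abel
  · refine hinj ?_
    have := hθ.act z a
    rw [hθ', hθ'] at this
    change (nilIncl π j hj hπ L).lin (ρ (L.str.d (t ((redMod π j L).act z a)) -
      t ((redMod π j L).str.d ((redMod π j L).act z a)))) = (nilIncl π j hj hπ L).lin
        (((redMod π j L).tensor π.kerS).act
          (ρ (L.str.d (t z) - t ((redMod π j L).str.d z))) a)
    rw [hq, (nilIncl π j hj hπ L).map_act, hq]
    exact this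

end ExtensionClass

/-! ### Lifting morphisms and isomorphisms along the reduction -/

section Lifting

variable {S : DGAlg k} {R : DGAlgOver S} {π : Augmentation R} {A : DGAlgOver S}
  {E : DGAlgOver R.toDGAlg} {j : DGAlg.Hom A.toDGAlg E.toDGAlg}
  {p : DGAlg.Hom E.toDGAlg A.toDGAlg}

/-- A graded `E`-free module `L` has an `A`-linear section of `L ⟶ L ⊗_R S` such that every
`A`-linear map from `L ⊗_R S` to an `E`-module is the restriction along it of an `E`-linear map. -/
theorem IsRetraction.exists_section (hp : IsRetraction π j p) {L : DGMod E.toDGAlg}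
    (hL : L.IsGradedFree) :
    ∃ t : redMod π j L →ₗ[k] L, IsGHom (redMod π j L) (L.restrict j) 0 t ∧
      (∀ z, redq π j L (t z) = z) ∧
      ∀ (Y : DGMod E.toDGAlg) (e : ℤ) (g : redMod π j L →ₗ[k] Y),
        IsGHom (redMod π j L) (Y.restrict j) e g →
        ∃ f : L →ₗ[k] Y, IsGHom L Y e f ∧ (∀ z, f (t z) = g z) ∧
          ∀ l, redq π j Y (f l) = redq π j Y (g (redq π j L l)) := by
  obtain ⟨I, n, b, c, hb, hc, hspan⟩ := hL.exists_coord
  have hL2 : ∀ {Y : Type u} [AddCommGroup Y] [Module k Y] (F G : L →ₗ[k] Y),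
      (∀ i x, F (L.act (b i) x) = G (L.act (b i) x)) → ∀ l, F l = G l := fun F G h l =>
    hspan (fun l => F l = G l) (by simp) (fun _ _ h h' => by rw [map_add, map_add, h, h']) h l
  -- The section replaces the coordinates `x` in an `E`-basis by `j (p x)`. This map turns the
  -- action of `R` into its action through the augmentation, so it descends to the reduction.
  let t0 : (I →₀ E.toDGAlg) →ₗ[k] L := Finsupp.lsum k fun i =>
    (L.act (b i)).comp (j.toAlgHom.toLinearMap.comp p.toAlgHom.toLinearMap)
  obtain ⟨t', ht'⟩ : ∃ t' : L →ₗ[k] L, ∀ i x, t' (L.act (b i) x) = L.act (b i) (j (p x)) := by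
    refine ⟨t0.comp c, fun i x => ?_⟩
    rw [LinearMap.comp_apply, hc]
    simp [t0]
  have htact : ∀ l x, t' (L.act l x) = L.act (t' l) (j (p x)) := fun l x => by
    refine hL2 (t'.comp (L.act.flip x)) ((L.act.flip (j (p x))).comp t') (fun i y => ?_) l
    change t' (L.act (L.act (b i) y) x) = L.act (t' (L.act (b i) y)) (j (p x))
    rw [← L.act_mul, ht', ht', ← L.act_mul, map_mul, map_mul]
  have htdeg : ∀ {m : ℤ} {l : L}, l ∈ L.str.deg m → t' l ∈ L.str.deg m := by
    intro m l hl
    refine DGMod.deg_induction_of_basis hb hspan (P := fun l => t' l ∈ L.str.deg m) (by simp)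
      (fun _ _ h h' => by rw [map_add]; exact add_mem h h') (fun i q x hx h => ?_) hl
    rw [ht', ← h]
    exact L.act_mem (hb i) (j.map_deg (p.map_deg hx))
  have htr : ∀ l r, t' (L.act l (E.algMap r)) =
      (L.restrict j).act (t' l) (A.algMap (π.hom r)) := fun l r => by
    rw [htact, hp.right]
    rfl
  have hqt : ∀ l, redq π j L (t' l) = redq π j L l := by
    refine hL2 ((redq π j L).comp t') (redq π j L) fun i x => ?_
    rw [LinearMap.comp_apply, ht', hp.redq_act, hp.redq_act, hp.left]
  have ht : ∀ l, redLift π j (Y := L.restrict j) t' htr (redq π j L l) = t' l :=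
    redLift_redq π j (Y := L.restrict j) t' htr
  refine ⟨redLift π j (Y := L.restrict j) t' htr, ⟨fun {m z} hz => ?_, fun z a => ?_⟩,
    fun z => ?_, fun Y e g hg => ?_⟩
  · rw [add_zero]
    exact red_deg_induction π j (P := fun z => redLift π j (Y := L.restrict j) t' htr z ∈
      L.str.deg m) (fun l hl => by rw [ht]; exact htdeg hl) hz
  · obtain ⟨l, rfl⟩ := redq_surjective π j L z
    rw [← DGDefo.redq_act, ht, ht, htact, hp.left]
    rfl
  · obtain ⟨l, rfl⟩ := redq_surjective π j L z
    rw [ht, hqt]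
  -- The extension has the value of `g` at the reduced basis. It agrees with `g` along `t` because
  -- the coordinates of elements in the image of `t` come from `A`.
  · let f0 : (I →₀ E.toDGAlg) →ₗ[k] Y := Finsupp.lsum k fun i => Y.act (g (redq π j L (b i)))
    obtain ⟨f, hf⟩ : ∃ f : L →ₗ[k] Y, ∀ i x, f (L.act (b i) x) =
        Y.act (g (redq π j L (b i))) x := by
      refine ⟨f0.comp c, fun i x => ?_⟩
      rw [LinearMap.comp_apply, hc]
      simp [f0]
    have hg' : ∀ l x, g (redq π j L (L.act l x)) = Y.act (g (redq π j L l)) (j (p x)) :=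
      fun l x => by
        rw [hp.redq_act, hg.act]
        rfl
    refine ⟨f, ⟨fun {m l} hl => ?_, fun l x => ?_⟩, fun z => ?_, ?_⟩
    · refine DGMod.deg_induction_of_basis hb hspan (P := fun l => f l ∈ Y.str.deg (m + e))
        (by simp) (fun _ _ h h' => by rw [map_add]; exact add_mem h h') (fun i q x hx h => ?_) hl
      rw [hf, ← h, add_right_comm]
      exact Y.act_mem (hg.deg (redq_deg π j (hb i))) hx
    · refine hL2 (f.comp (L.act.flip x)) ((Y.act.flip x).comp f) (fun i y => ?_) l
      change f (L.act (L.act (b i) y) x) = Y.act (f (L.act (b i) y)) x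
      rw [← L.act_mul, hf, hf, Y.act_mul]
    · obtain ⟨l, rfl⟩ := redq_surjective π j L z
      rw [ht]
      refine hL2 (f.comp t') (g.comp (redq π j L)) (fun i x => ?_) l
      rw [LinearMap.comp_apply, LinearMap.comp_apply, ht', hf, hg']
    · refine hL2 ((redq π j Y).comp f) (((redq π j Y).comp g).comp (redq π j L)) fun i x => ?_
      simp only [LinearMap.comp_apply]
      rw [hf, hg', hp.redq_act, hp.redq_act, hp.left]

/-- An `R`-linear map that takes values in the kernel of the reduction factors through the
reduction of the source. -/
theorem eq_zero_of_redq_eq_zero (hj : ∀ s, j (A.algMap s) = E.algMap (R.algMap s))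
    (hπ : π.SqZero) {L L' : DGMod E.toDGAlg}
    (hL : (L.restrict E.algMap).IsGradedFree) {f : L →ₗ[k] L'}
    (hf : ∀ l x, f (L.act l x) = L'.act (f l) x) (hq : ∀ l, redq π j L' (f l) = 0) {l : L}
    (hl : redq π j L l = 0) : f l = 0 := by
  -- An element that reduces to zero is a sum of products `l n`, and `f (l n) = f l · n` is zero
  -- since `f l` reduces to zero.
  obtain ⟨ρ, -, -, hρ⟩ := exists_nilRetraction π j hj hπ hL
  rw [← hρ l hl]
  have : f.comp (nilLin π j hj hπ L) = 0 := by
    refine nil_hom_ext π j fun a b l _ n _ => ?_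
    rw [LinearMap.comp_apply, nilLin_tmk, hf, act_ker_of_redq π j hπ (hq l)]
    rfl
  exact LinearMap.congr_fun this (ρ l)

/-- If the reduction of an endomorphism is homotopic to the identity, then the endomorphism is
an isomorphism of the relative derived category. -/
theorem IsRetraction.isIso_of_redMap_homotopic (hp : IsRetraction π j p) (hπ : π.SqZero)
    {L : DGMod E.toDGAlg} (hL : L.IsGradedFree) (hL' : (L.restrict E.algMap).IsGradedFree)
    (χ : L ⟶ L) (H : DGMod.Homotopic (redMap π j χ) (𝟙 _)) : IsIso ((relQ E).map χ) := by
  obtain ⟨h, h1, h2, h3⟩ := H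
  obtain ⟨t, ht, hqt, hext⟩ := hp.exists_section hL
  have hh : IsGHom (redMod π j L) (redMod π j L) (-1) h := ⟨fun hx => h1 _ _ hx, h2⟩
  -- An `E`-linear lift of the homotopy `h`, of degree `-1`.
  obtain ⟨s, hs, -, hsq⟩ := hext L (-1) (t.comp h) (ht.comp hh (by norm_num))
  have hsq' : ∀ l, redq π j L (s l) = h (redq π j L l) := fun l => by
    rw [hsq, LinearMap.comp_apply, hqt]
  have hc := hs.commutator 1 (by norm_num)
  have hcd : ∀ l, (L.str.d.comp s + (1 : k) • s.comp L.str.d) l =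
      L.str.d (s l) + s (L.str.d l) := fun l => by
    rw [LinearMap.add_apply, LinearMap.smul_apply, one_smul]
    rfl
  generalize L.str.d.comp s + (1 : k) • s.comp L.str.d = D at hc hcd
  -- Subtracting `D = d s + s d` replaces `χ` by a homotopic endomorphism `μ` whose reduction is
  -- exactly the identity.
  have hμ : IsGHom L L 0 (χ.lin - D) := χ.isGHom.sub (hc.cast (by norm_num))
  let μ : L ⟶ L := hμ.toHom fun l => by
    rw [LinearMap.sub_apply, LinearMap.sub_apply, hcd, hcd, map_sub, map_add, χ.map_d,
      L.str.d_d, L.str.d_d, map_zero, add_zero, zero_add]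
  have hν : IsGHom L L 0 (μ.lin - DGMod.Hom.lin (𝟙 L)) := μ.isGHom.sub (DGMod.Hom.isGHom (𝟙 L))
  have hνq : ∀ l, redq π j L ((μ.lin - DGMod.Hom.lin (𝟙 L)) l) = 0 := fun l => by
    change redq π j L (χ.lin l - D l - l) = 0
    have := h3 (redq π j L l)
    rw [redMap_redq, DGMod.id_lin] at this
    rw [hcd, map_sub, map_sub, map_add, redq_d, hsq', hsq', redq_d, ← this]
    abel
  -- Put `ν = μ - 1`. Its values reduce to zero, so it vanishes on its own image. Hence `ν ^ 2 = 0`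
  -- and `1 - ν` is inverse to `μ`.
  have hνν : ∀ l, (μ.lin - DGMod.Hom.lin (𝟙 L)) ((μ.lin - DGMod.Hom.lin (𝟙 L)) l) = 0 :=
    fun l => eq_zero_of_redq_eq_zero hp.base hπ hL' hν.act hνq (hνq l)
  have hνν' : ∀ l, μ.lin (μ.lin l) = μ.lin l + (μ.lin l - l) := fun l => by
    have := hνν l
    change μ.lin (μ.lin l - l) - (μ.lin l - l) = 0 at this
    rw [map_sub, sub_eq_zero, sub_eq_iff_eq_add] at this
    rw [this]
    abel
  let μ' : L ⟶ L := ((DGMod.Hom.isGHom (𝟙 L)).sub hν).toHom fun l => by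
    change L.str.d l - (μ.lin (L.str.d l) - L.str.d l) = L.str.d (l - (μ.lin l - l))
    rw [map_sub, map_sub, μ.map_d]
  have hiso : IsIso μ := by
    refine ⟨μ', DGMod.hom_ext fun l => ?_, DGMod.hom_ext fun l => ?_⟩
    · change μ.lin l - (μ.lin (μ.lin l) - μ.lin l) = l
      rw [hνν']
      abel
    · change μ.lin (l - (μ.lin l - l)) = l
      rw [map_sub, map_sub, hνν']
      abel
  have : (relQ E).map χ = (relQ E).map μ := by
    refine relQ_map_eq_of_homotopic E ⟨s, fun i x hx => hs.deg hx, hs.act, fun l => ?_⟩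
    change χ.lin l - (χ.lin l - D l) = _
    rw [sub_sub_cancel, hcd]
  rw [this]
  infer_instance

/-- A morphism between reductions that is compatible up to homotopy with the classes of the
extensions lifts. -/
theorem IsRetraction.exists_redMap_eq (hp : IsRetraction π j p) (hR : R.IsComm) (hπ : π.SqZero)
    {L L' : DGMod E.toDGAlg}
    (hL : L.IsGradedFree) (hLR : (L.restrict E.algMap).IsGradedFree) (hLc : IsCofib E L)
    (hL' : L'.IsGradedFree) (hLR' : (L'.restrict E.algMap).IsGradedFree)
    (v : redMod π j L ⟶ redMod π j L')
    (hv : extClass π j hp.base hR hπ L hLR ≫ (relQ A).map ((twist A π.kerS).map v) =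
      (relQ A).map v ≫ extClass π j hp.base hR hπ L' hLR') :
    ∃ φ : L ⟶ L', redMap π j φ = v := by
  obtain ⟨t, ht, hqt, hext⟩ := hp.exists_section hL
  obtain ⟨t', ht', hqt', -⟩ := hp.exists_section hL'
  obtain ⟨e, he⟩ := exists_section_hom π j hp.base hπ hLR ht hqt
  obtain ⟨e', he'⟩ := exists_section_hom π j hp.base hπ hLR' ht' hqt'
  rw [extClass_eq_of_section π j hp.base hR hπ hLR ht hqt e he,
    extClass_eq_of_section π j hp.base hR hπ hLR' ht' hqt' e' he',
    ← CategoryTheory.Functor.map_comp, ← CategoryTheory.Functor.map_comp] at hv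
  -- The reduction of `L` is cofibrant, so the two cocycles, equal in the derived category, are
  -- homotopic.
  obtain ⟨h, h1, h2, h3⟩ := (hLc.red π j hp).homotopic_of_relQ_map_eq hv.symm
  let ι := nilIncl π j hp.base hπ L
  let ι' := nilIncl π j hp.base hπ L'
  let h₀ : redMod π j L →ₗ[k] (redMod π j L').tensor π.kerS := h
  let e₀ : redMod π j L →ₗ[k] (redMod π j L).tensor π.kerS := e.lin
  let e₀' : redMod π j L' →ₗ[k] (redMod π j L').tensor π.kerS := e'.lin
  -- Of degree `-1` to the shift, hence of degree `0` to the unshifted module.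
  have hh : IsGHom (redMod π j L) ((redMod π j L').tensor π.kerS) 0 h₀ := ⟨fun {i z} hz => by
    have : h₀ z ∈ ((redMod π j L').tensor π.kerS).str.deg (i - 1 + 1) := h1 i z hz
    rwa [sub_add_cancel, ← add_zero i] at this, h2⟩
  -- A graded `E`-linear lift of `v`. The obstruction to its being a morphism is its commutator `θ`
  -- with the differentials.
  obtain ⟨f, hf, hft, hfq⟩ := hext L' 0 (t'.comp v.lin) (ht'.comp v.isGHom (by norm_num))
  have hfq' : ∀ l, redq π j L' (f l) = v.lin (redq π j L l) := fun l => by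
    rw [hfq, LinearMap.comp_apply, hqt']
  have hfι : ∀ w, f (ι.lin w) = ι'.lin ((DGMod.tensorMap v π.kerS).lin w) :=
    nilIncl_map π j hp.base hπ f (fun l r => hf.act l _) v.lin
      (fun z s => v.map_act z _) hfq'
  have hθ := hf.commutator (-1) (by norm_num)
  have hθd : ∀ l, (L'.str.d.comp f + (-1 : k) • f.comp L.str.d) l =
      L'.str.d (f l) - f (L.str.d l) := fun l => by
    rw [LinearMap.add_apply, LinearMap.smul_apply, neg_one_smul, sub_eq_add_neg]
    rfl
  generalize L'.str.d.comp f + (-1 : k) • f.comp L.str.d = θ at hθ hθd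
  have hθq : ∀ l, redq π j L' (θ l) = 0 := fun l => by
    rw [hθd, map_sub, redq_d, hfq', hfq', redq_d, v.map_d, sub_self]
  -- Since `θ` takes values that reduce to zero, it depends only on the reduction of its argument
  -- and is determined along `t`.
  have hθt : ∀ l, θ l = θ (t (redq π j L l)) := fun l => by
    rw [← sub_eq_zero, ← map_sub]
    refine eq_zero_of_redq_eq_zero hp.base hπ hLR hθ.act hθq ?_
    rw [map_sub, hqt, sub_self]
  -- Along `t` the obstruction is the difference of the two cocycles, which `h₀` bounds.
  have hθ2 : ∀ z, θ (t z) = -L'.str.d (ι'.lin (h₀ z)) +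
      ι'.lin (h₀ ((redMod π j L).str.d z)) := fun z => by
    have a1 : ι.lin (e₀ z) = L.str.d (t z) - t ((redMod π j L).str.d z) := he z
    have a2 : ι'.lin (e₀' (v.lin z)) =
        L'.str.d (t' (v.lin z)) - t' ((redMod π j L').str.d (v.lin z)) := he' _
    have a3 : e₀' (v.lin z) - (DGMod.tensorMap v π.kerS).lin (e₀ z) =
        -((redMod π j L').tensor π.kerS).str.d (h₀ z) + h₀ ((redMod π j L).str.d z) := h3 z
    have a4 := congrArg ι'.lin a3
    have a5 : ι'.lin (((redMod π j L').tensor π.kerS).str.d (h₀ z)) =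
      L'.str.d (ι'.lin (h₀ z)) := ι'.map_d _
    rw [map_sub, map_add, map_neg, a5, a2, ← hfι, a1, map_sub, hft, LinearMap.comp_apply,
      v.map_d] at a4
    rw [hθd, hft, LinearMap.comp_apply, ← a4]
    abel
  have hιh : IsGHom L L' 0 (ι'.lin.comp (h₀.comp (redq π j L))) := by
    refine ⟨fun {i l} hl => ?_, fun l x => ?_⟩
    · have := ι'.map_deg (hh.deg (redq_deg π j hl))
      exact this
    · change ι'.lin (h₀ (redq π j L (L.act l x))) = L'.act (ι'.lin (h₀ (redq π j L l))) x
      rw [hp.nilIncl_act, hp.redq_act, hh.act]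
  -- Adding `h₀`, carried to `L` and `L'` by the reduction and the inclusion, cancels `θ` without
  -- changing the reduction of `f`.
  refine ⟨(hf.add hιh).toHom fun l => ?_, DGMod.hom_ext fun z => ?_⟩
  · change f (L.str.d l) + ι'.lin (h₀ (redq π j L (L.str.d l))) =
      L'.str.d (f l + ι'.lin (h₀ (redq π j L l)))
    have a1 := hθt l
    rw [hθ2, hθd, ← redq_d] at a1
    rw [map_add, eq_comm, ← sub_eq_zero]
    rw [← sub_eq_zero] at a1
    rw [← a1]
    abel
  · obtain ⟨l, rfl⟩ := redq_surjective π j L z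
    rw [redMap_redq]
    change redq π j L' (f l + ι'.lin (h₀ (redq π j L l))) = _
    rw [map_add, redq_nilIncl, add_zero, hfq']

/-- Relatively cofibrant free modules whose reductions are isomorphic, compatibly with the classes
of the extensions, are isomorphic in the relative derived category. -/
theorem IsRetraction.nonempty_iso (hp : IsRetraction π j p) (hR : R.IsComm) (hπ : π.SqZero)
    {L L' : DGMod E.toDGAlg}
    (hL : L.IsGradedFree) (hLR : (L.restrict E.algMap).IsGradedFree) (hLc : IsCofib E L)
    (hL' : L'.IsGradedFree) (hLR' : (L'.restrict E.algMap).IsGradedFree) (hLc' : IsCofib E L')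
    (v : (relQ A).obj (redMod π j L) ≅ (relQ A).obj (redMod π j L'))
    (hv : extClass π j hp.base hR hπ L hLR ≫ derTwistMap A π.kerS v.hom =
      v.hom ≫ extClass π j hp.base hR hπ L' hLR') :
    Nonempty ((relQ E).obj L ≅ (relQ E).obj L') := by
  obtain ⟨v₀, hv₀⟩ := (hLc.red π j hp).exists_relQ_map_eq v.hom
  obtain ⟨w₀, hw₀⟩ := (hLc'.red π j hp).exists_relQ_map_eq v.inv
  have hw : extClass π j hp.base hR hπ L' hLR' ≫ derTwistMap A π.kerS v.inv =
      v.inv ≫ extClass π j hp.base hR hπ L hLR := by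
    rw [Iso.eq_inv_comp, ← Category.assoc, ← hv, Category.assoc, ← derTwistMap_comp,
      Iso.hom_inv_id, derTwistMap_id, Category.comp_id]
  rw [← hv₀, derTwistMap_Q] at hv
  rw [← hw₀, derTwistMap_Q] at hw
  obtain ⟨φ, hφ⟩ := hp.exists_redMap_eq hR hπ hL hLR hLc hL' hLR' v₀ hv
  obtain ⟨ψ, hψ⟩ := hp.exists_redMap_eq hR hπ hL' hLR' hLc' hL hLR w₀ hw
  -- The reduction of this composite represents `v.hom ≫ v.inv`, the identity of the derived
  -- category, so it is homotopic to the identity by cofibrancy.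
  have h1 : IsIso ((relQ E).map (φ ≫ ψ)) := by
    refine hp.isIso_of_redMap_homotopic hπ hL hLR _ ?_
    rw [redMap_comp, hφ, hψ]
    refine (hLc.red π j hp).homotopic_of_relQ_map_eq ?_
    rw [CategoryTheory.Functor.map_comp, hv₀, hw₀, Iso.hom_inv_id, CategoryTheory.Functor.map_id]
  have h2 : IsIso ((relQ E).map (ψ ≫ φ)) := by
    refine hp.isIso_of_redMap_homotopic hπ hL' hLR' _ ?_
    rw [redMap_comp, hφ, hψ]
    refine (hLc'.red π j hp).homotopic_of_relQ_map_eq ?_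
    rw [CategoryTheory.Functor.map_comp, hv₀, hw₀, Iso.inv_hom_id, CategoryTheory.Functor.map_id]
  rw [CategoryTheory.Functor.map_comp] at h1 h2
  -- As both composites with `ψ` are invertible, `φ` is a monomorphism and a split epimorphism in
  -- the derived category.
  have h3 : Mono ((relQ E).map φ) := mono_of_mono ((relQ E).map φ) ((relQ E).map ψ)
  have h4 : IsSplitEpi ((relQ E).map φ) := ⟨⟨⟨inv ((relQ E).map ψ ≫ (relQ E).map φ) ≫
    (relQ E).map ψ, by rw [Category.assoc, IsIso.inv_hom_id]⟩⟩⟩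
  have h5 : IsIso ((relQ E).map φ) := isIso_of_mono_of_isSplitEpi _
  exact ⟨asIso ((relQ E).map φ)⟩

end Lifting

/-! ### The retraction `A ⊗_S R ⟶ A` and freeness of `A ⊗_S R` -/

section BaseChange

variable {S : DGAlg k} {R : DGAlgOver S} (A : DGAlgOver S)

theorem tensorAlg_mul_one (a : A.carrier) (r : R.carrier) :
    (HMul.hMul (α := tensorAlg A R) (β := tensorAlg A R) (bmk a 1) (bmk 1 r)) = bmk a r := by
  have h := tensorAlg_mul (A := A) (R := R) a 1 1 r R.one_mem A.one_mem
  rw [h]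
  simp
  rfl

/-- The bilinear map `(a, r) ↦ a π(r)`. -/
def projBil (π : Augmentation R) : A.carrier →ₗ[k] R.carrier →ₗ[k] A.carrier :=
  (LinearMap.mul k A.carrier).compl₂
    (A.algMap.toAlgHom.toLinearMap.comp π.hom.toAlgHom.toLinearMap)

/-- The linear map `A ⊗_S R ⟶ A`, `a ⊗ r ↦ a π(r)`. -/
def projLin (π : Augmentation R) : BC A R →ₗ[k] A.carrier :=
  Tens.lift (X := (DGMod.self A.toDGAlg).restrict A.algMap)
    (N := (DGLMod.self R.toDGAlg).restrict R.algMap) (projBil A π) fun _ _ _ a _ s _ r _ => by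
    change (a * A.algMap s) * A.algMap (π.hom r) = a * A.algMap (π.hom (R.algMap s * r))
    rw [map_mul, π.hom_algMap, map_mul, mul_assoc]

theorem projLin_bmk (π : Augmentation R) (a : A.carrier) (r : R.carrier) :
    projLin A π (bmk a r) = a * A.algMap (π.hom r) :=
  Tens.lift_tmk (X := (DGMod.self A.toDGAlg).restrict A.algMap)
    (N := (DGLMod.self R.toDGAlg).restrict R.algMap) (projBil A π) _ a r

/-- The Koszul sign in the product of `A ⊗_S R` is the one produced by moving the image of `S` past
an element of `A`, by graded centrality. -/
theorem projLin_mul (π : Augmentation R) (x y : BC A R) :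
    projLin A π (BC.mul A R x y) = projLin A π x * projLin A π y := by
  refine BC.induction (P := fun x => projLin A π (BC.mul A R x y) =
    projLin A π x * projLin A π y) (by simp)
    (fun _ _ h h' => by simp only [map_add, LinearMap.add_apply, add_mul, h, h'])
    (fun i p a _ r hr => ?_) x
  refine BC.induction (P := fun y => projLin A π (BC.mul A R (bmk a r) y) =
    projLin A π (bmk a r) * projLin A π y) (by simp)
    (fun _ _ h h' => by simp only [map_add, mul_add, h, h'])
    (fun q l a' ha' r' _ => ?_) y
  rw [BC.mul_bmk a r' hr ha', map_smul, projLin_bmk, projLin_bmk, projLin_bmk, map_mul, map_mul,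
    mul_assoc a (A.algMap (π.hom r)), ← mul_assoc (A.algMap (π.hom r)) a',
    A.central (π.hom.map_deg hr) ha', smul_mul_assoc, mul_smul_comm]
  simp only [mul_assoc]

/-- The morphism `A ⊗_S R ⟶ A`, `a ⊗ r ↦ a π(r)`. -/
noncomputable def tensorProj (π : Augmentation R) : DGAlg.Hom (tensorAlg A R) A.toDGAlg where
  toAlgHom :=
    letI f : tensorAlg A R →ₗ[k] A.toDGAlg := projLin A π
    AlgHom.ofLinearMap f (by
      refine (projLin_bmk A π 1 1).trans ?_
      rw [map_one, map_one, mul_one]) fun x y => projLin_mul A π x y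
  map_deg {m x} hx := by
    refine BC.deg_induction (P := fun x => projLin A π x ∈ A.str.deg m) (by simp)
      (fun _ _ h h' => by rw [map_add]; exact add_mem h h') (fun i q a ha r hr h => ?_) hx
    rw [projLin_bmk, ← h]
    exact A.mul_mem ha (A.algMap.map_deg (π.hom.map_deg hr))
  map_d x := by
    refine BC.induction (P := fun x => projLin A π ((BC.str A R).d x) =
      A.str.d (projLin A π x)) (by simp)
      (fun _ _ h h' => by simp only [map_add, h, h']) (fun i q a ha r _ => ?_) x
    rw [BC.d_bmk ha, map_add, map_smul, projLin_bmk, projLin_bmk, projLin_bmk, A.d_mul _ ha,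
      π.hom.map_d, A.algMap.map_d]

theorem isRetraction_tensorProj (hR : R.IsComm) (π : Augmentation R) :
    IsRetraction π (bcInl hR A) (tensorProj A π) where
  base := bcInl_algMap hR
  left a := by
    refine (projLin_bmk A π a 1).trans ?_
    rw [map_one, map_one, mul_one]
  right r := by
    refine (projLin_bmk A π 1 r).trans ?_
    rw [one_mul]
  gen Q hadd h0 h e := by
    refine BC.induction (P := Q) h0 hadd (fun _ _ a _ r _ => ?_) e
    rw [← tensorAlg_mul_one]
    exact h a r

theorem isGradedFree_baseChange (hR : R.IsComm)
    (hA : ((DGMod.self A.toDGAlg).restrict A.algMap).IsGradedFree) :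
    ((DGMod.self (baseChange A R hR).toDGAlg).restrict
      (baseChange A R hR).algMap).IsGradedFree := by
  obtain ⟨I, n, b, c, hb, hc, hspan⟩ := hA.exists_coord
  obtain ⟨c', hc', hspan'⟩ :=
    Tens.exists_coord ((DGLMod.self R.toDGAlg).restrict R.algMap) c hc hspan
  have hact : ∀ i r, ((DGMod.self (baseChange A R hR).toDGAlg).restrict
      (baseChange A R hR).algMap).act (bmk (b i) 1 : BC A R) r = (bmk (b i) r : BC A R) :=
    fun i r => tensorAlg_mul_one A (b i) r
  refine DGMod.IsGradedFree.of_coord (I := I) (n := n) (b := fun i => (bmk (b i) 1 : BC A R)) c'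
    (fun i => BC.bmk_mem (hb i) R.one_mem (add_zero _)) (fun i r => ?_) fun P h0 hadd h x => ?_
  · rw [hact]
    exact hc' i r
  · refine hspan' P h0 hadd (fun i r => ?_) x
    have := h i r
    rw [hact] at this
    exact this

end BaseChange

/-! ### Deforming the differential, and the trivial deformation -/

section Deform

/-- The right dg module with the differential `d + Γ`. -/
@[reducible] def DGMod.deform {B : DGAlg k} (X : DGMod B) (Γ : X →ₗ[k] X) (hΓ : IsGHom X X 1 Γ)
    (hd : ∀ x, (X.str.d + Γ) ((X.str.d + Γ) x) = 0) : DGMod B where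
  carrier := X.carrier
  str :=
    { deg := X.str.deg
      isInternal := X.str.isInternal
      d := X.str.d + Γ
      d_mem := fun h => add_mem (X.str.d_mem h) (hΓ.deg h)
      d_d := hd }
  act := X.act
  act_one := X.act_one
  act_mul := X.act_mul
  act_mem := X.act_mem
  d_act a hx := by
    simp only [LinearMap.add_apply, map_add]
    rw [X.d_act a hx, hΓ.act, add_right_comm]

variable {S : DGAlg k} {R : DGAlgOver S} {π : Augmentation R} {A : DGAlgOver S}
  {E : DGAlgOver R.toDGAlg} {j : DGAlg.Hom A.toDGAlg E.toDGAlg}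
  {p : DGAlg.Hom E.toDGAlg A.toDGAlg}

/-- The morphism on `L ⊗_R S` given by a morphism on `L`. -/
noncomputable def redDesc {L : DGMod E.toDGAlg} {Y : DGMod A.toDGAlg} (g : L →ₗ[k] Y)
    (hdeg : ∀ {i : ℤ} {l : L}, l ∈ L.str.deg i → g l ∈ Y.str.deg i)
    (hd : ∀ l, g (L.str.d l) = Y.str.d (g l)) (ha : ∀ l a, g (L.act l (j a)) = Y.act (g l) a)
    (hr : ∀ l r, g (L.act l (E.algMap r)) = Y.act (g l) (A.algMap (π.hom r))) :
    redMod π j L ⟶ Y where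
  lin := redLift π j g hr
  map_deg {i z} hz := red_deg_induction π j (P := fun z => redLift π j g hr z ∈ Y.str.deg i)
    (fun l hl => by rw [redLift_redq]; exact hdeg hl) hz
  map_d z := by
    obtain ⟨l, rfl⟩ := redq_surjective π j L z
    rw [← redq_d, redLift_redq, redLift_redq, hd]
  map_act z a := by
    obtain ⟨l, rfl⟩ := redq_surjective π j L z
    rw [← redq_act, redLift_redq, redLift_redq, ha]

theorem redDesc_redq {L : DGMod E.toDGAlg} {Y : DGMod A.toDGAlg} (g : L →ₗ[k] Y) (hdeg) (hd)
    (ha) (hr) (l : L) :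
    (redDesc (π := π) (j := j) g hdeg hd ha hr).lin (redq π j L l) = g l :=
  redLift_redq π j g hr l

/-- Every morphism `γ : L ⊗_R S ⟶ ((L ⊗_R S) ⊗_S 𝔫)[1]` deforms the differential of `L`, and is
the class of the new extension if `L ⟶ L ⊗_R S` splits. -/
theorem IsRetraction.exists_deform (hp : IsRetraction π j p) (hR : R.IsComm) (hπ : π.SqZero)
    {L : DGMod E.toDGAlg} (hL : (L.restrict E.algMap).IsGradedFree)
    (t : redMod π j L ⟶ L.restrict j) (ht : ∀ z, redq π j L (t.lin z) = z)
    (γ : redMod π j L ⟶ (twist A π.kerS).obj (redMod π j L)) :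
    ∃ (L' : DGMod E.toDGAlg) (hL' : (L'.restrict E.algMap).IsGradedFree)
      (ζ : redMod π j L' ≅ redMod π j L),
      extClass π j hp.base hR hπ L' hL' =
        (relQ A).map (ζ.hom ≫ γ ≫ (twist A π.kerS).map ζ.inv) := by
  let ι := nilIncl π j hp.base hπ L
  let γ₀ : redMod π j L →ₗ[k] (redMod π j L).tensor π.kerS := γ.lin
  have hγd : ∀ z, γ₀ ((redMod π j L).str.d z) = -((redMod π j L).tensor π.kerS).str.d (γ₀ z) :=
    γ.map_d
  have hγa : ∀ z a, γ₀ ((redMod π j L).act z a) = ((redMod π j L).tensor π.kerS).act (γ₀ z) a :=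
    γ.map_act
  have hιd : ∀ w, ι.lin (((redMod π j L).tensor π.kerS).str.d w) = L.str.d (ι.lin w) := ι.map_d
  -- The perturbation of the differential. It squares to zero because the reduction kills the image
  -- of `ι`, and it anticommutes with `d` because `γ` is a morphism to a shift. Thus `(d + Γ) ^ 2 =
  -- 0`.
  let Γ : L →ₗ[k] L := ι.lin.comp (γ₀.comp (redq π j L))
  have hΓq : ∀ l, redq π j L (Γ l) = 0 := fun l => redq_nilIncl π j hp.base hπ L _
  have hΓ : IsGHom L L 1 Γ := by
    refine ⟨fun {i l} hl => ι.map_deg (γ.map_deg (redq_deg π j hl)), fun l x => ?_⟩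
    change ι.lin (γ₀ (redq π j L (L.act l x))) = L.act (ι.lin (γ₀ (redq π j L l))) x
    rw [hp.nilIncl_act, hp.redq_act, hγa]
  have hdd : ∀ l, (L.str.d + Γ) ((L.str.d + Γ) l) = 0 := fun l => by
    change L.str.d (L.str.d l + Γ l) + ι.lin (γ₀ (redq π j L (L.str.d l + Γ l))) = 0
    rw [map_add, L.str.d_d, map_add (redq π j L), hΓq, redq_d, add_zero, hγd, map_neg, hιd,
      zero_add]
    exact add_neg_cancel _
  let L' : DGMod E.toDGAlg := L.deform Γ hΓ hdd
  -- Graded freeness does not involve the differential.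
  have hL' : (L'.restrict E.algMap).IsGradedFree := hL
  -- `Γ` takes values in `L 𝔫`, so it disappears in the reduction of `L'` too, and the identity of
  -- the graded module `L` induces inverse isomorphisms between the two reductions.
  have hq0 : ∀ l : L, redq π j L' (Γ l) = 0 := fun l => by
    have : (redq π j L').comp (nilLin π j hp.base hπ L) = 0 := by
      refine nil_hom_ext π j fun a b l hl n hn => ?_
      have hn' : π.hom (n : R.toDGAlg) = 0 := n.2
      rw [LinearMap.comp_apply, nilLin_tmk]
      refine (redq_act_algMap π j hp.base L' l n).trans ?_
      rw [hn', map_zero, map_zero]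
      rfl
    exact LinearMap.congr_fun this _
  let f : redMod π j L' ⟶ redMod π j L := redDesc (L := L') (redq π j L)
    (fun h => redq_deg π j h) (fun l => by
      change redq π j L (L.str.d l + Γ l) = _
      rw [map_add, hΓq, add_zero, redq_d]) (DGDefo.redq_act π j L) (redq_act_algMap π j hp.base L)
  let g : redMod π j L ⟶ redMod π j L' := redDesc (L := L) (redq π j L')
    (fun h => redq_deg π j h) (fun l => by
      rw [← redq_d]
      change _ = redq π j L' (L.str.d l + Γ l)
      rw [map_add, hq0, add_zero]) (DGDefo.redq_act π j L') (redq_act_algMap π j hp.base L')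
  have hf : ∀ l : L, f.lin (redq π j L' l) = redq π j L l :=
    redDesc_redq (L := L') _ _ _ _ _
  have hg : ∀ l : L, g.lin (redq π j L l) = redq π j L' l := redDesc_redq (L := L) _ _ _ _ _
  have hfg : f ≫ g = 𝟙 _ := DGMod.hom_ext fun z => by
    obtain ⟨l, rfl⟩ := redq_surjective π j L' z
    rw [DGMod.comp_lin, hf, hg]
    rfl
  have hgf : g ≫ f = 𝟙 _ := DGMod.hom_ext fun z => by
    obtain ⟨l, rfl⟩ := redq_surjective π j L z
    rw [DGMod.comp_lin, hg, hf]
    rfl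
  refine ⟨L', hL', ⟨f, g, hfg, hgf⟩, ?_⟩
  -- The section `t` commutes with the old differential, so its commutator with `d + Γ` is `Γ t`,
  -- which is `γ` followed by the inclusion.
  refine extClass_eq_of_section π j hp.base hR hπ hL' (t := t.lin.comp f.lin)
    ⟨fun h => by rw [add_zero]; exact t.map_deg (f.map_deg h),
      fun z a => (congrArg t.lin (f.map_act z a)).trans (t.map_act _ _)⟩ (fun z => ?_) _ fun z => ?_
  · have h1 := hg (t.lin (f.lin z))
    rw [ht] at h1
    refine h1.symm.trans ?_
    rw [← DGMod.comp_lin, hfg]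
    rfl
  · have h1 : ∀ w, (nilIncl π j hp.base hπ L').lin ((DGMod.tensorMap g π.kerS).lin w) =
        ι.lin w := fun w =>
      (nilIncl_map π j hp.base hπ (L := L) (L' := L') LinearMap.id (fun _ _ => rfl) g.lin
        (fun z s => g.map_act z _) (fun l => (hg l).symm) w).symm
    refine (h1 (γ₀ (f.lin z))).trans ?_
    change _ = L.str.d (t.lin (f.lin z)) + ι.lin (γ₀ (redq π j L (t.lin (f.lin z)))) -
      t.lin (f.lin ((redMod π j L').str.d z))
    have h2 : t.lin ((redMod π j L).str.d (f.lin z)) = L.str.d (t.lin (f.lin z)) := t.map_d _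
    rw [ht, f.map_d, h2, add_sub_cancel_left]

/-- A graded free dg `A`-module is the reduction of `P ⊗_A E`, and `P ⊗_A E` is split over its
reduction. -/
theorem IsRetraction.exists_split (hp : IsRetraction π j p)
    (hE : ((DGMod.self E.toDGAlg).restrict E.algMap).IsGradedFree) {P : DGMod A.toDGAlg}
    (hP : P.IsGradedFree) :
    ∃ (L : DGMod E.toDGAlg) (_ : (L.restrict E.algMap).IsGradedFree)
      (t : redMod π j L ⟶ L.restrict j) (_ : redMod π j L ≅ P),
      ∀ z, redq π j L (t.lin z) = z := by
  -- The map `x ⊗ e ↦ x p(e)`. It descends to the reduction of `P ⊗_A E`, where its inverse is the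
  -- class of `x ⊗ 1`.
  let c : P.induce j ⟶ P.restrict p := induceDesc (φ := j)
    { lin := LinearMap.id
      map_deg := fun h => h
      map_d := fun _ => rfl
      map_act := fun x a => by
        change P.act x a = P.act x (p (j a))
        rw [hp.left] }
  have hc : ∀ x, c.lin ((induceUnit (φ := j)).lin x) = x := induceDesc_unit _
  let b : redMod π j (P.induce j) ⟶ P := redDesc (L := P.induce j) c.lin c.map_deg c.map_d
    (fun l a => by
      refine (c.map_act l (j a)).trans ?_
      change P.act (c.lin l) (p (j a)) = _
      rw [hp.left]) (fun l r => by
      refine (c.map_act l (E.algMap r)).trans ?_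
      change P.act (c.lin l) (p (E.algMap r)) = _
      rw [hp.right])
  have hb : ∀ l, b.lin (redq π j (P.induce j) l) = c.lin l := redDesc_redq _ _ _ _ _
  let a : P ⟶ redMod π j (P.induce j) := (induceUnit (φ := j)) ≫ quotMapA π j (P.induce j)
  have ha : ∀ x, a.lin x = redq π j (P.induce j) ((induceUnit (φ := j)).lin x) := fun _ => rfl
  have hab : a ≫ b = 𝟙 P := DGMod.hom_ext fun x => by
    rw [DGMod.comp_lin, ha, hb, hc]
    rfl
  have hba : b ≫ a = 𝟙 _ := DGMod.hom_ext fun z => by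
    obtain ⟨l, rfl⟩ := redq_surjective π j _ z
    rw [DGMod.comp_lin, hb, ha]
    have h1 : ∀ e l, c.lin ((P.induce j).act l e) = P.act (c.lin l) (p e) := fun e l =>
      c.map_act l e
    refine Tens.induction (X := P) (N := j.leftMod) (P := fun l => redq π j (P.induce j)
      ((induceUnit (φ := j)).lin (c.lin l)) = redq π j (P.induce j) l) (by simp)
      (fun _ _ h h' => by simp only [map_add, h, h']) (fun _ _ x _ e _ => ?_) l
    have h2 : tmk P j.leftMod x e = (P.induce j).act ((induceUnit (φ := j)).lin x) e := by
      rw [induceUnit_lin, induce_act_tmk, one_mul]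
    have h3 : (induceUnit (φ := j)).lin (P.act x (p e)) =
        (P.induce j).act ((induceUnit (φ := j)).lin x) (j (p e)) :=
      (induceUnit (V := P) (φ := j)).map_act x (p e)
    rw [h2, h1, hc, h3, hp.redq_act, hp.redq_act, hp.left]
  -- The section is `x ↦ x ⊗ 1`, transported along `b`; it is a morphism of dg modules, so the
  -- extension is split.
  refine ⟨P.induce j, (hP.induce j).restrict hE, b ≫ induceUnit (φ := j), ⟨b, a, hba, hab⟩,
    fun z => ?_⟩
  exact congrArg (fun f : redMod π j (P.induce j) ⟶ redMod π j (P.induce j) => f.lin z) hba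

end Deform

/-! ### Classes of deformations and orbits -/

section Classification

variable {S : DGAlg k} {R A : DGAlgOver S} {hR : R.IsComm} {π : Augmentation R}
  (hπ : π.SqZero) {M : DGMod A.toDGAlg}

/-- The class of `(L, u)` is the extension class of `L` transported along `u`, so everything proved
about `extClass` applies. -/
theorem Deformation.cls_eq (D : Deformation hR π M) :
    D.cls hπ = D.iso.inv ≫ extClass π (bcInl hR A) (bcInl_algMap hR) hR hπ D.mod D.free ≫
      derTwistMap A π.kerS D.iso.hom := by
  have h : (relQ A).map (coneCan π (bcInl hR A) (bcInl_algMap hR) hπ D.mod) =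
      (relQ A).map (DGMod.coneFst (mulMapA π (bcInl hR A) D.mod)) ≫
        (relQ A).map ((DGMod.shiftFunctor A.toDGAlg).map
          (canMap π (bcInl hR A) D.mod (bcInl_algMap hR) hπ)) :=
    CategoryTheory.Functor.map_comp _ _ _
  rw [Deformation.cls, connecting, extClass, h]
  exact congrArg (D.iso.inv ≫ ·) ((Category.assoc _ _ _).trans
    ((congrArg (_ ≫ ·) (Category.assoc _ _ _).symm).trans (Category.assoc _ _ _).symm))

/-- The class of a deformation in terms of a morphism to the underlying module. -/
theorem Deformation.map_cls (D : Deformation hR π M) {P : DGMod (baseChange A R hR).toDGAlg}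
    (hP : (P.restrict (baseChange A R hR).algMap).IsGradedFree) (φ : P ⟶ D.mod) :
    ((relQ A).map (redMap π (bcInl hR A) φ) ≫ D.iso.hom) ≫ D.cls hπ =
      extClass π (bcInl hR A) (bcInl_algMap hR) hR hπ P hP ≫
        derTwistMap A π.kerS ((relQ A).map (redMap π (bcInl hR A) φ) ≫ D.iso.hom) := by
  rw [D.cls_eq hπ, derTwistMap_comp, derTwistMap_Q, Category.assoc, Iso.hom_inv_id_assoc,
    ← Category.assoc, ← extClass_naturality π (bcInl hR A) (bcInl_algMap hR) hR hπ hP D.free φ,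
    Category.assoc]

/-- Every class is the class of a deformation. -/
theorem exists_cls_eq (hR : R.IsComm)
    (hA : ((DGMod.self A.toDGAlg).restrict A.algMap).IsGradedFree)
    (hM : (M.restrict A.algMap).IsGradedFree)
    (c : (relQ A).obj M ⟶ (relQ A).obj ((twist A π.kerS).obj M)) :
    ∃ D : Deformation hR π M, D.cls hπ = c := by
  have hp := isRetraction_tensorProj A hR π
  obtain ⟨P, q, hq, hPc, hPf⟩ := exists_resolution hA M hM
  have := isIso_relQ_map A hq
  obtain ⟨L, hL, t, β, ht⟩ := hp.exists_split (isGradedFree_baseChange A hR hA) hPf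
  obtain ⟨U, hU⟩ : ∃ U : (relQ A).obj (redMod π (bcInl hR A) L) ≅ (relQ A).obj M,
      U.hom = (relQ A).map β.hom ≫ (relQ A).map q :=
    ⟨(relQ A).mapIso β ≪≫ asIso ((relQ A).map q), rfl⟩
  -- Cofibrancy of the resolution `P` turns the prescribed class into a morphism of dg modules, by
  -- which the differential of the trivial deformation can be perturbed.
  obtain ⟨f, hf⟩ := hPc.exists_relQ_map_eq (Y := (twist A π.kerS).obj (redMod π (bcInl hR A) L))
    ((relQ A).map q ≫ c ≫ derTwistMap A π.kerS U.inv)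
  have hγ : (relQ A).map (β.hom ≫ f) = U.hom ≫ c ≫ derTwistMap A π.kerS U.inv := by
    rw [CategoryTheory.Functor.map_comp, hf, ← Category.assoc, hU]
  obtain ⟨L', hL', ζ, hext⟩ := hp.exists_deform hR hπ hL t ht (β.hom ≫ f)
  refine ⟨⟨L', hL', (relQ A).mapIso ζ ≪≫ U⟩, ?_⟩
  rw [Deformation.cls_eq]
  change ((relQ A).mapIso ζ ≪≫ U).inv ≫ extClass π (bcInl hR A) (bcInl_algMap hR) hR hπ L' hL' ≫
    derTwistMap A π.kerS ((relQ A).mapIso ζ ≪≫ U).hom = c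
  rw [hext, CategoryTheory.Functor.map_comp, CategoryTheory.Functor.map_comp, hγ, Iso.trans_inv,
    Iso.trans_hom, derTwistMap_comp, Functor.mapIso_hom, Functor.mapIso_inv, derTwistMap_Q]
  have h1 : (relQ A).map ((twist A π.kerS).map ζ.inv) ≫ (relQ A).map ((twist A π.kerS).map ζ.hom)
      = 𝟙 _ := by
    rw [← CategoryTheory.Functor.map_comp, ← CategoryTheory.Functor.map_comp, Iso.inv_hom_id,
      CategoryTheory.Functor.map_id, CategoryTheory.Functor.map_id]
  have h2 : (relQ A).map ζ.inv ≫ (relQ A).map ζ.hom = 𝟙 _ := by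
    rw [← CategoryTheory.Functor.map_comp, Iso.inv_hom_id, CategoryTheory.Functor.map_id]
  have h3 : derTwistMap A π.kerS U.inv ≫ derTwistMap A π.kerS U.hom = 𝟙 _ := by
    rw [← derTwistMap_comp, Iso.inv_hom_id, derTwistMap_id]
  simp only [Category.assoc]
  rw [reassoc_of% h1, reassoc_of% h2, h3, Category.comp_id, Iso.inv_hom_id_assoc]

/-- The classes of isomorphic deformations are in the same orbit. -/
theorem Deformation.cls_orbitRel
    (hA : ((DGMod.self A.toDGAlg).restrict A.algMap).IsGradedFree) (D D' : Deformation hR π M)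
    (α : (relQ (baseChange A R hR)).obj D.mod ≅ (relQ (baseChange A R hR)).obj D'.mod) :
    ∃ f : Aut ((relQ A).obj M), D.cls hπ = MulOpposite.op f • D'.cls hπ := by
  have hE := isGradedFree_baseChange A hR hA
  obtain ⟨P, q, hq, hPc, hPf⟩ := exists_resolution hE D.mod D.free
  have hP := hPf.restrict hE
  have := isIso_relQ_map _ hq
  -- The isomorphism `α` becomes the roof of the morphisms `q` and `ψ` out of `P`, both invertible
  -- in the derived category, to which naturality of the class applies.
  obtain ⟨ψ, hψ⟩ := hPc.exists_relQ_map_eq ((relQ _).map q ≫ α.hom)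
  have : IsIso ((relQ (baseChange A R hR)).map ψ) := by
    rw [hψ]
    infer_instance
  have := isIso_redMap π (bcInl hR A) (bcInl_algMap hR) q
  have := isIso_redMap π (bcInl hR A) (bcInl_algMap hR) ψ
  let a := asIso ((relQ A).map (redMap π (bcInl hR A) q)) ≪≫ D.iso
  let a' := asIso ((relQ A).map (redMap π (bcInl hR A) ψ)) ≪≫ D'.iso
  have h1 : a.hom ≫ D.cls hπ = _ ≫ derTwistMap A π.kerS a.hom := D.map_cls hπ hP q
  have h2 : a'.hom ≫ D'.cls hπ = _ ≫ derTwistMap A π.kerS a'.hom := D'.map_cls hπ hP ψ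
  -- The automorphism of `M` compares its two identifications with the reduction of `P`, one through
  -- each deformation.
  refine ⟨a.symm ≪≫ a', ?_⟩
  change _ = (a.inv ≫ a'.hom) ≫ D'.cls hπ ≫ derTwistMap A π.kerS (a'.inv ≫ a.hom)
  have h3 : derTwistMap A π.kerS a'.hom ≫ derTwistMap A π.kerS a'.inv = 𝟙 _ := by
    rw [← derTwistMap_comp, Iso.hom_inv_id, derTwistMap_id]
  rw [derTwistMap_comp, Category.assoc, reassoc_of% h2, reassoc_of% h3, ← h1,
    Iso.inv_hom_id_assoc]

/-- Deformations whose classes are in the same orbit are isomorphic. -/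
theorem Deformation.nonempty_iso_of_cls
    (hA : ((DGMod.self A.toDGAlg).restrict A.algMap).IsGradedFree) (D D' : Deformation hR π M)
    (f : Aut ((relQ A).obj M)) (hf : D.cls hπ = MulOpposite.op f • D'.cls hπ) :
    Nonempty ((relQ (baseChange A R hR)).obj D.mod ≅ (relQ (baseChange A R hR)).obj D'.mod) := by
  have hp := isRetraction_tensorProj A hR π
  have hE := isGradedFree_baseChange A hR hA
  obtain ⟨P, q, hq, hPc, hPf⟩ := exists_resolution hE D.mod D.free
  obtain ⟨P', q', hq', hPc', hPf'⟩ := exists_resolution hE D'.mod D'.free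
  have := isIso_relQ_map _ hq
  have := isIso_relQ_map _ hq'
  have := isIso_redMap π (bcInl hR A) (bcInl_algMap hR) q
  have := isIso_redMap π (bcInl hR A) (bcInl_algMap hR) q'
  let a := asIso ((relQ A).map (redMap π (bcInl hR A) q)) ≪≫ D.iso
  let a' := asIso ((relQ A).map (redMap π (bcInl hR A) q')) ≪≫ D'.iso
  have h1 : a.hom ≫ D.cls hπ = _ ≫ derTwistMap A π.kerS a.hom :=
    D.map_cls hπ (hPf.restrict hE) q
  have h2 : a'.hom ≫ D'.cls hπ = _ ≫ derTwistMap A π.kerS a'.hom :=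
    D'.map_cls hπ (hPf'.restrict hE) q'
  let g : (relQ A).obj M ≅ (relQ A).obj M := f
  have hg : D.cls hπ = g.hom ≫ D'.cls hπ ≫ derTwistMap A π.kerS g.inv := hf
  have h3 : derTwistMap A π.kerS a'.hom ≫ derTwistMap A π.kerS a'.inv = 𝟙 _ := by
    rw [← derTwistMap_comp, Iso.hom_inv_id, derTwistMap_id]
  have h4 : derTwistMap A π.kerS g.inv ≫ derTwistMap A π.kerS g.hom = 𝟙 _ := by
    rw [← derTwistMap_comp, Iso.inv_hom_id, derTwistMap_id]
  -- The automorphism `g` of `M` is carried to an isomorphism between the reductions of the two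
  -- resolutions. The hypothesis on the orbit says that it respects their extension classes.
  obtain ⟨e⟩ := hp.nonempty_iso hR hπ hPf (hPf.restrict hE) hPc hPf' (hPf'.restrict hE) hPc'
    (a ≪≫ g ≪≫ a'.symm) (by
      change _ ≫ derTwistMap A π.kerS (a.hom ≫ g.hom ≫ a'.inv) = (a.hom ≫ g.hom ≫ a'.inv) ≫ _
      rw [derTwistMap_comp, derTwistMap_comp, ← Category.assoc, ← h1, hg]
      simp only [Category.assoc]
      rw [reassoc_of% h4]
      rw [← Iso.eq_inv_comp] at h2
      rw [h2]
      simp only [Category.assoc]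
      rw [h3, Category.comp_id])
  exact ⟨(asIso ((relQ _).map q)).symm ≪≫ e ≪≫ asIso ((relQ _).map q')⟩

end Classification

end DGDefo

/-! ### The bijection -/

theorem mainTheorem3 {k : Type u} [Field k]
    (S : DGDefo.DGAlg k) (hS : S.IsComm)
    (R : DGDefo.DGAlgOver S) (hR : R.IsComm)
    (π : DGDefo.Augmentation R) (hπ : π.SqZero)
    (A : DGDefo.DGAlgOver S)
    (hA : ((DGDefo.DGMod.self A.toDGAlg).restrict A.algMap).IsGradedFree)
    (M : DGDefo.DGMod A.toDGAlg) (hM : (M.restrict A.algMap).IsGradedFree) :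
    ∃ Φ : DGDefo.WeakDefo hR π M → DGDefo.HomModAut π M,
      (∀ D : DGDefo.Deformation hR π M, Φ D.weakClass = Quotient.mk _ (D.cls hπ)) ∧
        Function.Bijective Φ := by
  -- An arbitrary choice of `u`. By `hsound` the orbit depends only on the isomorphism class of `L`,
  -- so the choice does not matter.
  let toDef : DGDefo.WeakDeformation hR π M → DGDefo.Deformation hR π M := fun W =>
    ⟨W.mod, W.free, W.exists_iso.some⟩
  have hsound : ∀ D D' : DGDefo.Deformation hR π M,
      Nonempty ((DGDefo.relQ _).obj D.mod ≅ (DGDefo.relQ _).obj D'.mod) →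
        (Quotient.mk _ (D.cls hπ) : DGDefo.HomModAut π M) = Quotient.mk _ (D'.cls hπ) := by
    rintro D D' ⟨α⟩
    obtain ⟨f, hf⟩ := D.cls_orbitRel hπ hA D' α
    exact Quotient.sound ⟨MulOpposite.op f, hf.symm⟩
  let Φ : DGDefo.WeakDefo hR π M → DGDefo.HomModAut π M :=
    Quotient.lift (fun W => Quotient.mk _ ((toDef W).cls hπ)) fun W W' h =>
      hsound (toDef W) (toDef W') h
  have hΦ : ∀ D : DGDefo.Deformation hR π M, Φ D.weakClass = Quotient.mk _ (D.cls hπ) :=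
    -- The chosen isomorphism may differ from `D.iso`, but the underlying modules coincide.
    fun D => hsound (toDef ⟨D.mod, D.free, ⟨D.iso⟩⟩) D ⟨Iso.refl _⟩
  refine ⟨Φ, hΦ, ?_, ?_⟩
  · intro x y
    refine Quotient.inductionOn₂ x y fun W W' h => ?_
    obtain ⟨f, hf⟩ : (toDef W).cls hπ ∈ MulAction.orbit _ ((toDef W').cls hπ) := Quotient.exact h
    exact Quotient.sound ((toDef W).nonempty_iso_of_cls hπ hA (toDef W') f.unop hf.symm)
  · intro y
    refine Quotient.inductionOn y fun c => ?_
    obtain ⟨D, hD⟩ := DGDefo.exists_cls_eq hπ hR hA hM c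
    exact ⟨D.weakClass, by rw [hΦ, hD]⟩
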